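/- Fix $0<q<1$; put $q^w=e^{w\log q}$, $(a;p)_n=\prod_{i=0}^{n-1}(1-ap^i)$ and $\begin{bmatrix}n\\k\end{bmatrix}=\frac{(q^2;q^2)_n}{(q^2;q^2)_k(q^2;q^2)_{n-k}}$. Let $M$ be the field of meromorphic functions on $\mathbb C$, with $\bar f(z)=\overline{f(\bar z)}$ and $(T_af)(z)=f(z+a)$, and let $$F(\lambda)=\frac{q^{2(\lambda+1)}-q^{-2}}{q^{2(\lambda+1)}-1},\qquad G(\lambda)=\frac{(q^{2(\lambda+1)}-q^{2})(q^{2(\lambda+1)}-q^{-2})}{(q^{2(\lambda+1)}-1)^2},$$ $$H(\lambda,\mu)=\frac{(q-q^{-1})(q^{2(\lambda+\mu+2)}-1)}{(q^{2(\lambda+1)}-1)(q^{2(\mu+1)}-1)},\qquad I(\lambda,\mu)=\frac{(q-q^{-1})(q^{2(\mu+1)}-q^{2(\lambda+1)})}{(q^{2(\lambda+1)}-1)(q^{2(\mu+1)}-1)}.$$ The algebra. $A=\mathcal F_R(\mathrm{SU}(2))$ is the complex unital algebra generated by $\alpha,\beta,\gamma,\delta$ and two commuting copies of $M$, whose elements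 are written $f(\lambda)=\mu_l(f)$ and $f(\mu)=\mu_r(f)$, with the relations $f(\lambda)x=x\,f(\lambda+a)$, $f(\mu)x=x\,f(\mu+b)$ for $x=\alpha,\beta,\gamma,\delta$ and $(a,b)=(1,1),(1,-1),(-1,1),(-1,-1)$ respectively; $\alpha\beta=qF(\mu-1)\beta\alpha$, $\alpha\gamma=qF(\lambda)\gamma\alpha$, $\beta\delta=qF(\lambda)\delta\beta$, $\gamma\delta=qF(\mu-1)\delta\gamma$; $\alpha\delta-\delta\alpha=H(\lambda,\mu)\gamma\beta$, $G(\mu)\alpha\delta-G(\lambda)\delta\alpha=H(\lambda,\mu)\beta\gamma$, $\beta\gamma-G(\mu)\gamma\beta=I(\lambda,\mu)\delta\alpha$, $\beta\gamma-G(\lambda)\gamma\beta=I(\lambda,\mu)\alpha\delta$; and $\alpha\delta-qF(\lambda)\gamma\beta=1$. It is bigraded by $\mathbb C\times\mathbb C$, $A=\bigoplus A_{ab}$, the generator $x$ having the bidegree $(a,b)$ above and the functions bidegree $(0,0)$. Put $A_a=\bigoplus_bA_{ab}$. An $\mathfrak h$-space is a vector space $V$ over $M$ with a grading $V=\bigoplus_{a\in\mathbb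 C}V_a$ by subspaces over $M$; morphisms are the $M$-linear grade-preserving maps. $A\widetilde\otimes V=\bigoplus_{a,b}A_{ab}\otimes V_b$ modulo $f(\mu)x\otimes v=x\otimes fv$, with $f(x\otimes v)=f(\lambda)x\otimes v$ and $A_{ab}\otimes V_b\subseteq(A\widetilde\otimes V)_a$. With $fx=f(\lambda)x$ and the components $A_a$, $A$ is itself an $\mathfrak h$-space, and $A\widetilde\otimes A$ is an algebra with product $(x\otimes y)(x'\otimes y')=xx'\otimes yy'$. The structure maps. The coproduct $\Delta:A\to A\widetilde\otimes A$ is the algebra homomorphism with $\Delta(f(\lambda))=f(\lambda)\otimes1$, $\Delta(f(\mu))=1\otimes f(\mu)$, $\Delta(\alpha)=\alpha\otimes\alpha+\beta\otimes\gamma$, $\Delta(\beta)=\alpha\otimes\beta+\beta\otimes\delta$, $\Delta(\gamma)=\gamma\otimes\alpha+\delta\otimes\gamma$, $\Delta(\delta)=\gamma\otimes\beta+\delta\otimes\delta$. The counit $\varepsilon$ is the algebra homomorphism to the difference operators on $M$ with $\varepsilon(f(\lambda))=\varepsilon(f(\mu))=f$, $\varepsilon(\alpha)=T_{-1}$, $\varepsilon(\beta)=\varepsilon(\gamma)=0$,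 $\varepsilon(\delta)=T_1$. The antipode $S$ is the algebra antihomomorphism with $S(f(\lambda))=f(\mu)$, $S(f(\mu))=f(\lambda)$, $S(\alpha)=\frac{F(\lambda)}{F(\mu)}\delta$, $S(\beta)=-\frac{q^{-1}}{F(\mu)}\beta$, $S(\gamma)=-qF(\lambda)\gamma$, $S(\delta)=\alpha$. The star is the antilinear algebra antihomomorphism with $\alpha^*=\delta$, $\beta^*=-q\gamma$, $\gamma^*=-q^{-1}\beta$, $\delta^*=\alpha$, $f(\lambda)^*=\bar f(\lambda)$, $f(\mu)^*=\bar f(\mu)$. Corepresentations. A corepresentation on an $\mathfrak h$-space $V$ is a morphism $\pi:V\to A\widetilde\otimes V$ with $(\Delta\otimes\mathrm{id})\pi=(\mathrm{id}\otimes\pi)\pi$ and $(\varepsilon\otimes\mathrm{id})\pi=\mathrm{id}$, where $fT_{-a}\otimes v$, for $v\in V_a$, is identified with $fv$. It is called unitarizable if $V$ has a homogeneous basis $(v_k)$ over $M$, with matrix elements $t_{kj}$ given by $\pi(v_k)=\sum_jt_{kj}\otimes v_j$, and functions $0\ne\Gamma_k\in M$ with $\bar\Gamma_k=\Gamma_k$,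 such that $\Gamma_k(\mu)S(t_{kj})^*=\Gamma_j(\lambda)t_{jk}$ for all $k,j$. Let $N\ge0$ be an integer, let $V_N\subseteq A$ be the $\mu_l(M)$-span of the elements $\gamma^{N-k}\alpha^k$, $0\le k\le N$, with the grading inherited from $A=\bigoplus_aA_a$, and for $0\le k,j\le N$ let $$t^N_{kj}=\sum_{l=\max(0,j+k-N)}^{\min(j,k)}\begin{bmatrix}N-k\\j-l\end{bmatrix}\begin{bmatrix}k\\l\end{bmatrix}q^{j(j+2k-N)+l(3l-3k-3j+N)}\frac{(q^{2(j-N-\mu-1)};q^2)_{j-l}}{(q^{2(j+k-l-N-\mu-1)};q^2)_{j-l}}\,\gamma^{j-l}\delta^{N-k-j+l}\alpha^l\beta^{k-l},$$ $$\Gamma_k(\lambda)=\begin{bmatrix}N\\k\end{bmatrix}\frac{(q^{2(k-N-\lambda-1)};q^2)_k}{(q^{-2\lambda};q^2)_k}.$$ Proposition. (i) In $\mathcal F_R(\mathrm{SU}(2))$, for all $0\le k,j\le N$, $$\begin{bmatrix}N\\k\end{bmatrix}\frac{(q^{2(k-N-\mu-1)};q^2)_k}{(q^{-2\mu};q^2)_k}\,S(t^N_{kj})^*=\begin{bmatrix}N\\j\end{bmatrix}\frac{(q^{2(j-N-\lambda-1)};q^2)_j}{(q^{-2\lambda};q^2)_j}\,t^N_{jk}.$$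 (ii) $\Delta$ restricts to a corepresentation of $\mathcal F_R(\mathrm{SU}(2))$ on $V_N$, and this corepresentation is unitarizable. More precisely, $(\gamma^{N-k}\alpha^k)_{0\le k\le N}$ is a basis of $V_N$ over $M$, with $\gamma^{N-k}\alpha^k$ of degree $2k-N$, its matrix elements are the $t^N_{kj}$, and the functions $\Gamma_k$ above have the properties required in the definition. (iii) For all $0\le k,l\le N$, $$\delta_{kl}=\sum_{j=0}^N(t^N_{jk})^*\,\frac{\Gamma_j(\lambda)}{\Gamma_k(\mu)}\,t^N_{jl}=\sum_{j=0}^Nt^N_{kj}\,(t^N_{lj})^*\,\frac{\Gamma_l(\lambda)}{\Gamma_j(\mu)}.$$ -/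

import Mathlib

noncomputable section

namespace DynSU2

open Filter Topology
open scoped TensorProduct

/-! ## Meromorphic functions on `ℂ` -/

/-- The algebra of functions `ℂ → ℂ` that are meromorphic at every point. -/
def merSub : Subalgebra ℂ (ℂ → ℂ) where
  carrier := {f | Meromorphic f}
  mul_mem' hf hg := hf.mul hg
  add_mem' hf hg := hf.add hg
  algebraMap_mem' c := Meromorphic.const c

/-- The functions that vanish outside a closed discrete set. -/
def merIdeal : Ideal merSub where
  carrier := {f | ∀ x : ℂ, ∀ᶠ z in 𝓝[≠] x, f.1 z = 0}
  add_mem' {f g} hf hg x := by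
    filter_upwards [hf x, hg x] with z h1 h2
    change f.1 z + g.1 z = 0
    rw [h1, h2, add_zero]
  zero_mem' x := Eventually.of_forall fun z => rfl
  smul_mem' c f hf x := by
    filter_upwards [hf x] with z h
    change c.1 z * f.1 z = 0
    rw [h, mul_zero]

theorem merIdeal_isMaximal : merIdeal.IsMaximal := by
  rw [Ideal.isMaximal_iff]
  constructor
  · intro h
    obtain ⟨z, hz⟩ := (h (0 : ℂ)).exists
    exact one_ne_zero (α := ℂ) hz
  · intro J f hJ hf hfJ
    have hne : ∀ x : ℂ, meromorphicOrderAt f.1 x ≠ ⊤ := by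
      have hf2 : ¬ ∀ x : ℂ, ∀ᶠ z in 𝓝[≠] x, f.1 z = 0 := hf
      obtain ⟨x, hx⟩ := not_forall.1 hf2
      have hx' : meromorphicOrderAt f.1 x ≠ ⊤ := by
        rw [Ne, meromorphicOrderAt_eq_top_iff]
        exact fun h => hx h
      intro y
      exact (Meromorphic.meromorphicOn f.2 (s := Set.univ)).meromorphicOrderAt_ne_top_of_isPreconnected
        isPreconnected_univ (Set.mem_univ x) (Set.mem_univ y) hx'
    let g : merSub := ⟨f.1⁻¹, Meromorphic.inv f.2⟩
    have h1 : (1 : merSub) - g * f ∈ merIdeal := by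
      intro x
      filter_upwards [(meromorphicOrderAt_ne_top_iff_eventually_ne_zero (f.2 x)).1 (hne x)]
        with z hz
      change (1 : ℂ) - (f.1 z)⁻¹ * f.1 z = 0
      rw [inv_mul_cancel₀ hz, sub_self]
    have h2 : g * f ∈ J := J.mul_mem_left g hfJ
    simpa using J.add_mem (hJ h1) h2

/-- The field of meromorphic functions on `𝔥* = ℂ`: functions meromorphic at every point, two of
them being identified when they agree outside a closed discrete set. -/
def Mer : Type := merSub ⧸ merIdeal

instance : CommRing Mer := inferInstanceAs (CommRing (merSub ⧸ merIdeal))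

instance : Algebra ℂ Mer := inferInstanceAs (Algebra ℂ (merSub ⧸ merIdeal))

theorem Mer.isField : IsField Mer :=
  (Ideal.Quotient.maximal_ideal_iff_isField_quotient merIdeal).1 merIdeal_isMaximal

instance : Inv Mer := ⟨fun f => Mer.isField.toField.inv f⟩

instance : Field Mer where
  exists_pair_ne := Mer.isField.exists_pair_ne
  mul_inv_cancel f hf := Mer.isField.toField.mul_inv_cancel f hf
  inv_zero := Mer.isField.toField.inv_zero
  nnqsmul := _
  nnqsmul_def := fun _ _ => rfl
  qsmul := _
  qsmul_def := fun _ _ => rfl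

/-- The class of a meromorphic function in `Mer`. -/
def Mer.mk (f : ℂ → ℂ) (hf : Meromorphic f) : Mer := Ideal.Quotient.mk merIdeal ⟨f, hf⟩

theorem Mer.mk_eq_mk {f g : ℂ → ℂ} (hf : Meromorphic f) (hg : Meromorphic g) :
    Mer.mk f hf = Mer.mk g hg ↔ ∀ x : ℂ, ∀ᶠ z in 𝓝[≠] x, f z = g z := by
  refine Ideal.Quotient.eq.trans ?_
  change (∀ x : ℂ, ∀ᶠ z in 𝓝[≠] x, f z - g z = 0) ↔ _
  simp only [sub_eq_zero]

theorem Mer.ind {P : Mer → Prop} (h : ∀ f hf, P (Mer.mk f hf)) (x : Mer) : P x := by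
  obtain ⟨⟨f, hf⟩, rfl⟩ := Ideal.Quotient.mk_surjective x
  exact h f hf

theorem tendsto_add_punctured (x a : ℂ) : Tendsto (fun z => z + a) (𝓝[≠] x) (𝓝[≠] (x + a)) := by
  refine tendsto_nhdsWithin_iff.2 ⟨?_, ?_⟩
  · exact ((continuous_id.add continuous_const).tendsto x).mono_left nhdsWithin_le_nhds
  · filter_upwards [self_mem_nhdsWithin] with z hz
    simpa using hz

theorem tendsto_conj_punctured (x : ℂ) :
    Tendsto (fun z => (starRingEnd ℂ) z) (𝓝[≠] x) (𝓝[≠] ((starRingEnd ℂ) x)) := by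
  refine tendsto_nhdsWithin_iff.2 ⟨?_, ?_⟩
  · exact (Complex.continuous_conj.tendsto x).mono_left nhdsWithin_le_nhds
  · filter_upwards [self_mem_nhdsWithin] with z hz
    intro h
    exact hz ((starRingEnd ℂ).injective h)

theorem meromorphic_shift {f : ℂ → ℂ} (hf : Meromorphic f) (a : ℂ) :
    Meromorphic (fun z => f (z + a)) := fun x =>
  (hf (x + a)).comp_analyticAt (g := fun z => z + a) (by fun_prop)

theorem analyticAt_conj {f : ℂ → ℂ} {x : ℂ} (hf : AnalyticAt ℂ f ((starRingEnd ℂ) x)) :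
    AnalyticAt ℂ (fun z => (starRingEnd ℂ) (f ((starRingEnd ℂ) z))) x := by
  rw [Complex.analyticAt_iff_eventually_differentiableAt] at hf ⊢
  have := (Complex.continuous_conj.tendsto x).eventually hf
  filter_upwards [this] with z hz
  exact (differentiableAt_conj_conj_iff (f := f)).2 hz

theorem meromorphic_conj {f : ℂ → ℂ} (hf : Meromorphic f) :
    Meromorphic (fun z => (starRingEnd ℂ) (f ((starRingEnd ℂ) z))) := by
  intro x
  obtain ⟨n, hn⟩ := hf ((starRingEnd ℂ) x)
  refine ⟨n, ?_⟩
  have := analyticAt_conj hn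
  simpa using this

/-- The automorphism `T_a`, `(T_a f)(z) = f (z + a)`, on representatives. -/
def merShift (a : ℂ) : merSub →ₐ[ℂ] merSub where
  toFun f := ⟨fun z => f.1 (z + a), meromorphic_shift f.2 a⟩
  map_one' := rfl
  map_mul' _ _ := rfl
  map_zero' := rfl
  map_add' _ _ := rfl
  commutes' _ := rfl

/-- The automorphism `T_a` of `Mer`, `(T_a f)(z) = f (z + a)`. -/
def Mer.T (a : ℂ) : Mer →ₐ[ℂ] Mer :=
  Ideal.quotientMapₐ merIdeal (merShift a) (by
    intro f hf x
    exact (tendsto_add_punctured x a).eventually (hf (x + a)))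

theorem Mer.T_mk (a : ℂ) (f : ℂ → ℂ) (hf : Meromorphic f) :
    Mer.T a (Mer.mk f hf) = Mer.mk (fun z => f (z + a)) (meromorphic_shift hf a) := rfl

/-- The conjugation `f̄ (z) = conj (f (conj z))`, on representatives. -/
def merConj : merSub →+* merSub where
  toFun f := ⟨fun z => (starRingEnd ℂ) (f.1 ((starRingEnd ℂ) z)), meromorphic_conj f.2⟩
  map_one' := by ext z; simp
  map_mul' _ _ := by ext z; simp
  map_zero' := by ext z; simp
  map_add' _ _ := by ext z; simp

/-- The conjugation `f̄ (z) = conj (f (conj z))` of `Mer`. -/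
def Mer.bar : Mer →+* Mer :=
  Ideal.quotientMap merIdeal merConj (by
    intro f hf x
    have := (tendsto_conj_punctured x).eventually (hf ((starRingEnd ℂ) x))
    filter_upwards [this] with z hz
    change (starRingEnd ℂ) (f.1 ((starRingEnd ℂ) z)) = 0
    rw [hz, map_zero])

theorem Mer.bar_mk (f : ℂ → ℂ) (hf : Meromorphic f) :
    Mer.bar (Mer.mk f hf) =
      Mer.mk (fun z => (starRingEnd ℂ) (f ((starRingEnd ℂ) z))) (meromorphic_conj hf) := rfl

theorem Mer.algebraMap_eq (c : ℂ) :
    algebraMap ℂ Mer c = Mer.mk (fun _ => c) (Meromorphic.const c) := rfl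

theorem Mer.T_T (a b : ℂ) (f : Mer) : Mer.T a (Mer.T b f) = Mer.T (a + b) f := by
  induction f using Mer.ind with
  | h f hf =>
    simp only [Mer.T_mk, Mer.mk_eq_mk]
    intro x
    exact Eventually.of_forall fun z => by ring_nf

theorem Mer.T_zero (f : Mer) : Mer.T 0 f = f := by
  induction f using Mer.ind with
  | h f hf =>
    simp only [Mer.T_mk, Mer.mk_eq_mk]
    intro x
    exact Eventually.of_forall fun z => by simp

theorem Mer.bar_algebraMap (c : ℂ) :
    Mer.bar (algebraMap ℂ Mer c) = algebraMap ℂ Mer ((starRingEnd ℂ) c) := rfl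

theorem Mer.bar_T (a : ℂ) (f : Mer) : Mer.bar (Mer.T a f) = Mer.T ((starRingEnd ℂ) a) (Mer.bar f) := by
  induction f using Mer.ind with
  | h f hf =>
    simp only [Mer.T_mk, Mer.bar_mk, Mer.mk_eq_mk]
    intro x
    exact Eventually.of_forall fun z => by simp

/-- The function `z ↦ q ^ (a z + b)`, where `q ^ w = exp (w log q)` for `q > 0`. -/
def qE (q : ℝ) (a b : ℂ) : Mer :=
  Mer.mk (fun z => Complex.exp ((a * z + b) * (Real.log q : ℂ)))
    (fun _ => AnalyticAt.meromorphicAt (by fun_prop))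

theorem qE_T (q : ℝ) (a b c : ℂ) : Mer.T c (qE q a b) = qE q a (a * c + b) :=
  (Mer.mk_eq_mk _ _).2 fun x => Eventually.of_forall fun z => by ring_nf

theorem qE_bar (q : ℝ) (a b : ℂ) :
    Mer.bar (qE q a b) = qE q ((starRingEnd ℂ) a) ((starRingEnd ℂ) b) :=
  (Mer.mk_eq_mk _ _).2 fun x => Eventually.of_forall fun z => by
    rw [← Complex.exp_conj]; simp [Complex.conj_ofReal]

theorem qE_meromorphic (q : ℝ) (a b : ℂ) :
    Meromorphic (fun z => Complex.exp ((a * z + b) * (Real.log q : ℂ))) :=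
  fun _ => AnalyticAt.meromorphicAt (by fun_prop)

theorem qE_add (q : ℝ) (a b a' b' : ℂ) : qE q (a + a') (b + b') = qE q a b * qE q a' b' :=
  (Mer.mk_eq_mk (qE_meromorphic _ _ _)
    ((qE_meromorphic q a b).mul (qE_meromorphic q a' b'))).2 fun x =>
      Eventually.of_forall fun z => by
        change _ = Complex.exp _ * Complex.exp _
        rw [← Complex.exp_add]; congr 1; ring

theorem qE_const (q : ℝ) (b : ℂ) :
    qE q 0 b = algebraMap ℂ Mer (Complex.exp (b * (Real.log q : ℂ))) :=
  (Mer.mk_eq_mk _ _).2 fun x => Eventually.of_forall fun z => by simp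

theorem qE_ne_zero (q : ℝ) (a b : ℂ) : qE q a b ≠ 0 := by
  intro h
  have h1 := qE_add q a b (-a) (-b)
  rw [h, zero_mul, add_neg_cancel, add_neg_cancel, qE_const] at h1
  simp at h1

/-- A non-constant exponential differs from every constant. -/
theorem qE_ne_const {q : ℝ} (hq : Real.log q ≠ 0) {a : ℂ} (ha : a ≠ 0) (b c : ℂ) :
    qE q a b - algebraMap ℂ Mer c ≠ 0 := by
  intro h
  rw [sub_eq_zero] at h
  have hL : (Real.log q : ℂ) ≠ 0 := by exact_mod_cast hq
  have h1 := congrArg (Mer.T (1 / (a * (Real.log q : ℂ)))) h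
  rw [qE_T, AlgHom.commutes, ← h] at h1
  have h2 := qE_add q 0 (a * (1 / (a * (Real.log q : ℂ)))) a b
  rw [zero_add, h1, qE_const] at h2
  have h3 : algebraMap ℂ Mer 1 =
      algebraMap ℂ Mer (Complex.exp (a * (1 / (a * (Real.log q : ℂ))) * (Real.log q : ℂ))) := by
    rw [map_one]
    exact mul_right_cancel₀ (qE_ne_zero q a b) (by rw [one_mul]; exact h2)
  have h4 := (algebraMap ℂ Mer).injective h3
  have h5 : a * (1 / (a * (Real.log q : ℂ))) * (Real.log q : ℂ) = ((1 : ℝ) : ℂ) := by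
    push_cast; field_simp
  rw [h5, ← Complex.ofReal_exp] at h4
  have h6 : (1 : ℝ) = Real.exp 1 := by exact_mod_cast h4
  have := Real.add_one_lt_exp (x := 1) one_ne_zero
  linarith

/-! ## The structure functions -/

/-- The deformation parameter, `0 < q < 1`. -/
abbrev QParam : Type := Set.Ioo (0 : ℝ) 1

/-- `q` as a complex number. -/
def qc (q : QParam) : ℂ := ((q : ℝ) : ℂ)

/-- Complex constants as meromorphic functions. -/
def cst : ℂ →+* Mer := algebraMap ℂ Mer

/-- The function `X(λ) = q ^ (2 (λ + 1))`. -/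
def fX (q : QParam) : Mer := qE q 2 2

/-- `F(λ) = (q ^ (2 (λ + 1)) - q ^ (-2)) / (q ^ (2 (λ + 1)) - 1)`. -/
def fF (q : QParam) : Mer := (fX q - cst (qc q ^ (-2 : ℤ))) / (fX q - 1)

/-- `G(λ) = (q ^ (2 (λ + 1)) - q ^ 2) (q ^ (2 (λ + 1)) - q ^ (-2)) / (q ^ (2 (λ + 1)) - 1) ^ 2`. -/
def fG (q : QParam) : Mer :=
  (fX q - cst (qc q ^ 2)) * (fX q - cst (qc q ^ (-2 : ℤ))) / (fX q - 1) ^ 2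

/-- `M ⊗ M`, for `M = Mer`: the functions `∑ f(λ) g(μ)` of two variables, `f ⊗ g` standing for
`f(λ) g(μ)`. -/
def Mer2 : Type := Mer ⊗[ℂ] Mer

instance : CommRing Mer2 := inferInstanceAs (CommRing (Mer ⊗[ℂ] Mer))
instance : Algebra ℂ Mer2 := inferInstanceAs (Algebra ℂ (Mer ⊗[ℂ] Mer))

/-- `f(λ)` in `M ⊗ M`. -/
def inL : Mer →ₐ[ℂ] Mer2 :=
  (Algebra.TensorProduct.includeLeft : Mer →ₐ[ℂ] Mer ⊗[ℂ] Mer)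

/-- `f(μ)` in `M ⊗ M`. -/
def inR : Mer →ₐ[ℂ] Mer2 :=
  (Algebra.TensorProduct.includeRight : Mer →ₐ[ℂ] Mer ⊗[ℂ] Mer)

/-- `H(λ, μ) = (q - q⁻¹) (q ^ (2 (λ + μ + 2)) - 1) /
((q ^ (2 (λ + 1)) - 1) (q ^ (2 (μ + 1)) - 1))`. -/
def fH (q : QParam) : Mer2 :=
  (qc q - (qc q)⁻¹) • ((inL (fX q) * inR (fX q) - 1) * (inL (fX q - 1)⁻¹ * inR (fX q - 1)⁻¹))

/-- `I(λ, μ) = (q - q⁻¹) (q ^ (2 (μ + 1)) - q ^ (2 (λ + 1))) /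
((q ^ (2 (λ + 1)) - 1) (q ^ (2 (μ + 1)) - 1))`. -/
def fI (q : QParam) : Mer2 :=
  (qc q - (qc q)⁻¹) • ((inR (fX q) - inL (fX q)) * (inL (fX q - 1)⁻¹ * inR (fX q - 1)⁻¹))

/-- `F(λ - 1)`. -/
def fFm (q : QParam) : Mer := Mer.T (-1) (fF q)

theorem qc_ne_zero (q : QParam) : qc q ≠ 0 := by
  have := q.2.1
  simp only [qc, ne_eq, Complex.ofReal_eq_zero]
  exact this.ne'

theorem log_q_ne_zero (q : QParam) : Real.log (q : ℝ) ≠ 0 :=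
  (Real.log_neg q.2.1 q.2.2).ne

theorem exp_log_q (q : QParam) (n : ℤ) :
    Complex.exp ((n : ℂ) * (Real.log (q : ℝ) : ℂ)) = qc q ^ n := by
  rw [Complex.exp_int_mul, ← Complex.ofReal_exp, Real.exp_log q.2.1, qc]

theorem Mer.T_cst (a c : ℂ) : Mer.T a (cst c) = cst c := AlgHom.commutes _ _

theorem Mer.bar_cst (c : ℂ) : Mer.bar (cst c) = cst ((starRingEnd ℂ) c) := rfl

theorem fX_T (q : QParam) (n : ℤ) : Mer.T n (fX q) = cst (qc q ^ (2 * n)) * fX q := by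
  rw [fX, qE_T, ← exp_log_q, cst, ← qE_const, ← qE_add]
  push_cast
  congr 1; ring

theorem fX_sub_ne (q : QParam) (c : ℂ) : fX q - cst c ≠ 0 :=
  qE_ne_const (log_q_ne_zero q) two_ne_zero 2 c

theorem fX_sub_one_ne (q : QParam) : fX q - 1 ≠ 0 := by
  have := fX_sub_ne q 1
  rwa [cst, map_one] at this

theorem fF_ne_zero (q : QParam) : fF q ≠ 0 :=
  div_ne_zero (fX_sub_ne q _) (fX_sub_one_ne q)

theorem fFm_ne_zero (q : QParam) : fFm q ≠ 0 := by
  rw [fFm, ne_eq, map_eq_zero]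
  exact fF_ne_zero q

theorem cst_q_ne_zero (q : QParam) : cst (qc q) ≠ 0 := by
  rw [cst, ne_eq, map_eq_zero]
  exact qc_ne_zero q

theorem fFm_eq (q : QParam) : fFm q = (fX q - 1) / (fX q - cst (qc q ^ 2)) := by
  have hq := cst_q_ne_zero q
  have h1 := fX_sub_ne q (qc q ^ 2)
  have hT : Mer.T (-1) (fX q) = (cst (qc q) ^ 2)⁻¹ * fX q := by
    have := fX_T q (-1)
    push_cast at this
    rw [this]
    simp [zpow_neg]
  have h2 : (cst (qc q) ^ 2)⁻¹ * fX q - 1 ≠ 0 := by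
    have : (cst (qc q) ^ 2)⁻¹ * fX q - 1 = (cst (qc q) ^ 2)⁻¹ * (fX q - cst (qc q ^ 2)) := by
      rw [map_pow]; field_simp
    rw [this]
    exact mul_ne_zero (inv_ne_zero (pow_ne_zero 2 hq)) h1
  rw [fFm, fF, map_div₀, map_sub, map_sub, map_one, Mer.T_cst, hT,
    div_eq_div_iff h2 h1, zpow_neg, map_inv₀, map_zpow₀, map_pow]
  simp only [zpow_ofNat]
  field_simp

theorem fG_eq (q : QParam) : fG q = fF q * (fFm q)⁻¹ := by
  have h1 := fX_sub_ne q (qc q ^ 2)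
  have h2 := fX_sub_one_ne q
  rw [fG, fFm_eq, fF, inv_div]
  field_simp

theorem fF_lin (q : QParam) :
    cst (qc q) * fF q = cst (qc q) + (cst (qc q) - (cst (qc q))⁻¹) * (fX q - 1)⁻¹ := by
  have hq := cst_q_ne_zero q
  have h2 := fX_sub_one_ne q
  rw [fF, zpow_neg, map_inv₀, map_zpow₀]
  simp only [zpow_ofNat]
  field_simp
  ring

theorem fFm_lin (q : QParam) :
    (cst (qc q))⁻¹ * (fFm q)⁻¹ =
      (cst (qc q))⁻¹ - (cst (qc q) - (cst (qc q))⁻¹) * (fX q - 1)⁻¹ := by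
  have hq := cst_q_ne_zero q
  have h2 := fX_sub_one_ne q
  have h1 := fX_sub_ne q (qc q ^ 2)
  rw [fFm_eq, inv_div, map_pow]
  rw [map_pow] at h1
  field_simp
  ring

/-- `q + q⁻¹ = q F(λ) + q⁻¹ / F(λ - 1)`. -/
theorem fF_add_fFm (q : QParam) :
    cst (qc q) * fF q + (cst (qc q))⁻¹ * (fFm q)⁻¹ = cst (qc q) + (cst (qc q))⁻¹ := by
  rw [fF_lin, fFm_lin]; ring

/-- Scalars `c` in `M ⊗ M`. -/
def kst : ℂ →+* Mer2 := algebraMap ℂ Mer2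

theorem inL_cst (c : ℂ) : inL (cst c) = kst c := AlgHom.commutes _ _

theorem inR_cst (c : ℂ) : inR (cst c) = kst c := AlgHom.commutes _ _

theorem inL_mul_inv {f : Mer} (hf : f ≠ 0) : inL f * inL f⁻¹ = 1 := by
  rw [← map_mul, mul_inv_cancel₀ hf, map_one]

theorem inR_mul_inv {f : Mer} (hf : f ≠ 0) : inR f * inR f⁻¹ = 1 := by
  rw [← map_mul, mul_inv_cancel₀ hf, map_one]

theorem kst_q_mul (q : QParam) : kst (qc q) * kst (qc q)⁻¹ = 1 := by
  rw [← map_mul, mul_inv_cancel₀ (qc_ne_zero q), map_one]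

theorem inL_fF_lin (q : QParam) : kst (qc q) * inL (fF q) =
    kst (qc q) + (kst (qc q) - kst (qc q)⁻¹) * inL (fX q - 1)⁻¹ := by
  have := congrArg inL (fF_lin q)
  simpa only [← map_inv₀ cst, map_mul, map_add, map_sub, inL_cst] using this

theorem inR_fF_lin (q : QParam) : kst (qc q) * inR (fF q) =
    kst (qc q) + (kst (qc q) - kst (qc q)⁻¹) * inR (fX q - 1)⁻¹ := by
  have := congrArg inR (fF_lin q)
  simpa only [← map_inv₀ cst, map_mul, map_add, map_sub, inR_cst] using this

theorem inL_fFm_lin (q : QParam) : kst (qc q)⁻¹ * inL (fFm q)⁻¹ =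
    kst (qc q)⁻¹ - (kst (qc q) - kst (qc q)⁻¹) * inL (fX q - 1)⁻¹ := by
  have := congrArg inL (fFm_lin q)
  simpa only [← map_inv₀ cst, map_mul, map_add, map_sub, inL_cst] using this

theorem inR_fFm_lin (q : QParam) : kst (qc q)⁻¹ * inR (fFm q)⁻¹ =
    kst (qc q)⁻¹ - (kst (qc q) - kst (qc q)⁻¹) * inR (fX q - 1)⁻¹ := by
  have := congrArg inR (fFm_lin q)
  simpa only [← map_inv₀ cst, map_mul, map_add, map_sub, inR_cst] using this

theorem fH_eq (q : QParam) :
    fH q = kst (qc q) * inL (fF q) - kst (qc q)⁻¹ * inR (fFm q)⁻¹ := by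
  have h1 := inL_mul_inv (fX_sub_one_ne q)
  have h2 := inR_mul_inv (fX_sub_one_ne q)
  rw [map_sub, map_one] at h1
  rw [map_sub, map_one] at h2
  rw [inL_fF_lin, inR_fFm_lin, fH, Algebra.smul_def, ← kst, map_sub]
  linear_combination (kst (qc q) - kst (qc q)⁻¹) *
    (h1 * (inR (fX q) * inR (fX q - 1)⁻¹) + h2 + (inL (fX q - 1)⁻¹) * h2)

theorem fI_eq (q : QParam) :
    fI q = kst (qc q) * inL (fF q) - kst (qc q) * inR (fF q) := by
  have h1 := inL_mul_inv (fX_sub_one_ne q)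
  have h2 := inR_mul_inv (fX_sub_one_ne q)
  rw [map_sub, map_one] at h1
  rw [map_sub, map_one] at h2
  rw [inL_fF_lin, inR_fF_lin, fI, Algebra.smul_def, ← kst, map_sub]
  linear_combination (kst (qc q) - kst (qc q)⁻¹) *
    (h2 * inL (fX q - 1)⁻¹ - h1 * inR (fX q - 1)⁻¹)

theorem fI_eq' (q : QParam) :
    fI q = kst (qc q)⁻¹ * inR (fFm q)⁻¹ - kst (qc q)⁻¹ * inL (fFm q)⁻¹ := by
  rw [fI_eq, inL_fF_lin, inR_fF_lin, inL_fFm_lin, inR_fFm_lin]; ring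

/-! ## The algebra `F_R(SL(2))` -/

/-- Generators: the coefficients `∑ f(λ) g(μ)`, and `α, β, γ, δ`. -/
inductive Gen : Type
  | coef (x : Mer2)
  | al
  | be
  | ga
  | de

namespace Gen

/-- The generator of the free algebra given by a coefficient. -/
abbrev S (x : Mer2) : FreeAlgebra ℂ Gen := FreeAlgebra.ι ℂ (Gen.coef x)
/-- The generator `α` of the free algebra. -/
abbrev A : FreeAlgebra ℂ Gen := FreeAlgebra.ι ℂ Gen.al
/-- The generator `β` of the free algebra. -/
abbrev B : FreeAlgebra ℂ Gen := FreeAlgebra.ι ℂ Gen.be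
/-- The generator `γ` of the free algebra. -/
abbrev C : FreeAlgebra ℂ Gen := FreeAlgebra.ι ℂ Gen.ga
/-- The generator `δ` of the free algebra. -/
abbrev D : FreeAlgebra ℂ Gen := FreeAlgebra.ι ℂ Gen.de

end Gen

open Gen in
/-- The defining relations of `F_R(M(2))`, together with the determinant relation
`α δ - q F(λ) γ β = 1`. The first three say that the two copies of the field `Mer` commute and form
a homomorphic image of `Mer ⊗ Mer`. -/
inductive Rel (q : QParam) : FreeAlgebra ℂ Gen → FreeAlgebra ℂ Gen → Prop
  | coef_add (x y : Mer2) : Rel q (S (x + y)) (S x + S y)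
  | coef_mul (x y : Mer2) : Rel q (S (x * y)) (S x * S y)
  | coef_cst (c : ℂ) : Rel q (S (algebraMap ℂ Mer2 c)) (algebraMap ℂ _ c)
  | al_left (f : Mer) : Rel q (S (inL f) * A) (A * S (inL (Mer.T 1 f)))
  | al_right (f : Mer) : Rel q (S (inR f) * A) (A * S (inR (Mer.T 1 f)))
  | be_left (f : Mer) : Rel q (S (inL f) * B) (B * S (inL (Mer.T 1 f)))
  | be_right (f : Mer) : Rel q (S (inR f) * B) (B * S (inR (Mer.T (-1) f)))
  | ga_left (f : Mer) : Rel q (S (inL f) * C) (C * S (inL (Mer.T (-1) f)))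
  | ga_right (f : Mer) : Rel q (S (inR f) * C) (C * S (inR (Mer.T 1 f)))
  | de_left (f : Mer) : Rel q (S (inL f) * D) (D * S (inL (Mer.T (-1) f)))
  | de_right (f : Mer) : Rel q (S (inR f) * D) (D * S (inR (Mer.T (-1) f)))
  | al_be : Rel q (A * B) (qc q • (S (inR (Mer.T (-1) (fF q))) * B * A))
  | al_ga : Rel q (A * C) (qc q • (S (inL (fF q)) * C * A))
  | be_de : Rel q (B * D) (qc q • (S (inL (fF q)) * D * B))
  | ga_de : Rel q (C * D) (qc q • (S (inR (Mer.T (-1) (fF q))) * D * C))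
  | cross1 : Rel q (A * D - D * A) (S (fH q) * C * B)
  | cross2 : Rel q (S (inR (fG q)) * A * D - S (inL (fG q)) * D * A) (S (fH q) * B * C)
  | cross3 : Rel q (B * C - S (inR (fG q)) * C * B) (S (fI q) * D * A)
  | cross4 : Rel q (B * C - S (inL (fG q)) * C * B) (S (fI q) * A * D)
  | det : Rel q (A * D - qc q • (S (inL (fF q)) * C * B)) 1

/-- The algebra `F_R(SL(2))`, which with the star structure below is also `F_R(SU(2))`. -/
def FR (q : QParam) : Type := RingQuot (Rel q)

instance (q : QParam) : Ring (FR q) := inferInstanceAs (Ring (RingQuot (Rel q)))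
instance (q : QParam) : Algebra ℂ (FR q) := inferInstanceAs (Algebra ℂ (RingQuot (Rel q)))

namespace FR

/-- The projection from the free algebra. -/
def proj (q : QParam) : FreeAlgebra ℂ Gen →ₐ[ℂ] FR q := RingQuot.mkAlgHom ℂ (Rel q)

theorem proj_rel {q : QParam} {x y : FreeAlgebra ℂ Gen} (h : Rel q x y) : proj q x = proj q y :=
  RingQuot.mkAlgHom_rel ℂ h

theorem proj_surjective (q : QParam) : Function.Surjective (proj q) :=
  RingQuot.mkAlgHom_surjective ℂ (Rel q)

/-- `α`. -/
def al (q : QParam) : FR q := proj q Gen.A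
/-- `β`. -/
def be (q : QParam) : FR q := proj q Gen.B
/-- `γ`. -/
def ga (q : QParam) : FR q := proj q Gen.C
/-- `δ`. -/
def de (q : QParam) : FR q := proj q Gen.D

/-- The homomorphism `∑ f ⊗ g ↦ ∑ f(λ) g(μ)` into `F_R(SL(2))`. -/
def coef (q : QParam) : Mer2 →ₐ[ℂ] FR q where
  toFun x := proj q (Gen.S x)
  map_one' := by
    have := proj_rel (q := q) (Rel.coef_cst 1)
    simpa using this
  map_zero' := by
    have := proj_rel (q := q) (Rel.coef_cst 0)
    simpa using this
  map_mul' x y := by rw [proj_rel (Rel.coef_mul x y), map_mul]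
  map_add' x y := by rw [proj_rel (Rel.coef_add x y), map_add]
  commutes' c := by rw [proj_rel (Rel.coef_cst c), AlgHom.commutes]

/-- The left moment map `f ↦ f(λ)`. -/
def muL (q : QParam) : Mer →ₐ[ℂ] FR q := (coef q).comp inL

/-- The right moment map `f ↦ f(μ)`. -/
def muR (q : QParam) : Mer →ₐ[ℂ] FR q := (coef q).comp inR

end FR

/-- Images of the generators in an algebra `B`, subject to relations that imply the defining
relations of `F_R(SL(2))`. -/
structure RepData (q : QParam) (B : Type) [Ring B] [Algebra ℂ B] where
  s : Mer2 →ₐ[ℂ] B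
  al : B
  be : B
  ga : B
  de : B
  al_left : ∀ f, s (inL f) * al = al * s (inL (Mer.T 1 f))
  al_right : ∀ f, s (inR f) * al = al * s (inR (Mer.T 1 f))
  be_left : ∀ f, s (inL f) * be = be * s (inL (Mer.T 1 f))
  be_right : ∀ f, s (inR f) * be = be * s (inR (Mer.T (-1) f))
  ga_left : ∀ f, s (inL f) * ga = ga * s (inL (Mer.T (-1) f))
  ga_right : ∀ f, s (inR f) * ga = ga * s (inR (Mer.T 1 f))
  de_left : ∀ f, s (inL f) * de = de * s (inL (Mer.T (-1) f))
  de_right : ∀ f, s (inR f) * de = de * s (inR (Mer.T (-1) f))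
  al_be : al * be = s (kst (qc q) * inR (fFm q)) * (be * al)
  al_ga : al * ga = s (kst (qc q) * inL (fF q)) * (ga * al)
  be_de : be * de = s (kst (qc q) * inL (fF q)) * (de * be)
  ga_de : ga * de = s (kst (qc q) * inR (fFm q)) * (de * ga)
  det1 : al * de - s (kst (qc q) * inL (fF q)) * (ga * be) = 1
  det2 : de * al - s (kst (qc q)⁻¹ * inR (fFm q)⁻¹) * (ga * be) = 1
  det3 : s (inL (fF q)) * (de * al) - s (kst (qc q)⁻¹) * (be * ga) = s (inR (fF q))

namespace RepData

variable {q : QParam} {B : Type} [Ring B] [Algebra ℂ B] (R : RepData q B)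

/-- The values on the generators. -/
def gen : Gen → B
  | Gen.coef x => R.s x
  | Gen.al => R.al
  | Gen.be => R.be
  | Gen.ga => R.ga
  | Gen.de => R.de

theorem s_kst (c : ℂ) : R.s (kst c) = algebraMap ℂ B c := AlgHom.commutes _ _

theorem cross1 : R.al * R.de - R.de * R.al = R.s (fH q) * (R.ga * R.be) := by
  let : Module Mer2 B := Module.compHom B R.s.toRingHom
  have hs : ∀ (x : Mer2) (y : B), R.s x * y = x • y := fun _ _ => rfl
  have h1 := R.det1
  have h2 := R.det2
  rw [hs] at h1 h2 ⊢
  rw [fH_eq]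
  linear_combination (norm := module) h1 - h2

theorem det4 : R.be * R.ga = R.s (kst (qc q) * inL (fF q)) * (R.de * R.al)
    - R.s (kst (qc q) * inR (fF q)) := by
  have h3 := congrArg (fun y => R.s (kst (qc q)) * y) R.det3
  simp only [mul_sub, ← mul_assoc, ← map_mul R.s] at h3
  rw [kst_q_mul, map_one, one_mul] at h3
  rw [← h3]; noncomm_ring

theorem cross4 : R.be * R.ga - R.s (inL (fG q)) * (R.ga * R.be) =
    R.s (fI q) * (R.al * R.de) := by
  let : Module Mer2 B := Module.compHom B R.s.toRingHom
  have hs : ∀ (x : Mer2) (y : B), R.s x * y = x • y := fun _ _ => rfl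
  have hs' : ∀ (x : Mer2), R.s x = x • (1 : B) := fun x => by rw [← hs, mul_one]
  have h1 := R.det1
  have h2 := R.det2
  have h4 := R.det4
  rw [hs] at h1 h2
  rw [hs, hs'] at h4
  rw [hs, hs]
  have hk := kst_q_mul q
  have hF := inL_mul_inv (fFm_ne_zero q)
  have e1 : R.al * R.de = (1 : B) + (kst (qc q) * inL (fF q)) • (R.ga * R.be) := by
    rw [← h1]; abel
  have e2 : R.de * R.al = (1 : B) + (kst (qc q)⁻¹ * inR (fFm q)⁻¹) • (R.ga * R.be) := by
    rw [← h2]; abel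
  rw [h4, e1, e2, smul_add, smul_add, smul_smul, smul_smul]
  have hI : fI q * (kst (qc q) * inL (fF q)) =
      kst (qc q) * inL (fF q) * (kst (qc q)⁻¹ * inR (fFm q)⁻¹) - inL (fG q) := by
    rw [fI_eq', fG_eq, map_mul]
    linear_combination (- inL (fF q) * inL (fFm q)⁻¹) * hk
  rw [hI]
  have hI2 := fI_eq q
  rw [hI2]
  module

theorem fG_sub (q : QParam) : inR (fG q) - inL (fG q) = fH q * fI q := by
  have hk := kst_q_mul q
  have e1 := fI_eq q
  have hi := fI_eq' q
  have hh := fH_eq q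
  rw [fG_eq, map_mul, map_mul]
  rw [hh, sub_mul]
  nth_rewrite 1 [hi]
  rw [e1]
  linear_combination (inL (fF q) * inL (fFm q)⁻¹ - inR (fF q) * inR (fFm q)⁻¹) * hk

theorem cross2 : R.s (inR (fG q)) * (R.al * R.de) - R.s (inL (fG q)) * (R.de * R.al) =
    R.s (fH q) * (R.be * R.ga) := by
  let : Module Mer2 B := Module.compHom B R.s.toRingHom
  have hs : ∀ (x : Mer2) (y : B), R.s x * y = x • y := fun _ _ => rfl
  have h1 := R.cross1
  have h4 := R.cross4
  have hG := fG_sub q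
  simp only [hs] at h1 h4 ⊢
  have hG' : inR (fG q) = inL (fG q) + fH q * fI q := by rw [← hG]; ring
  rw [hG']
  linear_combination (norm := module) (inL (fG q)) • h1 - (fH q) • h4

theorem cross3 : R.be * R.ga - R.s (inR (fG q)) * (R.ga * R.be) =
    R.s (fI q) * (R.de * R.al) := by
  let : Module Mer2 B := Module.compHom B R.s.toRingHom
  have hs : ∀ (x : Mer2) (y : B), R.s x * y = x • y := fun _ _ => rfl
  have h1 := R.cross1
  have h4 := R.cross4
  have hG := fG_sub q
  simp only [hs] at h1 h4 ⊢
  have hG' : inR (fG q) = inL (fG q) + fH q * fI q := by rw [← hG]; ring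
  rw [hG']
  linear_combination (norm := module) h4 + (fI q) • h1

/-- The homomorphism out of `F_R(SL(2))` with the given values on the generators. -/
def lift : FR q →ₐ[ℂ] B :=
  RingQuot.liftAlgHom ℂ ⟨FreeAlgebra.lift ℂ R.gen, by
    intro x y h
    have hq : ∀ y : B, qc q • y = R.s (kst (qc q)) * y := fun y => by
      rw [R.s_kst, Algebra.smul_def]
    induction h with
    | coef_add x y => simp [gen]
    | coef_mul x y => simp [gen]
    | coef_cst c => simp [gen]
    | al_left f => simpa [gen] using R.al_left f
    | al_right f => simpa [gen] using R.al_right f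
    | be_left f => simpa [gen] using R.be_left f
    | be_right f => simpa [gen] using R.be_right f
    | ga_left f => simpa [gen] using R.ga_left f
    | ga_right f => simpa [gen] using R.ga_right f
    | de_left f => simpa [gen] using R.de_left f
    | de_right f => simpa [gen] using R.de_right f
    | al_be => simpa [gen, hq, mul_assoc, fFm] using R.al_be
    | al_ga => simpa [gen, hq, mul_assoc] using R.al_ga
    | be_de => simpa [gen, hq, mul_assoc] using R.be_de
    | ga_de => simpa [gen, hq, mul_assoc, fFm] using R.ga_de
    | cross1 => simpa [gen, mul_assoc] using R.cross1
    | cross2 => simpa [gen, mul_assoc] using R.cross2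
    | cross3 => simpa [gen, mul_assoc] using R.cross3
    | cross4 => simpa [gen, mul_assoc] using R.cross4
    | det => simpa [gen, hq, mul_assoc] using R.det1⟩

theorem lift_proj (x : FreeAlgebra ℂ Gen) :
    R.lift (FR.proj q x) = FreeAlgebra.lift ℂ R.gen x := by
  simp only [lift, FR.proj]
  erw [RingQuot.liftAlgHom_mkAlgHom_apply]

theorem lift_coef (x : Mer2) : R.lift (FR.coef q x) = R.s x := by
  refine (R.lift_proj (Gen.S x)).trans ?_
  simp [gen]

theorem lift_al : R.lift (FR.al q) = R.al := (R.lift_proj _).trans (by simp [gen])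
theorem lift_be : R.lift (FR.be q) = R.be := (R.lift_proj _).trans (by simp [gen])
theorem lift_ga : R.lift (FR.ga q) = R.ga := (R.lift_proj _).trans (by simp [gen])
theorem lift_de : R.lift (FR.de q) = R.de := (R.lift_proj _).trans (by simp [gen])

theorem lift_muL (f : Mer) : R.lift (FR.muL q f) = R.s (inL f) := R.lift_coef _
theorem lift_muR (f : Mer) : R.lift (FR.muR q f) = R.s (inR f) := R.lift_coef _

end RepData

/-! ## Calculus in `F_R(SL(2))` -/

/-- The shift `f(λ) g(μ) ↦ f(λ + a) g(μ + b)`. -/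
def T2 (a b : ℂ) : Mer2 →ₐ[ℂ] Mer2 :=
  (Algebra.TensorProduct.map (Mer.T a) (Mer.T b) : Mer ⊗[ℂ] Mer →ₐ[ℂ] Mer ⊗[ℂ] Mer)

/-- The exchange `f(λ) g(μ) ↦ g(λ) f(μ)`. -/
def swap2 : Mer2 →ₐ[ℂ] Mer2 :=
  ((Algebra.TensorProduct.comm ℂ Mer Mer : Mer ⊗[ℂ] Mer ≃ₐ[ℂ] Mer ⊗[ℂ] Mer) :
    Mer ⊗[ℂ] Mer →ₐ[ℂ] Mer ⊗[ℂ] Mer)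

theorem T2_inL (a b : ℂ) (f : Mer) : T2 a b (inL f) = inL (Mer.T a f) := by
  change (Algebra.TensorProduct.map (Mer.T a) (Mer.T b)) (f ⊗ₜ[ℂ] (1 : Mer)) = _
  rw [Algebra.TensorProduct.map_tmul, map_one]; rfl

theorem T2_inR (a b : ℂ) (f : Mer) : T2 a b (inR f) = inR (Mer.T b f) := by
  change (Algebra.TensorProduct.map (Mer.T a) (Mer.T b)) ((1 : Mer) ⊗ₜ[ℂ] f) = _
  rw [Algebra.TensorProduct.map_tmul, map_one]; rfl

theorem T2_kst (a b c : ℂ) : T2 a b (kst c) = kst c := AlgHom.commutes _ _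

theorem swap2_inL (f : Mer) : swap2 (inL f) = inR f := rfl
theorem swap2_inR (f : Mer) : swap2 (inR f) = inL f := rfl
theorem swap2_kst (c : ℂ) : swap2 (kst c) = kst c := AlgHom.commutes _ _

theorem Mer2.ind {P : Mer2 → Prop} (hadd : ∀ x y, P x → P y → P (x + y))
    (hmul : ∀ f g, P (inL f * inR g)) (x : Mer2) : P x := by
  refine TensorProduct.induction_on (motive := P) x ?_ ?_ hadd
  · have := hmul 0 0
    rwa [map_zero, zero_mul] at this
  · intro f g
    have h : (f ⊗ₜ[ℂ] g : Mer ⊗[ℂ] Mer) = f ⊗ₜ[ℂ] (1 : Mer) * (1 : Mer) ⊗ₜ[ℂ] g := by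
      rw [Algebra.TensorProduct.tmul_mul_tmul, mul_one, one_mul]
    rw [h]
    exact hmul f g

theorem T_neg_fF (q : QParam) : Mer.T (-1) (fF q) = fFm q := rfl

theorem T_one_T (f : Mer) : Mer.T 1 (Mer.T (-1) f) = f := by
  rw [Mer.T_T, add_neg_cancel, Mer.T_zero]

theorem T_neg_T (f : Mer) : Mer.T (-1) (Mer.T 1 f) = f := by
  rw [Mer.T_T, neg_add_cancel, Mer.T_zero]

theorem inL_sum (q : QParam) : kst (qc q) * inL (fF q) + kst (qc q)⁻¹ * inL (fFm q)⁻¹ =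
    kst (qc q) + kst (qc q)⁻¹ := by
  rw [inL_fF_lin, inL_fFm_lin]; ring

theorem inR_sum (q : QParam) : kst (qc q) * inR (fF q) + kst (qc q)⁻¹ * inR (fFm q)⁻¹ =
    kst (qc q) + kst (qc q)⁻¹ := by
  rw [inR_fF_lin, inR_fFm_lin]; ring

theorem T_one_fFm (q : QParam) : Mer.T 1 (fFm q) = fF q := by
  rw [fFm, Mer.T_T, add_neg_cancel, Mer.T_zero]

namespace FR

variable {q : QParam}

/-- `F_R(SL(2))` as a module over the coefficients, acting by left multiplication. -/
instance : Module Mer2 (FR q) := Module.compHom (FR q) (coef q).toRingHom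

theorem smul2_def (x : Mer2) (y : FR q) : x • y = coef q x * y := rfl

theorem coef_eq (x : Mer2) : coef q x = x • (1 : FR q) := by rw [smul2_def, mul_one]

theorem smul2_mul (x : Mer2) (y z : FR q) : (x • y) * z = x • (y * z) := by
  rw [smul2_def, smul2_def, mul_assoc]

theorem shift_aux {w : FR q} {a b : ℂ}
    (h1 : ∀ f, coef q (inL f) * w = w * coef q (inL (Mer.T (-a) f)))
    (h2 : ∀ f, coef q (inR f) * w = w * coef q (inR (Mer.T (-b) f))) (x : Mer2) :
    w * coef q x = coef q (T2 a b x) * w := by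
  induction x using Mer2.ind with
  | hadd x y hx hy => rw [map_add, mul_add, hx, hy, map_add, map_add, add_mul]
  | hmul f g =>
    have e1 := h1 (Mer.T a f)
    have e2 := h2 (Mer.T b g)
    rw [Mer.T_T, neg_add_cancel, Mer.T_zero] at e1 e2
    rw [map_mul, map_mul, T2_inL, T2_inR, map_mul, ← mul_assoc, ← e1, mul_assoc, ← e2, mul_assoc]

theorem al_coef (x : Mer2) : al q * coef q x = coef q (T2 (-1) (-1) x) * al q := by
  refine shift_aux (fun f => ?_) (fun f => ?_) x
  · rw [neg_neg]; have h := proj_rel (Rel.al_left (q := q) f); rw [map_mul, map_mul] at h; exact h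
  · rw [neg_neg]; have h := proj_rel (Rel.al_right (q := q) f); rw [map_mul, map_mul] at h; exact h

theorem be_coef (x : Mer2) : be q * coef q x = coef q (T2 (-1) 1 x) * be q := by
  refine shift_aux (fun f => ?_) (fun f => ?_) x
  · rw [neg_neg]; have h := proj_rel (Rel.be_left (q := q) f); rw [map_mul, map_mul] at h; exact h
  · have h := proj_rel (Rel.be_right (q := q) f); rw [map_mul, map_mul] at h; exact h

theorem ga_coef (x : Mer2) : ga q * coef q x = coef q (T2 1 (-1) x) * ga q := by
  refine shift_aux (fun f => ?_) (fun f => ?_) x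
  · have h := proj_rel (Rel.ga_left (q := q) f); rw [map_mul, map_mul] at h; exact h
  · rw [neg_neg]; have h := proj_rel (Rel.ga_right (q := q) f); rw [map_mul, map_mul] at h; exact h

theorem de_coef (x : Mer2) : de q * coef q x = coef q (T2 1 1 x) * de q := by
  refine shift_aux (fun f => ?_) (fun f => ?_) x
  · have h := proj_rel (Rel.de_left (q := q) f); rw [map_mul, map_mul] at h; exact h
  · have h := proj_rel (Rel.de_right (q := q) f); rw [map_mul, map_mul] at h; exact h

theorem al_smul (x : Mer2) (y : FR q) : al q * (x • y) = T2 (-1) (-1) x • (al q * y) := by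
  rw [smul2_def, ← mul_assoc, al_coef, mul_assoc, smul2_def]

theorem be_smul (x : Mer2) (y : FR q) : be q * (x • y) = T2 (-1) 1 x • (be q * y) := by
  rw [smul2_def, ← mul_assoc, be_coef, mul_assoc, smul2_def]

theorem ga_smul (x : Mer2) (y : FR q) : ga q * (x • y) = T2 1 (-1) x • (ga q * y) := by
  rw [smul2_def, ← mul_assoc, ga_coef, mul_assoc, smul2_def]

theorem de_smul (x : Mer2) (y : FR q) : de q * (x • y) = T2 1 1 x • (de q * y) := by
  rw [smul2_def, ← mul_assoc, de_coef, mul_assoc, smul2_def]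

theorem csmul_eq (c : ℂ) (y : FR q) : c • y = kst c • y := by
  rw [smul2_def, Algebra.smul_def]
  exact congrArg (fun t => t * y) ((coef q).commutes c).symm

theorem al_be : al q * be q = (kst (qc q) * inR (fFm q)) • (be q * al q) := by
  have h := proj_rel (Rel.al_be (q := q))
  rw [map_smul, csmul_eq] at h
  simp only [map_mul, mul_assoc] at h
  rw [mul_smul]; exact h

theorem al_ga : al q * ga q = (kst (qc q) * inL (fF q)) • (ga q * al q) := by
  have h := proj_rel (Rel.al_ga (q := q))
  rw [map_smul, csmul_eq] at h
  simp only [map_mul, mul_assoc] at h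
  rw [mul_smul]; exact h

theorem be_de : be q * de q = (kst (qc q) * inL (fF q)) • (de q * be q) := by
  have h := proj_rel (Rel.be_de (q := q))
  rw [map_smul, csmul_eq] at h
  simp only [map_mul, mul_assoc] at h
  rw [mul_smul]; exact h

theorem ga_de : ga q * de q = (kst (qc q) * inR (fFm q)) • (de q * ga q) := by
  have h := proj_rel (Rel.ga_de (q := q))
  rw [map_smul, csmul_eq] at h
  simp only [map_mul, mul_assoc] at h
  rw [mul_smul]; exact h

/-- `α δ = 1 + q F(λ) γ β`. -/
theorem al_de : al q * de q = 1 + (kst (qc q) * inL (fF q)) • (ga q * be q) := by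
  have h := proj_rel (Rel.det (q := q))
  rw [map_sub, map_smul, csmul_eq, map_one] at h
  simp only [map_mul, mul_assoc] at h
  rw [mul_smul, ← sub_eq_iff_eq_add]; exact h

/-- `δ α = 1 + (q⁻¹ / F(μ - 1)) γ β`. -/
theorem de_al : de q * al q = 1 + (kst (qc q)⁻¹ * inR (fFm q)⁻¹) • (ga q * be q) := by
  have h := proj_rel (Rel.cross1 (q := q))
  simp only [map_mul, map_sub, mul_assoc] at h
  have h' : al q * de q - de q * al q = fH q • (ga q * be q) := h
  rw [al_de, fH_eq] at h'
  linear_combination (norm := module) - h'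

/-- `β γ = I(λ, μ) + (F(λ) / F(μ - 1)) γ β`. -/
theorem be_ga : be q * ga q =
    (kst (qc q) * inL (fF q) - kst (qc q) * inR (fF q)) • (1 : FR q)
      + (inL (fF q) * inR (fFm q)⁻¹) • (ga q * be q) := by
  have h := proj_rel (Rel.cross4 (q := q))
  simp only [map_mul, map_sub, mul_assoc] at h
  have h' : be q * ga q - inL (fG q) • (ga q * be q) = fI q • (al q * de q) := h
  rw [al_de, smul_add, smul_smul] at h'
  have hk := kst_q_mul q
  have hI : fI q * (kst (qc q) * inL (fF q)) = inL (fF q) * inR (fFm q)⁻¹ - inL (fG q) := by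
    rw [fI_eq', fG_eq, map_mul]
    linear_combination (inR (fFm q)⁻¹ - inL (fFm q)⁻¹) * inL (fF q) * hk
  rw [hI, fI_eq] at h'
  linear_combination (norm := module) h'

end FR

/-! ## The antipode -/

section Antipode

set_option linter.unusedSimpArgs false

variable (q : QParam)

open MulOpposite

/-- `f(λ) ↦ f(μ)`, `g(μ) ↦ g(λ)`, as a map to the opposite algebra. -/
def antipodeCoef : Mer2 →ₐ[ℂ] (FR q)ᵐᵒᵖ :=
  ((FR.coef q).comp swap2).toOpposite fun x y => by
    simp only [AlgHom.comp_apply, Commute, SemiconjBy, ← map_mul, mul_comm]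

theorem antipodeCoef_apply (x : Mer2) : antipodeCoef q x = op (FR.coef q (swap2 x)) := rfl

/-- The values of the antipode on the generators. -/
def antipodeData : RepData q (FR q)ᵐᵒᵖ where
  s := antipodeCoef q
  al := op (FR.coef q (inL (fF q) * inR (fF q)⁻¹) * FR.de q)
  be := op (- (FR.coef q (kst (qc q)⁻¹ * inR (fF q)⁻¹) * FR.be q))
  ga := op (- (FR.coef q (kst (qc q) * inL (fF q)) * FR.ga q))
  de := op (FR.al q)
  al_left f := by
    rw [antipodeCoef_apply, antipodeCoef_apply, ← op_mul, ← op_mul, swap2_inL, swap2_inL,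
      mul_assoc, FR.de_coef, T2_inR, ← mul_assoc, ← mul_assoc, ← map_mul, ← map_mul, mul_comm]
  al_right f := by
    rw [antipodeCoef_apply, antipodeCoef_apply, ← op_mul, ← op_mul, swap2_inR, swap2_inR,
      mul_assoc, FR.de_coef, T2_inL, ← mul_assoc, ← mul_assoc, ← map_mul, ← map_mul, mul_comm]
  be_left f := by
    rw [antipodeCoef_apply, antipodeCoef_apply, ← op_mul, ← op_mul, swap2_inL, swap2_inL,
      neg_mul, mul_neg,
      mul_assoc, FR.be_coef, T2_inR, ← mul_assoc, ← mul_assoc, ← map_mul, ← map_mul, mul_comm]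
  be_right f := by
    rw [antipodeCoef_apply, antipodeCoef_apply, ← op_mul, ← op_mul, swap2_inR, swap2_inR,
      neg_mul, mul_neg,
      mul_assoc, FR.be_coef, T2_inL, ← mul_assoc, ← mul_assoc, ← map_mul, ← map_mul, mul_comm]
  ga_left f := by
    rw [antipodeCoef_apply, antipodeCoef_apply, ← op_mul, ← op_mul, swap2_inL, swap2_inL,
      neg_mul, mul_neg,
      mul_assoc, FR.ga_coef, T2_inR, ← mul_assoc, ← mul_assoc, ← map_mul, ← map_mul, mul_comm]
  ga_right f := by
    rw [antipodeCoef_apply, antipodeCoef_apply, ← op_mul, ← op_mul, swap2_inR, swap2_inR,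
      neg_mul, mul_neg,
      mul_assoc, FR.ga_coef, T2_inL, ← mul_assoc, ← mul_assoc, ← map_mul, ← map_mul, mul_comm]
  de_left f := by
    rw [antipodeCoef_apply, antipodeCoef_apply, ← op_mul, ← op_mul, swap2_inL, swap2_inL,
      FR.al_coef, T2_inR]
  de_right f := by
    rw [antipodeCoef_apply, antipodeCoef_apply, ← op_mul, ← op_mul, swap2_inR, swap2_inR,
      FR.al_coef, T2_inL]
  al_be := by
    apply unop_injective
    simp only [antipodeCoef_apply, unop_mul, unop_sub, unop_one, unop_op, map_mul swap2, swap2_inR,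
      swap2_inL, swap2_kst, FR.coef_eq]
    simp only [FR.smul2_mul, neg_mul, mul_neg, neg_neg, smul_neg, one_mul, mul_one, mul_assoc,
      FR.al_smul, FR.be_smul, FR.ga_smul, FR.de_smul, smul_smul, T2_inL, T2_inR, T2_kst, map_mul,
      map_inv₀, T_neg_fF, T_one_fFm, T_one_T, T_neg_T, smul_add, add_mul, sub_mul, FR.be_de]
    congr 2; ring
  al_ga := by
    apply unop_injective
    simp only [antipodeCoef_apply, unop_mul, unop_sub, unop_one, unop_op, map_mul swap2, swap2_inR,
      swap2_inL, swap2_kst, FR.coef_eq]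
    simp only [FR.smul2_mul, neg_mul, mul_neg, neg_neg, smul_neg, one_mul, mul_one, mul_assoc,
      FR.al_smul, FR.be_smul, FR.ga_smul, FR.de_smul, smul_smul, T2_inL, T2_inR, T2_kst, map_mul,
      map_inv₀, T_neg_fF, T_one_fFm, T_one_T, T_neg_T, smul_add, add_mul, sub_mul, FR.ga_de]
    have hk := kst_q_mul q
    have hL := inL_mul_inv (fF_ne_zero q)
    have hR := inR_mul_inv (fF_ne_zero q)
    have hLm := inL_mul_inv (fFm_ne_zero q)
    have hRm := inR_mul_inv (fFm_ne_zero q)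
    congr 2; grind
  be_de := by
    apply unop_injective
    simp only [antipodeCoef_apply, unop_mul, unop_sub, unop_one, unop_op, map_mul swap2, swap2_inR,
      swap2_inL, swap2_kst, FR.coef_eq]
    simp only [FR.smul2_mul, neg_mul, mul_neg, neg_neg, smul_neg, one_mul, mul_one, mul_assoc,
      FR.al_smul, FR.be_smul, FR.ga_smul, FR.de_smul, smul_smul, T2_inL, T2_inR, T2_kst, map_mul,
      map_inv₀, T_neg_fF, T_one_fFm, T_one_T, T_neg_T, smul_add, add_mul, sub_mul, FR.al_be]
    have hk := kst_q_mul q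
    have hL := inL_mul_inv (fF_ne_zero q)
    have hR := inR_mul_inv (fF_ne_zero q)
    have hLm := inL_mul_inv (fFm_ne_zero q)
    have hRm := inR_mul_inv (fFm_ne_zero q)
    congr 2; grind
  ga_de := by
    apply unop_injective
    simp only [antipodeCoef_apply, unop_mul, unop_sub, unop_one, unop_op, map_mul swap2, swap2_inR,
      swap2_inL, swap2_kst, FR.coef_eq]
    simp only [FR.smul2_mul, neg_mul, mul_neg, neg_neg, smul_neg, one_mul, mul_one, mul_assoc,
      FR.al_smul, FR.be_smul, FR.ga_smul, FR.de_smul, smul_smul, T2_inL, T2_inR, T2_kst, map_mul,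
      map_inv₀, T_neg_fF, T_one_fFm, T_one_T, T_neg_T, smul_add, add_mul, sub_mul, FR.al_ga]
    congr 2; ring
  det1 := by
    apply unop_injective
    simp only [antipodeCoef_apply, unop_mul, unop_sub, unop_one, unop_op, map_mul swap2, swap2_inR,
      swap2_inL, swap2_kst, FR.coef_eq]
    simp only [FR.smul2_mul, neg_mul, mul_neg, neg_neg, smul_neg, one_mul, mul_one, mul_assoc,
      FR.al_smul, FR.be_smul, FR.ga_smul, FR.de_smul, smul_smul, T2_inL, T2_inR, T2_kst, map_mul,
      map_inv₀, T_neg_fF, T_one_fFm, T_one_T, T_neg_T, smul_add, add_mul, sub_mul, FR.al_de, FR.be_ga]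
    have hk := kst_q_mul q
    have hL := inL_mul_inv (fF_ne_zero q)
    have hR := inR_mul_inv (fF_ne_zero q)
    have hLm := inL_mul_inv (fFm_ne_zero q)
    have hRm := inR_mul_inv (fFm_ne_zero q)
    have hsL := inL_sum q
    have hsR := inR_sum q
    match_scalars
    · grind
    · grind
  det2 := by
    apply unop_injective
    simp only [antipodeCoef_apply, unop_mul, unop_sub, unop_one, unop_op, map_mul swap2, swap2_inR,
      swap2_inL, swap2_kst, FR.coef_eq]
    simp only [FR.smul2_mul, neg_mul, mul_neg, neg_neg, smul_neg, one_mul, mul_one, mul_assoc,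
      FR.al_smul, FR.be_smul, FR.ga_smul, FR.de_smul, smul_smul, T2_inL, T2_inR, T2_kst, map_mul,
      map_inv₀, T_neg_fF, T_one_fFm, T_one_T, T_neg_T, smul_add, add_mul, sub_mul, FR.de_al, FR.be_ga]
    have hk := kst_q_mul q
    have hL := inL_mul_inv (fF_ne_zero q)
    have hR := inR_mul_inv (fF_ne_zero q)
    have hLm := inL_mul_inv (fFm_ne_zero q)
    have hRm := inR_mul_inv (fFm_ne_zero q)
    have hsL := inL_sum q
    have hsR := inR_sum q
    match_scalars
    · grind
    · grind
  det3 := by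
    apply unop_injective
    simp only [antipodeCoef_apply, unop_mul, unop_sub, unop_one, unop_op, map_mul swap2, swap2_inR,
      swap2_inL, swap2_kst, FR.coef_eq]
    simp only [FR.smul2_mul, neg_mul, mul_neg, neg_neg, smul_neg, one_mul, mul_one, mul_assoc,
      FR.al_smul, FR.be_smul, FR.ga_smul, FR.de_smul, smul_smul, T2_inL, T2_inR, T2_kst, map_mul,
      map_inv₀, T_neg_fF, T_one_fFm, T_one_T, T_neg_T, smul_add, add_mul, sub_mul, FR.de_al]
    have hk := kst_q_mul q
    have hL := inL_mul_inv (fF_ne_zero q)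
    have hR := inR_mul_inv (fF_ne_zero q)
    have hLm := inL_mul_inv (fFm_ne_zero q)
    have hRm := inR_mul_inv (fFm_ne_zero q)
    have hsL := inL_sum q
    have hsR := inR_sum q
    match_scalars
    · grind
    · grind

end Antipode

/-! ## The star structure -/

/-- The opposite algebra with the conjugate scalar action: homomorphisms `B → ConjOp A` are
antimultiplicative antilinear maps `B → A`. -/
def ConjOp (A : Type) : Type := Aᵐᵒᵖ

namespace ConjOp

set_option linter.unusedSectionVars false

variable {A : Type} [Ring A] [Algebra ℂ A]

instance : Ring (ConjOp A) := inferInstanceAs (Ring Aᵐᵒᵖ)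

instance : Algebra ℂ (ConjOp A) :=
  RingHom.toAlgebra' (((algebraMap ℂ Aᵐᵒᵖ).comp (starRingEnd ℂ) : ℂ →+* Aᵐᵒᵖ))
    (fun c x => Algebra.commutes (A := Aᵐᵒᵖ) ((starRingEnd ℂ) c) x)

/-- The element of `ConjOp A` given by an element of `A`. -/
def cop (a : A) : ConjOp A := MulOpposite.op a

/-- The element of `A` given by an element of `ConjOp A`. -/
def cunop (x : ConjOp A) : A := MulOpposite.unop (α := A) x

theorem cunop_cop (a : A) : cunop (cop a) = a := rfl
theorem cunop_mul (x y : ConjOp A) : cunop (x * y) = cunop y * cunop x := rfl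
theorem cunop_add (x y : ConjOp A) : cunop (x + y) = cunop x + cunop y := rfl
theorem cunop_sub (x y : ConjOp A) : cunop (x - y) = cunop x - cunop y := rfl
theorem cunop_one : cunop (1 : ConjOp A) = 1 := rfl
theorem cunop_algebraMap (c : ℂ) :
    cunop (algebraMap ℂ (ConjOp A) c) = algebraMap ℂ A ((starRingEnd ℂ) c) := rfl
theorem cunop_injective : Function.Injective (cunop : ConjOp A → A) :=
  MulOpposite.unop_injective

end ConjOp

theorem bar_fX (q : QParam) : Mer.bar (fX q) = fX q := by
  rw [fX, qE_bar, Complex.conj_ofNat]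

theorem conj_qc (q : QParam) : (starRingEnd ℂ) (qc q) = qc q := Complex.conj_ofReal _

theorem bar_fF (q : QParam) : Mer.bar (fF q) = fF q := by
  rw [fF, map_div₀, map_sub, map_sub, map_one, bar_fX, Mer.bar_cst, map_zpow₀, conj_qc]

theorem bar_fFm (q : QParam) : Mer.bar (fFm q) = fFm q := by
  rw [fFm, Mer.bar_T, bar_fF, map_neg, map_one]

section Star

open ConjOp

variable (q : QParam)

/-- `f(λ) ↦ f̄(λ)`. -/
def starL : Mer →ₐ[ℂ] ConjOp (FR q) where
  toFun f := cop (FR.muL q (Mer.bar f))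
  map_one' := by rw [map_one, map_one]; rfl
  map_mul' f g := by rw [map_mul, mul_comm, map_mul]; rfl
  map_zero' := by rw [map_zero, map_zero]; rfl
  map_add' f g := by rw [map_add, map_add]; rfl
  commutes' c := by
    apply cunop_injective
    rw [Mer.bar_algebraMap, AlgHom.commutes, cunop_algebraMap]; rfl

/-- `f(μ) ↦ f̄(μ)`. -/
def starR : Mer →ₐ[ℂ] ConjOp (FR q) where
  toFun f := cop (FR.muR q (Mer.bar f))
  map_one' := by rw [map_one, map_one]; rfl
  map_mul' f g := by rw [map_mul, mul_comm, map_mul]; rfl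
  map_zero' := by rw [map_zero, map_zero]; rfl
  map_add' f g := by rw [map_add, map_add]; rfl
  commutes' c := by
    apply cunop_injective
    rw [Mer.bar_algebraMap, AlgHom.commutes, cunop_algebraMap]; rfl

theorem starL_commute (f g : Mer) : Commute (starL q f) (starR q g) := by
  apply cunop_injective
  change FR.coef q _ * FR.coef q _ = FR.coef q _ * FR.coef q _
  rw [← map_mul, mul_comm, map_mul]

/-- `f(λ) g(μ) ↦ f̄(λ) ḡ(μ)`. -/
def starCoef : Mer2 →ₐ[ℂ] ConjOp (FR q) :=
  (Algebra.TensorProduct.lift (starL q) (starR q) (starL_commute q) :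
    Mer ⊗[ℂ] Mer →ₐ[ℂ] ConjOp (FR q))

theorem starCoef_inL (f : Mer) : starCoef q (inL f) = cop (FR.coef q (inL (Mer.bar f))) :=
  (Algebra.TensorProduct.lift_tmul (starL q) (starR q) (starL_commute q) f 1).trans (by
    rw [map_one, mul_one]; rfl)

theorem starCoef_inR (f : Mer) : starCoef q (inR f) = cop (FR.coef q (inR (Mer.bar f))) :=
  (Algebra.TensorProduct.lift_tmul (starL q) (starR q) (starL_commute q) 1 f).trans (by
    rw [map_one, one_mul]; rfl)

theorem starCoef_kst (c : ℂ) :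
    starCoef q (kst c) = cop (FR.coef q (kst ((starRingEnd ℂ) c))) := by
  apply cunop_injective
  rw [kst, AlgHom.commutes, cunop_algebraMap, cunop_cop, AlgHom.commutes]

set_option linter.unusedSimpArgs false

/-- The values of the star on the generators. -/
def starData : RepData q (ConjOp (FR q)) where
  s := starCoef q
  al := cop (FR.de q)
  be := cop (- (FR.coef q (kst (qc q)) * FR.ga q))
  ga := cop (- (FR.coef q (kst (qc q)⁻¹) * FR.be q))
  de := cop (FR.al q)
  al_left f := by
    apply cunop_injective
    rw [starCoef_inL, starCoef_inL, cunop_mul, cunop_mul, cunop_cop, cunop_cop, cunop_cop,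
      FR.de_coef, T2_inL, Mer.bar_T, map_one]
  al_right f := by
    apply cunop_injective
    rw [starCoef_inR, starCoef_inR, cunop_mul, cunop_mul, cunop_cop, cunop_cop, cunop_cop,
      FR.de_coef, T2_inR, Mer.bar_T, map_one]
  be_left f := by
    apply cunop_injective
    rw [starCoef_inL, starCoef_inL, cunop_mul, cunop_mul, cunop_cop, cunop_cop, cunop_cop,
      neg_mul, mul_neg, mul_assoc, FR.ga_coef, T2_inL, Mer.bar_T, map_one,
      ← mul_assoc, ← mul_assoc, ← map_mul, ← map_mul, mul_comm]
  be_right f := by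
    apply cunop_injective
    rw [starCoef_inR, starCoef_inR, cunop_mul, cunop_mul, cunop_cop, cunop_cop, cunop_cop,
      neg_mul, mul_neg, mul_assoc, FR.ga_coef, T2_inR, Mer.bar_T, map_neg, map_one,
      ← mul_assoc, ← mul_assoc, ← map_mul, ← map_mul, mul_comm]
  ga_left f := by
    apply cunop_injective
    rw [starCoef_inL, starCoef_inL, cunop_mul, cunop_mul, cunop_cop, cunop_cop, cunop_cop,
      neg_mul, mul_neg, mul_assoc, FR.be_coef, T2_inL, Mer.bar_T, map_neg, map_one,
      ← mul_assoc, ← mul_assoc, ← map_mul, ← map_mul, mul_comm]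
  ga_right f := by
    apply cunop_injective
    rw [starCoef_inR, starCoef_inR, cunop_mul, cunop_mul, cunop_cop, cunop_cop, cunop_cop,
      neg_mul, mul_neg, mul_assoc, FR.be_coef, T2_inR, Mer.bar_T, map_one,
      ← mul_assoc, ← mul_assoc, ← map_mul, ← map_mul, mul_comm]
  de_left f := by
    apply cunop_injective
    rw [starCoef_inL, starCoef_inL, cunop_mul, cunop_mul, cunop_cop, cunop_cop, cunop_cop,
      FR.al_coef, T2_inL, Mer.bar_T, map_neg, map_one]
  de_right f := by
    apply cunop_injective
    rw [starCoef_inR, starCoef_inR, cunop_mul, cunop_mul, cunop_cop, cunop_cop, cunop_cop,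
      FR.al_coef, T2_inR, Mer.bar_T, map_neg, map_one]
  al_be := by
    apply cunop_injective
    simp only [cunop_mul, cunop_sub, cunop_one, cunop_cop, map_mul (starCoef q), starCoef_inL,
      starCoef_inR, starCoef_kst, map_inv₀ Mer.bar, map_inv₀ (starRingEnd ℂ), bar_fF, bar_fFm,
      conj_qc, FR.coef_eq]
    simp only [FR.smul2_mul, neg_mul, mul_neg, neg_neg, smul_neg, one_mul, mul_one, mul_assoc,
      FR.al_smul, FR.be_smul, FR.ga_smul, FR.de_smul, smul_smul, T2_inL, T2_inR, T2_kst, map_mul,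
      map_inv₀, T_neg_fF, T_one_fFm, T_one_T, T_neg_T, smul_add, add_mul, sub_mul, FR.ga_de]
    have hk := kst_q_mul q
    have hL := inL_mul_inv (fF_ne_zero q)
    have hR := inR_mul_inv (fF_ne_zero q)
    have hLm := inL_mul_inv (fFm_ne_zero q)
    have hRm := inR_mul_inv (fFm_ne_zero q)
    have hsL := inL_sum q
    have hsR := inR_sum q
    congr 2; grind
  al_ga := by
    apply cunop_injective
    simp only [cunop_mul, cunop_sub, cunop_one, cunop_cop, map_mul (starCoef q), starCoef_inL,
      starCoef_inR, starCoef_kst, map_inv₀ Mer.bar, map_inv₀ (starRingEnd ℂ), bar_fF, bar_fFm,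
      conj_qc, FR.coef_eq]
    simp only [FR.smul2_mul, neg_mul, mul_neg, neg_neg, smul_neg, one_mul, mul_one, mul_assoc,
      FR.al_smul, FR.be_smul, FR.ga_smul, FR.de_smul, smul_smul, T2_inL, T2_inR, T2_kst, map_mul,
      map_inv₀, T_neg_fF, T_one_fFm, T_one_T, T_neg_T, smul_add, add_mul, sub_mul, FR.be_de]
    have hk := kst_q_mul q
    have hL := inL_mul_inv (fF_ne_zero q)
    have hR := inR_mul_inv (fF_ne_zero q)
    have hLm := inL_mul_inv (fFm_ne_zero q)
    have hRm := inR_mul_inv (fFm_ne_zero q)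
    have hsL := inL_sum q
    have hsR := inR_sum q
    congr 2; grind
  be_de := by
    apply cunop_injective
    simp only [cunop_mul, cunop_sub, cunop_one, cunop_cop, map_mul (starCoef q), starCoef_inL,
      starCoef_inR, starCoef_kst, map_inv₀ Mer.bar, map_inv₀ (starRingEnd ℂ), bar_fF, bar_fFm,
      conj_qc, FR.coef_eq]
    simp only [FR.smul2_mul, neg_mul, mul_neg, neg_neg, smul_neg, one_mul, mul_one, mul_assoc,
      FR.al_smul, FR.be_smul, FR.ga_smul, FR.de_smul, smul_smul, T2_inL, T2_inR, T2_kst, map_mul,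
      map_inv₀, T_neg_fF, T_one_fFm, T_one_T, T_neg_T, smul_add, add_mul, sub_mul, FR.al_ga]
    have hk := kst_q_mul q
    have hL := inL_mul_inv (fF_ne_zero q)
    have hR := inR_mul_inv (fF_ne_zero q)
    have hLm := inL_mul_inv (fFm_ne_zero q)
    have hRm := inR_mul_inv (fFm_ne_zero q)
    have hsL := inL_sum q
    have hsR := inR_sum q
    congr 2; grind
  ga_de := by
    apply cunop_injective
    simp only [cunop_mul, cunop_sub, cunop_one, cunop_cop, map_mul (starCoef q), starCoef_inL,
      starCoef_inR, starCoef_kst, map_inv₀ Mer.bar, map_inv₀ (starRingEnd ℂ), bar_fF, bar_fFm,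
      conj_qc, FR.coef_eq]
    simp only [FR.smul2_mul, neg_mul, mul_neg, neg_neg, smul_neg, one_mul, mul_one, mul_assoc,
      FR.al_smul, FR.be_smul, FR.ga_smul, FR.de_smul, smul_smul, T2_inL, T2_inR, T2_kst, map_mul,
      map_inv₀, T_neg_fF, T_one_fFm, T_one_T, T_neg_T, smul_add, add_mul, sub_mul, FR.al_be]
    have hk := kst_q_mul q
    have hL := inL_mul_inv (fF_ne_zero q)
    have hR := inR_mul_inv (fF_ne_zero q)
    have hLm := inL_mul_inv (fFm_ne_zero q)
    have hRm := inR_mul_inv (fFm_ne_zero q)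
    have hsL := inL_sum q
    have hsR := inR_sum q
    congr 2; grind
  det1 := by
    apply cunop_injective
    simp only [cunop_mul, cunop_sub, cunop_one, cunop_cop, map_mul (starCoef q), starCoef_inL,
      starCoef_inR, starCoef_kst, map_inv₀ Mer.bar, map_inv₀ (starRingEnd ℂ), bar_fF, bar_fFm,
      conj_qc, FR.coef_eq]
    simp only [FR.smul2_mul, neg_mul, mul_neg, neg_neg, smul_neg, one_mul, mul_one, mul_assoc,
      FR.al_smul, FR.be_smul, FR.ga_smul, FR.de_smul, smul_smul, T2_inL, T2_inR, T2_kst, map_mul,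
      map_inv₀, T_neg_fF, T_one_fFm, T_one_T, T_neg_T, smul_add, add_mul, sub_mul, FR.al_de, FR.be_ga]
    have hk := kst_q_mul q
    have hL := inL_mul_inv (fF_ne_zero q)
    have hR := inR_mul_inv (fF_ne_zero q)
    have hLm := inL_mul_inv (fFm_ne_zero q)
    have hRm := inR_mul_inv (fFm_ne_zero q)
    have hsL := inL_sum q
    have hsR := inR_sum q
    match_scalars
    · grind
    · grind
  det2 := by
    apply cunop_injective
    simp only [cunop_mul, cunop_sub, cunop_one, cunop_cop, map_mul (starCoef q), starCoef_inL,
      starCoef_inR, starCoef_kst, map_inv₀ Mer.bar, map_inv₀ (starRingEnd ℂ), bar_fF, bar_fFm,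
      conj_qc, FR.coef_eq]
    simp only [FR.smul2_mul, neg_mul, mul_neg, neg_neg, smul_neg, one_mul, mul_one, mul_assoc,
      FR.al_smul, FR.be_smul, FR.ga_smul, FR.de_smul, smul_smul, T2_inL, T2_inR, T2_kst, map_mul,
      map_inv₀, T_neg_fF, T_one_fFm, T_one_T, T_neg_T, smul_add, add_mul, sub_mul, FR.de_al, FR.be_ga]
    have hk := kst_q_mul q
    have hL := inL_mul_inv (fF_ne_zero q)
    have hR := inR_mul_inv (fF_ne_zero q)
    have hLm := inL_mul_inv (fFm_ne_zero q)
    have hRm := inR_mul_inv (fFm_ne_zero q)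
    have hsL := inL_sum q
    have hsR := inR_sum q
    match_scalars
    · grind
    · grind
  det3 := by
    apply cunop_injective
    simp only [cunop_mul, cunop_sub, cunop_one, cunop_cop, map_mul (starCoef q), starCoef_inL,
      starCoef_inR, starCoef_kst, map_inv₀ Mer.bar, map_inv₀ (starRingEnd ℂ), bar_fF, bar_fFm,
      conj_qc, FR.coef_eq]
    simp only [FR.smul2_mul, neg_mul, mul_neg, neg_neg, smul_neg, one_mul, mul_one, mul_assoc,
      FR.al_smul, FR.be_smul, FR.ga_smul, FR.de_smul, smul_smul, T2_inL, T2_inR, T2_kst, map_mul,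
      map_inv₀, T_neg_fF, T_one_fFm, T_one_T, T_neg_T, smul_add, add_mul, sub_mul, FR.de_al, FR.al_de, FR.be_ga]
    have hk := kst_q_mul q
    have hL := inL_mul_inv (fF_ne_zero q)
    have hR := inR_mul_inv (fF_ne_zero q)
    have hLm := inL_mul_inv (fFm_ne_zero q)
    have hRm := inR_mul_inv (fFm_ne_zero q)
    have hsL := inL_sum q
    have hsR := inR_sum q
    match_scalars
    · grind
    · grind

end Star

namespace FR

/-- The antipode `S`, the algebra antihomomorphism with `S(α) = (F(λ) / F(μ)) δ`,
`S(β) = -(q⁻¹ / F(μ)) β`, `S(γ) = -q F(λ) γ`, `S(δ) = α`, `S(f(λ)) = f(μ)`, `S(f(μ)) = f(λ)`. -/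
def antipode (q : QParam) (x : FR q) : FR q := MulOpposite.unop ((antipodeData q).lift x)

/-- The star structure of `F_R(SU(2))`, the antilinear algebra antihomomorphism with `α* = δ`,
`β* = -q γ`, `γ* = -q⁻¹ β`, `δ* = α`, `f(λ)* = f̄(λ)`, `f(μ)* = f̄(μ)`. -/
def star (q : QParam) (x : FR q) : FR q := ConjOp.cunop ((starData q).lift x)

variable (q : QParam)

theorem antipode_mul (x y : FR q) : antipode q (x * y) = antipode q y * antipode q x := by
  rw [antipode, map_mul]; rfl

theorem antipode_al : antipode q (al q) = muL q (fF q) * muR q (fF q)⁻¹ * de q := by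
  rw [antipode, RepData.lift_al, muL, muR, AlgHom.comp_apply, AlgHom.comp_apply, ← map_mul]; rfl

theorem antipode_be : antipode q (be q) = - ((qc q)⁻¹ • (muR q (fF q)⁻¹ * be q)) := by
  rw [antipode, RepData.lift_be, csmul_eq, smul2_def, ← mul_assoc, muR, AlgHom.comp_apply,
    ← map_mul]; rfl

theorem antipode_ga : antipode q (ga q) = - (qc q • (muL q (fF q) * ga q)) := by
  rw [antipode, RepData.lift_ga, csmul_eq, smul2_def, ← mul_assoc, muL, AlgHom.comp_apply,
    ← map_mul]; rfl

theorem antipode_de : antipode q (de q) = al q := by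
  rw [antipode, RepData.lift_de]; rfl

theorem antipode_muL (f : Mer) : antipode q (muL q f) = muR q f := by
  rw [antipode, RepData.lift_muL]; rfl

theorem antipode_muR (f : Mer) : antipode q (muR q f) = muL q f := by
  rw [antipode, RepData.lift_muR]; rfl

theorem star_mul (x y : FR q) : star q (x * y) = star q y * star q x := by
  rw [star, map_mul]; rfl

theorem star_smul (c : ℂ) (x : FR q) : star q (c • x) = (starRingEnd ℂ) c • star q x := by
  rw [star, Algebra.smul_def, map_mul, AlgHom.commutes, ConjOp.cunop_mul,
    ConjOp.cunop_algebraMap, ← Algebra.commutes, ← Algebra.smul_def]; rfl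

theorem star_al : star q (al q) = de q := by rw [star, RepData.lift_al]; rfl

theorem star_be : star q (be q) = - (qc q • ga q) := by
  rw [star, RepData.lift_be, csmul_eq, smul2_def]; rfl

theorem star_ga : star q (ga q) = - ((qc q)⁻¹ • be q) := by
  rw [star, RepData.lift_ga, csmul_eq, smul2_def]; rfl

theorem star_de : star q (de q) = al q := by rw [star, RepData.lift_de]; rfl

theorem star_muL (f : Mer) : star q (muL q f) = muL q (Mer.bar f) := by
  rw [star, RepData.lift_muL]
  exact congrArg ConjOp.cunop (starCoef_inL q f)

theorem star_muR (f : Mer) : star q (muR q f) = muR q (Mer.bar f) := by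
  rw [star, RepData.lift_muR]
  exact congrArg ConjOp.cunop (starCoef_inR q f)

end FR

/-! ## The counit -/

/-- `∑ f ⊗ g ↦ ∑ f g`, as multiplication operators on `Mer`. -/
def counitCoef : Mer2 →ₐ[ℂ] Module.End ℂ Mer :=
  (Algebra.lmul ℂ Mer).comp (Algebra.TensorProduct.lmul' ℂ : Mer ⊗[ℂ] Mer →ₐ[ℂ] Mer)

theorem counitCoef_inL (f g : Mer) : counitCoef (inL f) g = f * g := by
  change (Algebra.TensorProduct.lmul' ℂ (f ⊗ₜ[ℂ] (1 : Mer))) * g = _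
  rw [Algebra.TensorProduct.lmul'_apply_tmul, mul_one]

theorem counitCoef_inR (f g : Mer) : counitCoef (inR f) g = f * g := by
  change (Algebra.TensorProduct.lmul' ℂ ((1 : Mer) ⊗ₜ[ℂ] f)) * g = _
  rw [Algebra.TensorProduct.lmul'_apply_tmul, one_mul]

/-- The values of the counit on the generators. -/
def counitData (q : QParam) : RepData q (Module.End ℂ Mer) where
  s := counitCoef
  al := (Mer.T (-1)).toLinearMap
  be := 0
  ga := 0
  de := (Mer.T 1).toLinearMap
  al_left f := by
    ext g
    simp [Module.End.mul_apply, counitCoef_inL, T_neg_T]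
  al_right f := by
    ext g
    simp [Module.End.mul_apply, counitCoef_inR, T_neg_T]
  be_left f := by simp
  be_right f := by simp
  ga_left f := by simp
  ga_right f := by simp
  de_left f := by
    ext g
    simp [Module.End.mul_apply, counitCoef_inL, T_one_T]
  de_right f := by
    ext g
    simp [Module.End.mul_apply, counitCoef_inR, T_one_T]
  al_be := by simp
  al_ga := by simp
  be_de := by simp
  ga_de := by simp
  det1 := by
    ext g
    simp [Module.End.mul_apply, T_neg_T]
  det2 := by
    ext g
    simp [Module.End.mul_apply, T_one_T]
  det3 := by
    ext g
    simp [Module.End.mul_apply, T_one_T, counitCoef_inL, counitCoef_inR]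

/-- The counit, an algebra homomorphism to the difference operators on `Mer`:
`ε(α) = T_{-1}`, `ε(β) = ε(γ) = 0`, `ε(δ) = T_1`, `ε(f(λ)) = ε(f(μ)) = f`. -/
def FR.counit (q : QParam) : FR q →ₐ[ℂ] Module.End ℂ Mer := (counitData q).lift

/-! ## Tensor products -/

/-- `F_R(SL(2))` as a vector space over `Mer`, through the left moment map. -/
instance (q : QParam) : Module Mer (FR q) := Module.compHom (FR q) (FR.muL q).toRingHom

theorem FR.smul_def {q : QParam} (f : Mer) (a : FR q) : f • a = FR.muL q f * a := rfl

/-- `F_R(SL(2))` as a vector space over `Mer`, through the right moment map: `f a = f(μ) a`. -/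
def RMod (q : QParam) : Type := FR q

instance (q : QParam) : AddCommGroup (RMod q) := inferInstanceAs (AddCommGroup (FR q))
instance (q : QParam) : Module Mer (RMod q) := Module.compHom (FR q) (FR.muR q).toRingHom

/-- The tensor product `A ⊗ V` of `A = F_R(SL(2))` and a vector space `V` over `M = Mer`, modulo
`f(μ) a ⊗ v = a ⊗ f v`. It contains
`A ⊗~ V = ⨁ A_{αβ} ⊗ V_β` as a direct summand. -/
def Tens (q : QParam) (V : Type*) [AddCommGroup V] [Module Mer V] : Type _ :=
  TensorProduct Mer (RMod q) V

namespace Tens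

variable {q : QParam} {V W : Type*} [AddCommGroup V] [Module Mer V] [AddCommGroup W] [Module Mer W]

instance : AddCommGroup (Tens q V) := inferInstanceAs (AddCommGroup (TensorProduct Mer (RMod q) V))

/-- The pure tensor `a ⊗ v`. -/
def tm (a : FR q) (v : V) : Tens q V := TensorProduct.tmul Mer (show RMod q from a) v

theorem add_tm (a b : FR q) (v : V) : tm (a + b) v = tm a v + tm b v :=
  TensorProduct.add_tmul (R := Mer) (show RMod q from a) (show RMod q from b) v

theorem tm_add (a : FR q) (v w : V) : tm a (v + w) = tm a v + tm a w :=
  TensorProduct.tmul_add (R := Mer) (show RMod q from a) v w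

theorem zero_tm (v : V) : tm (0 : FR q) v = 0 := TensorProduct.zero_tmul (R := Mer) (RMod q) v

theorem tm_zero (a : FR q) : tm a (0 : V) = 0 :=
  TensorProduct.tmul_zero (R := Mer) V (show RMod q from a)

/-- `f(μ) a ⊗ v = a ⊗ f v`. -/
theorem muR_tm (f : Mer) (a : FR q) (v : V) : tm (FR.muR q f * a) v = tm a (f • v) :=
  TensorProduct.smul_tmul (R := Mer) f (show RMod q from a) v

theorem ind {P : Tens q V → Prop} (h0 : P 0) (ht : ∀ a v, P (tm a v))
    (ha : ∀ x y, P x → P y → P (x + y)) (x : Tens q V) : P x :=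
  TensorProduct.induction_on (motive := P) x h0 (fun a v => ht a v) ha

/-- The additive map out of `A ⊗ V` given by a balanced biadditive map. -/
def lift {Z : Type*} [AddCommGroup Z] (φ : FR q →+ V →+ Z)
    (h : ∀ f a v, φ (FR.muR q f * a) v = φ a (f • v)) : Tens q V →+ Z :=
  TensorProduct.liftAddHom (R := Mer) (M := RMod q) (N := V) φ (fun r m n => h r m n)

theorem lift_tm {Z : Type*} [AddCommGroup Z] (φ : FR q →+ V →+ Z)
    (h : ∀ f a v, φ (FR.muR q f * a) v = φ a (f • v)) (a : FR q) (v : V) :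
    lift φ h (tm a v) = φ a v := rfl

/-- The biadditive map `(a, v) ↦ a ⊗ v`. -/
def tmHom (q : QParam) (V : Type*) [AddCommGroup V] [Module Mer V] : FR q →+ V →+ Tens q V where
  toFun a :=
    { toFun := fun v => tm a v
      map_zero' := tm_zero a
      map_add' := tm_add a }
  map_zero' := by ext v; exact zero_tm v
  map_add' a b := by ext v; exact add_tm a b v

/-- The map `a ⊗ v ↦ x a ⊗ v`, for `x` commuting with all `f(μ)`. -/
def mulL (x : FR q) (hx : ∀ f, x * FR.muR q f = FR.muR q f * x) : Tens q V →+ Tens q V :=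
  lift ((tmHom q V).comp (AddMonoidHom.mulLeft x)) (fun f a v => by
    change tm (x * (FR.muR q f * a)) v = tm (x * a) (f • v)
    rw [← mul_assoc, hx, mul_assoc, muR_tm])

theorem muL_comm (f g : Mer) : FR.muL q f * FR.muR q g = FR.muR q g * FR.muL q f := by
  rw [FR.muL, FR.muR, AlgHom.comp_apply, AlgHom.comp_apply, ← map_mul, mul_comm, map_mul]

/-- The extension of scalars `f (a ⊗ v) = f(λ) a ⊗ v`. -/
instance : Module Mer (Tens q V) where
  smul f x := mulL (FR.muL q f) (muL_comm f) x
  one_smul x := by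
    induction x using ind with
    | h0 => exact map_zero _
    | ht a v =>
      change tm (FR.muL q 1 * a) v = _
      rw [map_one, one_mul]
    | ha x y hx hy => exact (map_add _ x y).trans (congrArg₂ _ hx hy)
  mul_smul f g x := by
    induction x using ind with
    | h0 => exact (map_zero _).trans (by
        change _ = mulL _ _ (mulL _ _ 0)
        rw [map_zero, map_zero])
    | ht a v =>
      change tm (FR.muL q (f * g) * a) v = tm (FR.muL q f * (FR.muL q g * a)) v
      rw [map_mul, mul_assoc]
    | ha x y hx hy =>
      refine (map_add _ x y).trans ((congrArg₂ _ hx hy).trans ?_)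
      change _ = mulL _ _ (mulL _ _ (x + y))
      rw [map_add, map_add]; rfl
  smul_zero f := map_zero _
  smul_add f x y := map_add _ x y
  zero_smul x := by
    induction x using ind with
    | h0 => exact map_zero _
    | ht a v =>
      change tm (FR.muL q 0 * a) v = _
      rw [map_zero, zero_mul, zero_tm]
    | ha x y hx hy => exact (map_add _ x y).trans ((congrArg₂ _ hx hy).trans (add_zero 0))
  add_smul f g x := by
    induction x using ind with
    | h0 => exact (map_zero _).trans (by
        change _ = mulL _ _ 0 + mulL _ _ 0
        rw [map_zero, map_zero, add_zero])
    | ht a v =>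
      change tm (FR.muL q (f + g) * a) v = tm (FR.muL q f * a) v + tm (FR.muL q g * a) v
      rw [map_add, add_mul, add_tm]
    | ha x y hx hy =>
      refine (map_add _ x y).trans ((congrArg₂ _ hx hy).trans ?_)
      change _ = mulL _ _ (x + y) + mulL _ _ (x + y)
      rw [map_add, map_add]
      exact add_add_add_comm _ _ _ _

theorem smul_tm (f : Mer) (a : FR q) (v : V) : f • tm a v = tm (FR.muL q f * a) v := rfl

/-- The complex vector space underlying `A ⊗ V`. -/
instance : Module ℂ (Tens q V) := Module.compHom (Tens q V) (algebraMap ℂ Mer)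

theorem csmul_tm (c : ℂ) (a : FR q) (v : V) : c • tm a v = tm (c • a) v := by
  change cst c • tm a v = _
  rw [smul_tm, Algebra.smul_def]
  exact congrArg (fun t => tm (t * a) v) ((FR.muL q).commutes c)

/-- The map `id ⊗ φ`. -/
def map (φ : V →ₗ[Mer] W) : Tens q V →ₗ[Mer] Tens q W where
  toFun := lift
    { toFun := fun a => (tmHom q W a).comp φ.toAddMonoidHom
      map_zero' := by ext v; exact zero_tm _
      map_add' := fun a b => by ext v; exact add_tm a b _ }
    (fun f a v => by
      change tm (FR.muR q f * a) (φ v) = tm a (φ (f • v))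
      rw [muR_tm, map_smul])
  map_add' := map_add _
  map_smul' f x := by
    induction x using ind with
    | h0 => rw [smul_zero, map_zero]; exact (smul_zero _).symm
    | ht a v => rfl
    | ha x y hx hy => rw [smul_add, map_add, map_add, hx, hy]; exact (smul_add _ _ _).symm

theorem map_tm (φ : V →ₗ[Mer] W) (a : FR q) (v : V) : map φ (tm a v) = tm a (φ v) := rfl

/-- The map `a ↦ a ⊗ v`. -/
def tmRight (v : V) : FR q →ₗ[Mer] Tens q V where
  toFun a := tm a v
  map_add' a b := add_tm a b v
  map_smul' _ _ := rfl

end Tens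

/-! ## The coproduct -/

section Coproduct

set_option linter.unusedSimpArgs false

open Tens

variable (q : QParam)

/-- Left multiplication by `x ⊗ y`, that is `a ⊗ b ↦ x a ⊗ y b`, on `A ⊗ A`. It is well defined when
the right weight of `x` equals the left weight of `y`, that is, when `x f(μ) = (σ f)(μ) x` and
`y f(λ) = (σ f)(λ) y` for a common map `σ`. -/
def mulTm {q : QParam} (σ : Mer → Mer) (x y : FR q)
    (hx : ∀ f, x * FR.muR q f = FR.muR q (σ f) * x)
    (hy : ∀ f, y * FR.muL q f = FR.muL q (σ f) * y) : Module.End ℂ (Tens q (FR q)) where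
  toFun := Tens.lift
    { toFun := fun a => (tmHom q (FR q) (x * a)).comp (AddMonoidHom.mulLeft y)
      map_zero' := by ext b; change tm (x * 0) _ = 0; rw [mul_zero, zero_tm]
      map_add' := fun a a' => by
        ext b; change tm (x * (a + a')) (y * b) = tm (x * a) (y * b) + tm (x * a') (y * b)
        rw [mul_add, add_tm] }
    (fun f a b => by
      change tm (x * (FR.muR q f * a)) (y * b) = tm (x * a) (y * (FR.muL q f * b))
      rw [← mul_assoc, hx, mul_assoc, muR_tm, ← mul_assoc, hy, mul_assoc]; rfl)
  map_add' := map_add _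
  map_smul' c t := by
    induction t using Tens.ind with
    | h0 => rw [smul_zero, map_zero]; exact (smul_zero _).symm
    | ht a b =>
      rw [csmul_tm]
      change tm (x * (c • a)) (y * b) = c • tm (x * a) (y * b)
      rw [csmul_tm, mul_smul_comm]
    | ha s t hs ht => rw [smul_add, map_add, map_add, hs, ht]; exact (smul_add _ _ _).symm

theorem mulTm_tm {q : QParam} (σ : Mer → Mer) (x y : FR q)
    (hx : ∀ f, x * FR.muR q f = FR.muR q (σ f) * x)
    (hy : ∀ f, y * FR.muL q f = FR.muL q (σ f) * y) (a b : FR q) :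
    mulTm σ x y hx hy (tm a b) = tm (x * a) (y * b) := rfl

theorem Tens.end_ext {q : QParam} {S T : Module.End ℂ (Tens q (FR q))}
    (h : ∀ a b, S (tm a b) = T (tm a b)) : S = T := by
  ext x
  induction x using Tens.ind with
  | h0 => rw [map_zero, map_zero]
  | ht a b => exact h a b
  | ha x y hx hy => rw [map_add, map_add, hx, hy]

theorem FR.al_muL (f : Mer) : FR.al q * FR.muL q f = FR.muL q (Mer.T (-1) f) * FR.al q := by
  rw [FR.muL, AlgHom.comp_apply, FR.al_coef, T2_inL]; rfl
theorem FR.al_muR (f : Mer) : FR.al q * FR.muR q f = FR.muR q (Mer.T (-1) f) * FR.al q := by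
  rw [FR.muR, AlgHom.comp_apply, FR.al_coef, T2_inR]; rfl
theorem FR.be_muL (f : Mer) : FR.be q * FR.muL q f = FR.muL q (Mer.T (-1) f) * FR.be q := by
  rw [FR.muL, AlgHom.comp_apply, FR.be_coef, T2_inL]; rfl
theorem FR.be_muR (f : Mer) : FR.be q * FR.muR q f = FR.muR q (Mer.T 1 f) * FR.be q := by
  rw [FR.muR, AlgHom.comp_apply, FR.be_coef, T2_inR]; rfl
theorem FR.ga_muL (f : Mer) : FR.ga q * FR.muL q f = FR.muL q (Mer.T 1 f) * FR.ga q := by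
  rw [FR.muL, AlgHom.comp_apply, FR.ga_coef, T2_inL]; rfl
theorem FR.ga_muR (f : Mer) : FR.ga q * FR.muR q f = FR.muR q (Mer.T (-1) f) * FR.ga q := by
  rw [FR.muR, AlgHom.comp_apply, FR.ga_coef, T2_inR]; rfl
theorem FR.de_muL (f : Mer) : FR.de q * FR.muL q f = FR.muL q (Mer.T 1 f) * FR.de q := by
  rw [FR.muL, AlgHom.comp_apply, FR.de_coef, T2_inL]; rfl
theorem FR.de_muR (f : Mer) : FR.de q * FR.muR q f = FR.muR q (Mer.T 1 f) * FR.de q := by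
  rw [FR.muR, AlgHom.comp_apply, FR.de_coef, T2_inR]; rfl

/-- `f(λ) ↦ f(λ) ⊗ 1`. -/
def coprodL : Mer →ₐ[ℂ] Module.End ℂ (Tens q (FR q)) where
  toFun f := mulTm id (FR.muL q f) 1 (muL_comm f) (fun g => by rw [one_mul, mul_one]; rfl)
  map_one' := end_ext fun a b => by rw [mulTm_tm, map_one, one_mul, one_mul]; rfl
  map_mul' f g := end_ext fun a b => by
    rw [Module.End.mul_apply, mulTm_tm, mulTm_tm, mulTm_tm, map_mul, mul_assoc, one_mul, one_mul]
  map_zero' := end_ext fun a b => by rw [mulTm_tm, map_zero, zero_mul, zero_tm]; rfl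
  map_add' f g := end_ext fun a b => by
    rw [LinearMap.add_apply, mulTm_tm, mulTm_tm, mulTm_tm, map_add, add_mul, add_tm]
  commutes' c := end_ext fun a b => by
    rw [mulTm_tm, AlgHom.commutes, one_mul, Module.algebraMap_end_apply, csmul_tm,
      Algebra.smul_def]

/-- `f(μ) ↦ 1 ⊗ f(μ)`. -/
def coprodR : Mer →ₐ[ℂ] Module.End ℂ (Tens q (FR q)) where
  toFun f := mulTm id 1 (FR.muR q f) (fun g => by rw [one_mul, mul_one]; rfl)
    (fun g => (muL_comm g f).symm)
  map_one' := end_ext fun a b => by rw [mulTm_tm, map_one, one_mul, one_mul]; rfl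
  map_mul' f g := end_ext fun a b => by
    rw [Module.End.mul_apply, mulTm_tm, mulTm_tm, mulTm_tm, map_mul, mul_assoc, one_mul, one_mul]
  map_zero' := end_ext fun a b => by rw [mulTm_tm, map_zero, zero_mul, tm_zero]; rfl
  map_add' f g := end_ext fun a b => by
    rw [LinearMap.add_apply, mulTm_tm, mulTm_tm, mulTm_tm, map_add, add_mul, tm_add]
  commutes' c := end_ext fun a b => by
    rw [mulTm_tm, one_mul, Module.algebraMap_end_apply, csmul_tm, Algebra.smul_def,
      ← (FR.muR q).commutes, muR_tm, AlgHom.commutes]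
    exact congrArg (fun t => tm a (t * b)) ((FR.muL q).commutes c).symm

theorem coprodL_commute (f g : Mer) : Commute (coprodL q f) (coprodR q g) :=
  end_ext fun a b => by
    change tm (FR.muL q f * (1 * a)) (1 * (FR.muR q g * b)) =
      tm (1 * (FR.muL q f * a)) (FR.muR q g * (1 * b))
    simp only [one_mul]

/-- `f(λ) g(μ) ↦ f(λ) ⊗ g(μ)`. -/
def coprodCoef : Mer2 →ₐ[ℂ] Module.End ℂ (Tens q (FR q)) :=
  (Algebra.TensorProduct.lift (coprodL q) (coprodR q) (coprodL_commute q) :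
    Mer ⊗[ℂ] Mer →ₐ[ℂ] Module.End ℂ (Tens q (FR q)))

theorem coprodCoef_inL (f : Mer) (a b : FR q) :
    coprodCoef q (inL f) (tm a b) = tm (inL f • a) b := by
  have h : coprodCoef q (inL f) = coprodL q f :=
    (Algebra.TensorProduct.lift_tmul (coprodL q) (coprodR q) (coprodL_commute q) f 1).trans (by
      rw [map_one, mul_one])
  rw [h]
  change tm (FR.muL q f * a) (1 * b) = _
  rw [one_mul]; rfl

theorem coprodCoef_inR (f : Mer) (a b : FR q) :
    coprodCoef q (inR f) (tm a b) = tm a (inR f • b) := by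
  have h : coprodCoef q (inR f) = coprodR q f :=
    (Algebra.TensorProduct.lift_tmul (coprodL q) (coprodR q) (coprodL_commute q) 1 f).trans (by
      rw [map_one, one_mul])
  rw [h]
  change tm (1 * a) (FR.muR q f * b) = _
  rw [one_mul]; rfl

theorem coprodCoef_kst (c : ℂ) (a b : FR q) :
    coprodCoef q (kst c) (tm a b) = tm (kst c • a) b := by
  rw [kst, AlgHom.commutes, Module.algebraMap_end_apply, csmul_tm, FR.csmul_eq, kst]

/-- `f(μ) a ⊗ b = a ⊗ f(λ) b`, in terms of the two-variable coefficients. -/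
theorem rho_tm (f : Mer) (a b : FR q) : tm (inR f • a) b = tm a (inL f • b) := muR_tm f a b

theorem kst_tm (c : ℂ) (a b : FR q) : tm (kst c • a) b = tm a (kst c • b) := by
  have h := rho_tm q (cst c) a b
  rwa [inR_cst, inL_cst] at h

theorem krho_tm (c : ℂ) (f : Mer) (a b : FR q) :
    tm ((kst c * inR f) • a) b = tm a ((kst c * inL f) • b) := by
  rw [mul_smul, kst_tm, rho_tm, smul_smul, mul_comm]

theorem coprodCoef_kinL (c : ℂ) (f : Mer) (a b : FR q) :
    coprodCoef q (kst c * inL f) (tm a b) = tm ((kst c * inL f) • a) b := by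
  rw [map_mul, Module.End.mul_apply, coprodCoef_inL, coprodCoef_kst, smul_smul]

theorem coprodCoef_kinR (c : ℂ) (f : Mer) (a b : FR q) :
    coprodCoef q (kst c * inR f) (tm a b) = tm a ((kst c * inR f) • b) := by
  rw [map_mul, Module.End.mul_apply, coprodCoef_inR, coprodCoef_kst, kst_tm, smul_smul]

theorem sub_tm (a b c : FR q) : tm (a - b) c = (tm a c - tm b c : Tens q (FR q)) := by
  rw [eq_sub_iff_add_eq, ← add_tm, sub_add_cancel]

theorem tm_sub (a b c : FR q) : tm a (b - c) = (tm a b - tm a c : Tens q (FR q)) :=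
  map_sub (tmHom q (FR q) a) b c

/-- `α ⊗ α + β ⊗ γ`. -/
def dAl : Module.End ℂ (Tens q (FR q)) :=
  mulTm (Mer.T (-1)) (FR.al q) (FR.al q) (FR.al_muR q) (FR.al_muL q)
    + mulTm (Mer.T 1) (FR.be q) (FR.ga q) (FR.be_muR q) (FR.ga_muL q)

/-- `α ⊗ β + β ⊗ δ`. -/
def dBe : Module.End ℂ (Tens q (FR q)) :=
  mulTm (Mer.T (-1)) (FR.al q) (FR.be q) (FR.al_muR q) (FR.be_muL q)
    + mulTm (Mer.T 1) (FR.be q) (FR.de q) (FR.be_muR q) (FR.de_muL q)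

/-- `γ ⊗ α + δ ⊗ γ`. -/
def dGa : Module.End ℂ (Tens q (FR q)) :=
  mulTm (Mer.T (-1)) (FR.ga q) (FR.al q) (FR.ga_muR q) (FR.al_muL q)
    + mulTm (Mer.T 1) (FR.de q) (FR.ga q) (FR.de_muR q) (FR.ga_muL q)

/-- `γ ⊗ β + δ ⊗ δ`. -/
def dDe : Module.End ℂ (Tens q (FR q)) :=
  mulTm (Mer.T (-1)) (FR.ga q) (FR.be q) (FR.ga_muR q) (FR.be_muL q)
    + mulTm (Mer.T 1) (FR.de q) (FR.de q) (FR.de_muR q) (FR.de_muL q)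

theorem dAl_tm (a b : FR q) :
    dAl q (tm a b) = tm (FR.al q * a) (FR.al q * b) + tm (FR.be q * a) (FR.ga q * b) := rfl
theorem dBe_tm (a b : FR q) :
    dBe q (tm a b) = tm (FR.al q * a) (FR.be q * b) + tm (FR.be q * a) (FR.de q * b) := rfl
theorem dGa_tm (a b : FR q) :
    dGa q (tm a b) = tm (FR.ga q * a) (FR.al q * b) + tm (FR.de q * a) (FR.ga q * b) := rfl
theorem dDe_tm (a b : FR q) :
    dDe q (tm a b) = tm (FR.ga q * a) (FR.be q * b) + tm (FR.de q * a) (FR.de q * b) := rfl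

theorem FR.al_be_mul (c : FR q) : FR.al q * (FR.be q * c) =
    (kst (qc q) * inR (fFm q)) • (FR.be q * (FR.al q * c)) := by
  rw [← mul_assoc, FR.al_be, FR.smul2_mul, mul_assoc]
theorem FR.al_ga_mul (c : FR q) : FR.al q * (FR.ga q * c) =
    (kst (qc q) * inL (fF q)) • (FR.ga q * (FR.al q * c)) := by
  rw [← mul_assoc, FR.al_ga, FR.smul2_mul, mul_assoc]
theorem FR.be_de_mul (c : FR q) : FR.be q * (FR.de q * c) =
    (kst (qc q) * inL (fF q)) • (FR.de q * (FR.be q * c)) := by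
  rw [← mul_assoc, FR.be_de, FR.smul2_mul, mul_assoc]
theorem FR.ga_de_mul (c : FR q) : FR.ga q * (FR.de q * c) =
    (kst (qc q) * inR (fFm q)) • (FR.de q * (FR.ga q * c)) := by
  rw [← mul_assoc, FR.ga_de, FR.smul2_mul, mul_assoc]
theorem FR.al_de_mul (c : FR q) : FR.al q * (FR.de q * c) =
    c + (kst (qc q) * inL (fF q)) • (FR.ga q * (FR.be q * c)) := by
  rw [← mul_assoc, FR.al_de, add_mul, FR.smul2_mul, mul_assoc, one_mul]
theorem FR.de_al_mul (c : FR q) : FR.de q * (FR.al q * c) =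
    c + (kst (qc q)⁻¹ * inR (fFm q)⁻¹) • (FR.ga q * (FR.be q * c)) := by
  rw [← mul_assoc, FR.de_al, add_mul, FR.smul2_mul, mul_assoc, one_mul]
theorem FR.be_ga_mul (c : FR q) : FR.be q * (FR.ga q * c) =
    (kst (qc q) * inL (fF q) - kst (qc q) * inR (fF q)) • c
      + (inL (fF q) * inR (fFm q)⁻¹) • (FR.ga q * (FR.be q * c)) := by
  rw [← mul_assoc, FR.be_ga, add_mul, FR.smul2_mul, FR.smul2_mul, mul_assoc, one_mul]

theorem key1 (d : FR q) :
    (kst (qc q) * inL (fFm q)) • (FR.al q * (FR.de q * d)) + FR.ga q * (FR.be q * d) =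
    (kst (qc q) * inL (fFm q)) • ((kst (qc q) * inR (fFm q)) • (FR.be q * (FR.ga q * d)))
      + (kst (qc q) * inR (fFm q)) • (FR.de q * (FR.al q * d)) := by
  have hk := kst_q_mul q
  have hL := inL_mul_inv (fF_ne_zero q)
  have hR := inR_mul_inv (fF_ne_zero q)
  have hLm := inL_mul_inv (fFm_ne_zero q)
  have hRm := inR_mul_inv (fFm_ne_zero q)
  have hsL := inL_sum q
  have hsR := inR_sum q
  rw [FR.al_de_mul, FR.be_ga_mul, FR.de_al_mul]
  match_scalars
  · grind
  · grind

theorem key2 (c : FR q) :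
    (kst (qc q) * inR (fF q)) • (FR.al q * (FR.de q * c)) + FR.be q * (FR.ga q * c) =
    (kst (qc q) * inR (fF q)) • ((kst (qc q) * inL (fF q)) • (FR.ga q * (FR.be q * c)))
      + (kst (qc q) * inL (fF q)) • (FR.de q * (FR.al q * c)) := by
  have hk := kst_q_mul q
  have hL := inL_mul_inv (fF_ne_zero q)
  have hR := inR_mul_inv (fF_ne_zero q)
  have hLm := inL_mul_inv (fFm_ne_zero q)
  have hRm := inR_mul_inv (fFm_ne_zero q)
  have hsL := inL_sum q
  have hsR := inR_sum q
  rw [FR.al_de_mul, FR.be_ga_mul, FR.de_al_mul]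
  match_scalars
  · grind
  · grind

theorem key3 (c : FR q) : FR.be q * (FR.ga q * c) =
    (kst (qc q) * inL (fF q)) • (FR.de q * (FR.al q * c)) - (kst (qc q) * inR (fF q)) • c := by
  have hk := kst_q_mul q
  rw [FR.be_ga_mul, FR.de_al_mul]
  match_scalars
  · grind
  · grind

theorem key4 (d : FR q) : FR.be q * (FR.ga q * d) =
    (kst (qc q)⁻¹ * inR (fFm q)⁻¹) • (FR.al q * (FR.de q * d))
      - (kst (qc q)⁻¹ * inL (fFm q)⁻¹) • d := by
  have hk := kst_q_mul q
  have hsL := inL_sum q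
  have hsR := inR_sum q
  rw [FR.be_ga_mul, FR.al_de_mul]
  match_scalars
  · grind
  · grind

/-- The values of the coproduct on the generators: `Δ(α) = α ⊗ α + β ⊗ γ`,
`Δ(β) = α ⊗ β + β ⊗ δ`, `Δ(γ) = γ ⊗ α + δ ⊗ γ`, `Δ(δ) = γ ⊗ β + δ ⊗ δ`,
`Δ(f(λ)) = f(λ) ⊗ 1`, `Δ(f(μ)) = 1 ⊗ f(μ)`, as left multiplication operators on `A ⊗ A`. -/
def coprodData : RepData q (Module.End ℂ (Tens q (FR q))) where
  s := coprodCoef q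
  al := dAl q
  be := dBe q
  ga := dGa q
  de := dDe q
  al_left f := end_ext fun c d => by
    simp only [Module.End.mul_apply, dAl_tm, map_add, coprodCoef_inL, FR.al_smul, FR.be_smul,
      FR.ga_smul, FR.de_smul, T2_inL, T_neg_T, T_one_T]
  al_right f := end_ext fun c d => by
    simp only [Module.End.mul_apply, dAl_tm, map_add, coprodCoef_inR, FR.al_smul, FR.be_smul,
      FR.ga_smul, FR.de_smul, T2_inR, T_neg_T, T_one_T]
  be_left f := end_ext fun c d => by
    simp only [Module.End.mul_apply, dBe_tm, map_add, coprodCoef_inL, FR.al_smul, FR.be_smul,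
      FR.ga_smul, FR.de_smul, T2_inL, T_neg_T, T_one_T]
  be_right f := end_ext fun c d => by
    simp only [Module.End.mul_apply, dBe_tm, map_add, coprodCoef_inR, FR.al_smul, FR.be_smul,
      FR.ga_smul, FR.de_smul, T2_inR, T_neg_T, T_one_T]
  ga_left f := end_ext fun c d => by
    simp only [Module.End.mul_apply, dGa_tm, map_add, coprodCoef_inL, FR.al_smul, FR.be_smul,
      FR.ga_smul, FR.de_smul, T2_inL, T_neg_T, T_one_T]
  ga_right f := end_ext fun c d => by
    simp only [Module.End.mul_apply, dGa_tm, map_add, coprodCoef_inR, FR.al_smul, FR.be_smul,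
      FR.ga_smul, FR.de_smul, T2_inR, T_neg_T, T_one_T]
  de_left f := end_ext fun c d => by
    simp only [Module.End.mul_apply, dDe_tm, map_add, coprodCoef_inL, FR.al_smul, FR.be_smul,
      FR.ga_smul, FR.de_smul, T2_inL, T_neg_T, T_one_T]
  de_right f := end_ext fun c d => by
    simp only [Module.End.mul_apply, dDe_tm, map_add, coprodCoef_inR, FR.al_smul, FR.be_smul,
      FR.ga_smul, FR.de_smul, T2_inR, T_neg_T, T_one_T]
  al_be := end_ext fun c d => by
    simp only [Module.End.mul_apply, dAl_tm, dBe_tm, map_add, coprodCoef_kinR]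
    rw [FR.al_be_mul q d, FR.ga_de_mul q d, FR.al_be_mul q c, krho_tm, krho_tm]
    have h := congrArg (tm (FR.be q * (FR.al q * c))) (key1 q d)
    rw [tm_add, tm_add] at h
    linear_combination (norm := abel) h
  al_ga := end_ext fun c d => by
    simp only [Module.End.mul_apply, dAl_tm, dGa_tm, map_add, coprodCoef_kinL]
    rw [FR.al_ga_mul q d, FR.al_ga_mul q c, FR.be_de_mul q c, ← krho_tm, ← krho_tm]
    have h := congrArg (fun t => tm t (FR.ga q * (FR.al q * d))) (key2 q c)
    simp only [add_tm] at h
    linear_combination (norm := abel) h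
  be_de := end_ext fun c d => by
    simp only [Module.End.mul_apply, dBe_tm, dDe_tm, map_add, coprodCoef_kinL]
    rw [FR.be_de_mul q d, FR.al_ga_mul q c, FR.be_de_mul q c, ← krho_tm, ← krho_tm]
    have h := congrArg (fun t => tm t (FR.de q * (FR.be q * d))) (key2 q c)
    simp only [add_tm] at h
    linear_combination (norm := abel) h
  ga_de := end_ext fun c d => by
    simp only [Module.End.mul_apply, dGa_tm, dDe_tm, map_add, coprodCoef_kinR]
    rw [FR.al_be_mul q d, FR.ga_de_mul q d, FR.ga_de_mul q c, krho_tm, krho_tm]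
    have h := congrArg (tm (FR.de q * (FR.ga q * c))) (key1 q d)
    rw [tm_add, tm_add] at h
    linear_combination (norm := abel) h
  det1 := end_ext fun c d => by
    simp only [Module.End.mul_apply, LinearMap.sub_apply, Module.End.one_apply, dAl_tm, dBe_tm,
      dGa_tm, dDe_tm, map_add, coprodCoef_kinL]
    have hB : tm c (FR.al q * (FR.de q * d)) =
        tm c d + tm c ((kst (qc q) * inL (fF q)) • (FR.ga q * (FR.be q * d))) := by
      rw [← tm_add, ← FR.al_de_mul]
    rw [FR.al_ga_mul q c, FR.be_de_mul q c, FR.al_de_mul q c, key3 q c, add_tm, sub_tm, krho_tm,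
      hB]
    abel
  det2 := end_ext fun c d => by
    simp only [Module.End.mul_apply, LinearMap.sub_apply, Module.End.one_apply, dAl_tm, dBe_tm,
      dGa_tm, dDe_tm, map_add, coprodCoef_kinR]
    have hk := kst_q_mul q
    have hRm := inR_mul_inv (fFm_ne_zero q)
    have e1 : (kst (qc q)⁻¹ * inR (fFm q)⁻¹) * (kst (qc q) * inR (fFm q)) = 1 := by grind
    have hB : tm (FR.de q * (FR.al q * c)) d =
        tm c d + tm ((kst (qc q)⁻¹ * inR (fFm q)⁻¹) • (FR.ga q * (FR.be q * c))) d := by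
      rw [← add_tm, ← FR.de_al_mul]
    rw [FR.al_be_mul q d, FR.ga_de_mul q d, smul_smul, smul_smul, e1, one_smul, one_smul,
      FR.de_al_mul q d, key4 q d, tm_sub, tm_add, ← krho_tm, hB]
    abel
  det3 := end_ext fun c d => by
    simp only [Module.End.mul_apply, LinearMap.sub_apply, Module.End.one_apply, dAl_tm, dBe_tm,
      dGa_tm, dDe_tm, map_add, coprodCoef_inL, coprodCoef_inR, coprodCoef_kst]
    have hk := kst_q_mul q
    have e1 : kst (qc q)⁻¹ * (kst (qc q) * inL (fF q)) = inL (fF q) := by grind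
    have e2 : kst (qc q)⁻¹ * (kst (qc q) * inR (fF q)) = inR (fF q) := by grind
    have e3 := congrArg (fun t => kst (qc q)⁻¹ • t) (key3 q d)
    simp only [smul_sub, smul_smul, e1, e2] at e3
    have hB : tm c (inL (fF q) • (FR.de q * (FR.al q * d))) =
        tm c (kst (qc q)⁻¹ • (FR.be q * (FR.ga q * d))) + tm c (inR (fF q) • d) := by
      rw [← tm_add, e3, sub_add_cancel]
    rw [FR.al_ga_mul q c, FR.be_de_mul q c, FR.al_de_mul q c, key3 q c, smul_add, smul_sub,
      smul_smul, smul_smul, smul_smul, smul_smul, smul_smul, e1, e2, add_tm, sub_tm, rho_tm,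
      kst_tm, hB]
    abel

end Coproduct

open Tens

/-- The coproduct `Δ`. The product of `A ⊗~ A` is `(a ⊗ b) (c ⊗ d) = a c ⊗ b d`, so that `Δ(x)` is
the value at `1 ⊗ 1` of the operator of left multiplication by `Δ(x)`. -/
def FR.coprod (q : QParam) (x : FR q) : Tens q (FR q) := (coprodData q).lift x (tm 1 1)

theorem FR.coprod_add {q : QParam} (x y : FR q) :
    FR.coprod q (x + y) = FR.coprod q x + FR.coprod q y := by
  rw [FR.coprod, map_add]; rfl

theorem FR.coprod_zero (q : QParam) : FR.coprod q 0 = 0 := by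
  rw [FR.coprod, map_zero]; rfl

theorem FR.coprod_muL_mul {q : QParam} (f : Mer) (x : FR q) :
    FR.coprod q (FR.muL q f * x) = f • FR.coprod q x := by
  rw [FR.coprod, map_mul, RepData.lift_muL, Module.End.mul_apply]
  change coprodCoef q (inL f) (FR.coprod q x) = _
  induction FR.coprod q x using Tens.ind with
  | h0 => rw [map_zero, smul_zero]
  | ht a b => rw [coprodCoef_inL]; rfl
  | ha x y hx hy => rw [map_add, hx, hy, smul_add]

theorem FR.coprod_al (q : QParam) :
    FR.coprod q (FR.al q) = tm (FR.al q) (FR.al q) + tm (FR.be q) (FR.ga q) := by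
  rw [FR.coprod, RepData.lift_al]
  change dAl q _ = _
  rw [dAl_tm]; simp only [mul_one]

theorem FR.coprod_be (q : QParam) :
    FR.coprod q (FR.be q) = tm (FR.al q) (FR.be q) + tm (FR.be q) (FR.de q) := by
  rw [FR.coprod, RepData.lift_be]
  change dBe q _ = _
  rw [dBe_tm]; simp only [mul_one]

theorem FR.coprod_ga (q : QParam) :
    FR.coprod q (FR.ga q) = tm (FR.ga q) (FR.al q) + tm (FR.de q) (FR.ga q) := by
  rw [FR.coprod, RepData.lift_ga]
  change dGa q _ = _
  rw [dGa_tm]; simp only [mul_one]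

theorem FR.coprod_de (q : QParam) :
    FR.coprod q (FR.de q) = tm (FR.ga q) (FR.be q) + tm (FR.de q) (FR.de q) := by
  rw [FR.coprod, RepData.lift_de]
  change dDe q _ = _
  rw [dDe_tm]; simp only [mul_one]

/-! ## Corepresentations -/

section Corepresentations

variable {q : QParam} {V : Type} [AddCommGroup V] [Module Mer V]

theorem FR.map_coprod_muR (f : Mer) (a : FR q) (v : V) :
    Tens.map (tmRight v) (FR.coprod q (FR.muR q f * a)) =
      Tens.map (tmRight (f • v)) (FR.coprod q a) := by
  rw [FR.coprod, map_mul, RepData.lift_muR, Module.End.mul_apply]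
  change Tens.map (tmRight v) (coprodCoef q (inR f) (FR.coprod q a)) = _
  induction FR.coprod q a using Tens.ind with
  | h0 => rw [map_zero, map_zero, map_zero]
  | ht c d =>
    rw [coprodCoef_inR, map_tm, map_tm]
    exact congrArg (tm c) (muR_tm f d v)
  | ha x y hx hy => rw [map_add, map_add, map_add, hx, hy]

/-- The map `Δ ⊗ id : A ⊗~ V → A ⊗~ A ⊗~ V`: if `Δ(a) = ∑ a' ⊗ a''`, then `a ⊗ v` goes to
`∑ a' ⊗ (a'' ⊗ v)`. -/
def coprodTens (q : QParam) (V : Type) [AddCommGroup V] [Module Mer V] :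
    Tens q V →+ Tens q (Tens q V) :=
  Tens.lift
    { toFun := fun a =>
        { toFun := fun v => Tens.map (tmRight v) (FR.coprod q a)
          map_zero' := by
            induction FR.coprod q a using Tens.ind with
            | h0 => rw [map_zero]
            | ht c d => rw [map_tm]; exact (congrArg (tm c) (tm_zero d)).trans (tm_zero c)
            | ha x y hx hy => rw [map_add, hx, hy, add_zero]
          map_add' := fun v w => by
            induction FR.coprod q a using Tens.ind with
            | h0 => rw [map_zero, map_zero, map_zero, add_zero]
            | ht c d =>
              rw [map_tm, map_tm, map_tm, ← tm_add]
              exact congrArg (tm c) (tm_add d v w)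
            | ha x y hx hy =>
              rw [map_add, map_add, map_add, hx, hy]; exact add_add_add_comm _ _ _ _ }
      map_zero' := by ext v; change Tens.map _ (FR.coprod q 0) = 0; rw [FR.coprod_zero, map_zero]
      map_add' := fun a b => by
        ext v
        change Tens.map _ (FR.coprod q (a + b)) =
          Tens.map _ (FR.coprod q a) + Tens.map _ (FR.coprod q b)
        rw [FR.coprod_add, map_add] }
    (fun f a v => FR.map_coprod_muR f a v)

/-- The map `ε ⊗ id`, with values in `V` through `f T_{-α} ⊗ v ↦ f v`. As `(f T_{-α}) 1 = f`, this is
`a ⊗ v ↦ (ε(a) 1) v`. -/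
def counitTens (q : QParam) (V : Type) [AddCommGroup V] [Module Mer V] : Tens q V →+ V :=
  Tens.lift
    { toFun := fun a =>
        { toFun := fun v => FR.counit q a 1 • v
          map_zero' := smul_zero _
          map_add' := smul_add _ }
      map_zero' := by ext v; change FR.counit q 0 1 • v = 0; rw [map_zero]; exact zero_smul _ v
      map_add' := fun a b => by
        ext v
        change FR.counit q (a + b) 1 • v = FR.counit q a 1 • v + FR.counit q b 1 • v
        rw [map_add]; exact add_smul _ _ v }
    (fun f a v => by
      change FR.counit q (FR.muR q f * a) 1 • v = FR.counit q a 1 • (f • v)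
      have h : FR.counit q (FR.muR q f * a) 1 = f * FR.counit q a 1 := by
        rw [map_mul, FR.counit, RepData.lift_muR, Module.End.mul_apply]
        exact counitCoef_inR f _
      rw [h, smul_smul, mul_comm])

/-- Products of generators of bidegree `(a, b)`: the functions `f(λ)`, `f(μ)` have bidegree `(0, 0)`,
and `α, β, γ, δ` have bidegrees `(1, 1)`, `(1, -1)`, `(-1, 1)`, `(-1, -1)`. -/
inductive IsMon (q : QParam) : ℂ → ℂ → FR q → Prop
  | left (f : Mer) : IsMon q 0 0 (FR.muL q f)
  | right (f : Mer) : IsMon q 0 0 (FR.muR q f)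
  | al : IsMon q 1 1 (FR.al q)
  | be : IsMon q 1 (-1) (FR.be q)
  | ga : IsMon q (-1) 1 (FR.ga q)
  | de : IsMon q (-1) (-1) (FR.de q)
  | mul {a b c d : ℂ} {x y : FR q} (hx : IsMon q a b x) (hy : IsMon q c d y) :
      IsMon q (a + c) (b + d) (x * y)

/-- The component `A_{ab}` of the bigrading of `A = F_R(SL(2))` by `𝔥* = ℂ`. -/
def FR.gr (q : QParam) (a b : ℂ) : Submodule ℂ (FR q) := Submodule.span ℂ {x | IsMon q a b x}

/-- The component `A_a = ⨁_b A_{ab}` of `A` as an `𝔥`-space. -/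
def FR.grL (q : QParam) (a : ℂ) : Submodule Mer (FR q) :=
  Submodule.span Mer {x | ∃ b, x ∈ FR.gr q a b}

/-- The component `(A ⊗~ V)_a = ⨁_b A_{ab} ⊗ V_b`, for a grading `𝒱` of `V`. -/
def tensGr (q : QParam) (𝒱 : ℂ → Submodule Mer V) (a : ℂ) : Submodule Mer (Tens q V) :=
  Submodule.span Mer {x | ∃ b, ∃ c ∈ FR.gr q a b, ∃ v ∈ 𝒱 b, x = tm c v}

/-- A left corepresentation `π : V → A ⊗~ V` of `A = F_R(SL(2))` on an `𝔥`-space `V`, that is, on a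
vector space over `M` with a grading `V = ⨁ V_a`, `a ∈ 𝔥* = ℂ`, by subspaces over `M`. -/
structure IsCorep (𝒱 : ℂ → Submodule Mer V) (π : V →ₗ[Mer] Tens q V) : Prop where
  internal : DirectSum.IsInternal 𝒱
  graded : ∀ a, ∀ v ∈ 𝒱 a, π v ∈ tensGr q 𝒱 a
  coassoc : ∀ v, coprodTens q V (π v) = Tens.map π (π v)
  counit : ∀ v, counitTens q V (π v) = v

/-- `Γ` are normalizing functions for the matrix elements `t` with respect to the basis `b`:
`π(b_k) = ∑_j t_{kj} ⊗ b_j`, the functions `Γ_k` are nonzero with `Γ̄_k = Γ_k`, and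
`Γ_k(μ) S(t_{kj})^* = Γ_j(λ) t_{jk}`. -/
structure IsNormalizing {ι : Type} (π : V →ₗ[Mer] Tens q V) (b : Module.Basis ι Mer V)
    (t : ι → ι →₀ FR q) (Γ : ι → Mer) : Prop where
  matrix_elements : ∀ k, π (b k) = (t k).sum fun j a => tm a (b j)
  ne_zero : ∀ k, Γ k ≠ 0
  bar_eq : ∀ k, Mer.bar (Γ k) = Γ k
  unitarity : ∀ k j, FR.muR q (Γ k) * FR.star q (FR.antipode q (t k j)) =
    FR.muL q (Γ j) * t j k

/-- A unitarizable corepresentation of `F_R(SU(2))`. -/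
def IsUnitarizable (𝒱 : ℂ → Submodule Mer V) (π : V →ₗ[Mer] Tens q V) : Prop :=
  IsCorep 𝒱 π ∧ ∃ (ι : Type) (b : Module.Basis ι Mer V) (ω : ι → ℂ) (t : ι → ι →₀ FR q)
    (Γ : ι → Mer), (∀ k, b k ∈ 𝒱 (ω k)) ∧ IsNormalizing π b t Γ

end Corepresentations

/-! ## The corepresentations `V_N` and their matrix elements -/

/-- The vector `γ ^ (N - k) α ^ k`. -/
def vN (q : QParam) (N k : ℕ) : FR q := FR.ga q ^ (N - k) * FR.al q ^ k

/-- The span of `γ ^ (N - k) α ^ k`, `0 ≤ k ≤ N`, over the functions `f(λ)`. -/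
def VN (q : QParam) (N : ℕ) : Submodule Mer (FR q) :=
  Submodule.span Mer {x | ∃ k ≤ N, x = vN q N k}

/-- The grading of `V_N` inherited from `A = ⨁ A_a`. -/
def VNgr (q : QParam) (N : ℕ) (a : ℂ) : Submodule Mer (VN q N) :=
  (FR.grL q a).comap (VN q N).subtype

/-- `(a; p)_n = ∏_{0 ≤ i < n} (1 - a p ^ i)`. -/
def qPoch {R : Type*} [CommRing R] (a p : R) (n : ℕ) : R := ∏ i ∈ Finset.range n, (1 - a * p ^ i)

/-- The `q`-binomial coefficient `(q²; q²)_n / ((q²; q²)_k (q²; q²)_{n-k})`, for `0 ≤ k ≤ n`. -/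
def qBinom (q : QParam) (n k : ℕ) : ℂ :=
  qPoch (qc q ^ 2) (qc q ^ 2) n /
    (qPoch (qc q ^ 2) (qc q ^ 2) k * qPoch (qc q ^ 2) (qc q ^ 2) (n - k))

/-- The function `z ↦ (q ^ (2 m - 2 z); q²)_n`, for an integer `m`. -/
def pochFun (q : QParam) (m : ℤ) (n : ℕ) : Mer :=
  qPoch (qE q (-2) (2 * m)) (cst (qc q ^ 2)) n

/-- `Γ_k(z) = [N; k] (q ^ (2 (k - N - z - 1)); q²)_k / (q ^ (-2 z); q²)_k`. -/
def normFun (q : QParam) (N k : ℕ) : Mer :=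
  cst (qBinom q N k) * (pochFun q (k - N - 1) k / pochFun q 0 k)

/-- The matrix element
`t_{kj} = ∑_l [N-k; j-l] [k; l] q ^ (j (j + 2 k - N) + l (3 l - 3 k - 3 j + N))
(q ^ (2 (j - N - μ - 1)); q²)_{j-l} / (q ^ (2 (j + k - l - N - μ - 1)); q²)_{j-l}
γ ^ (j - l) δ ^ (N - k - j + l) α ^ l β ^ (k - l)`,
`max (0, j + k - N) ≤ l ≤ min (j, k)`, for `0 ≤ k, j ≤ N`. -/
def tN (q : QParam) (N k j : ℕ) : FR q :=
  ∑ l ∈ Finset.Icc (j + k - N) (min j k),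
    FR.muR q (cst (qBinom q (N - k) (j - l) * qBinom q k l *
        qc q ^ ((j * (j + 2 * k - N) + l * (3 * l - 3 * k - 3 * j + N) : ℤ))) *
      (pochFun q (j - N - 1) (j - l) / pochFun q (j + k - l - N - 1) (j - l))) *
    (FR.ga q ^ (j - l) * FR.de q ^ (N + l - (k + j)) * FR.al q ^ l * FR.be q ^ (k - l))

end DynSU2

end

open DynSU2

noncomputable section

open DynSU2 DynSU2.Tens

namespace DynSU2

/-! ## Scalars -/

/-! Write v_k = γ^{N-k} α^k and c_n(z) = [z+n+1]/[z+1], where [x] = q^x - q^{-x}. Moving α across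
powers of γ gives α γ^n = c_n(λ) γ^n α, so γ v_k^N = v_k^{N+1} and α v_k^N = c_{N-k}(λ)
v_{k+1}^{N+1}. Multiplying Δ(v_k^N) on the left by Δ(γ) or Δ(α) therefore predicts two recursions in
N for the matrix elements: t^{N+1}_{kj} = c_{N+1-j}(μ) γ t^N_{k,j-1} + δ t^N_{kj}, and c_{N-k}(λ)
t^{N+1}_{k+1,j} = c_{N+1-j}(μ) α t^N_{k,j-1} + β t^N_{kj}. Both are derived here from the explicit
formula (`tt_succ_left`, `tt_succ_right`). The first is the q-Pascal rule. The second is the same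
rule when there is no γ or δ, and in general follows by induction on their number through the
quadratic relation `key2`. Everything else uses the recursions and not the formula.

Unitarity is the comparison of two inverses of the matrix t = (t_{kj}). The antipode gives a right
inverse: ∑_j t_{kj} S(t_{jl}) = δ_{kl} (`sum_tE_antipode`). Under the recursions the induction on N
reduces to the four identities for the generators, which are the case N = 1. The star gives a left
inverse: ∑_j t_{jk}^* Γ_j(λ) t_{jl} = δ_{kl} Γ_k(μ+2k-N) (`sum_star_tE`). Here Γ obeys a two-term
recursion in N (`Gam_succ`). One term fits the first recursion for t, the other fits the second, and
`star_quadratic` collapses their sum into weighted sums at level N. On the diagonal the same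
recursion for Γ, now in μ, puts the two pieces together again. A left and a right inverse over a
ring agree, so S(t_{kj}) = t_{jk}^* Γ_j(λ) Γ_k(μ)⁻¹ (`antipode_tE`). Its star is (i), and the two
inverse relations are (iii).

For (ii), the recursions give Δ(v_k) = ∑_j t_{kj} ⊗ v_j (`coprod_vN`). Coassociativity and the
counit axiom hold at 1 and survive left multiplication by α and γ, hence hold on V_N. Linear
independence of the v_k is seen in a representation by difference operators in which γ moves a
discrete index by one and α does not (`linearIndependent_vN`). The grading is direct because right
multiplication by the function λ acts on A_a as multiplication by λ - a, so the A_a lie in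
eigenspaces with distinct eigenvalues (`iSupIndep_grL`). -/

/-- The constant function `q`. -/
def fQ (q : QParam) : Mer := cst (qc q)

/-- The function `z ↦ q ^ (-2 z)`. -/
def fY (q : QParam) : Mer := qE q (-2) 0

/-- The function `z ↦ 1 - q ^ (2 (a - z))`. -/
def br (q : QParam) (a : ℤ) : Mer := 1 - fQ q ^ (2 * a) * fY q

/-- The function `z ↦ (q ^ (z + n + 1) - q ^ (-z - n - 1)) / (q ^ (z + 1) - q ^ (-z - 1))`. -/
def cf (q : QParam) (n : ℤ) : Mer := fQ q ^ n * br q (-n - 1) / br q (-1)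

/-- The `q`-binomial coefficient, extended by zero. -/
def bin (q : QParam) (n k : ℕ) : Mer := if k ≤ n then cst (qBinom q n k) else 0

variable {q : QParam}

theorem fQ_ne_zero : fQ q ≠ 0 := cst_q_ne_zero q

theorem fY_ne_zero : fY q ≠ 0 := qE_ne_zero _ _ _

theorem cst_zpow (n : ℤ) : cst (qc q ^ n) = fQ q ^ n := map_zpow₀ cst _ _

theorem cst_qc_exp (n : ℤ) : qE q 0 n = fQ q ^ n := by
  rw [qE_const, exp_log_q, ← cst_zpow]; rfl

/-- A nonconstant exponential equals no constant. Every bracket is thus invertible in the field,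
which is what allows denominators to be cleared in all scalar identities below. -/
theorem br_ne_zero (a : ℤ) : br q a ≠ 0 := by
  have h := qE_ne_const (q := q) (log_q_ne_zero q) (a := -2) (by norm_num) ((2 * a : ℤ) : ℂ) 1
  have h1 := qE_add q 0 ((2 * a : ℤ) : ℂ) (-2) 0
  rw [zero_add, add_zero, cst_qc_exp] at h1
  rw [h1, map_one] at h
  intro h0
  apply h
  rw [br, fY] at h0
  linear_combination -h0

theorem T_fQ (a : ℂ) : Mer.T a (fQ q) = fQ q := Mer.T_cst _ _

theorem T_fY (n : ℤ) : Mer.T n (fY q) = fQ q ^ (-2 * n) * fY q := by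
  rw [fY, qE_T, ← cst_qc_exp, ← qE_add]
  push_cast
  rw [zero_add, add_zero]

/-- Integer shifts of the variable only move the integer label, so identities between shifted
scalars become identities between brackets. -/
theorem T_br (n a : ℤ) : Mer.T n (br q a) = br q (a - n) := by
  have h : fQ q ^ (2 * (a - n)) = fQ q ^ (2 * a) * fQ q ^ (-2 * n) := by
    rw [← zpow_add₀ fQ_ne_zero]; congr 1; ring
  rw [br, br, map_sub, map_mul, map_zpow₀, T_fQ, T_fY, map_one, h]; ring

theorem T_one_br (a : ℤ) : Mer.T 1 (br q a) = br q (a - 1) := by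
  have := T_br (q := q) 1 a
  rwa [Int.cast_one] at this

theorem T_neg_one_br (a : ℤ) : Mer.T (-1) (br q a) = br q (a + 1) := by
  have := T_br (q := q) (-1) a
  rwa [Int.cast_neg, Int.cast_one, sub_neg_eq_add] at this

theorem fX_eq : fX q = fQ q ^ 2 * (fY q)⁻¹ := by
  rw [eq_mul_inv_iff_mul_eq₀ fY_ne_zero, fX, fY, ← qE_add, add_neg_cancel, add_zero]
  have := cst_qc_exp (q := q) 2
  push_cast at this
  rw [this, zpow_ofNat]

/-- As a ratio of neighbouring brackets, `fF` has telescoping products of shifts; this is why c_n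
has a closed form. -/
theorem fF_eq : fF q = br q (-2) / br q (-1) := by
  have h1 := fX_sub_one_ne q
  have h2 := br_ne_zero (q := q) (-1)
  have hQ := fQ_ne_zero (q := q)
  have hY := fY_ne_zero (q := q)
  rw [fF, div_eq_div_iff h1 h2, cst_zpow, br, br, fX_eq]
  have e1 : fQ q ^ (2 * (-1) : ℤ) = (fQ q ^ 2)⁻¹ := by
    rw [← zpow_natCast, ← zpow_neg]; rfl
  have e2 : fQ q ^ (2 * (-2) : ℤ) = (fQ q ^ 2)⁻¹ * (fQ q ^ 2)⁻¹ := by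
    rw [← e1, ← zpow_add₀ hQ]; rfl
  have e3 : fQ q ^ (-2 : ℤ) = (fQ q ^ 2)⁻¹ := e1
  rw [e1, e2, e3]
  field_simp

theorem fFm_eq_br : fFm q = br q (-1) / br q 0 := by
  rw [fFm, fF_eq, map_div₀, T_neg_one_br, T_neg_one_br]; rfl

theorem T_one_cf (n : ℤ) : Mer.T 1 (cf q n) = fQ q ^ n * br q (-n - 2) / br q (-2) := by
  rw [cf, map_div₀, map_mul, map_zpow₀, T_fQ, T_one_br, T_one_br]
  congr 3
  ring

theorem T_neg_one_cf (n : ℤ) : Mer.T (-1) (cf q n) = fQ q ^ n * br q (-n) / br q 0 := by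
  rw [cf, map_div₀, map_mul, map_zpow₀, T_fQ, T_neg_one_br, T_neg_one_br]
  congr 3
  ring

theorem cf_zero : cf q 0 = 1 := by
  rw [cf, zpow_zero, one_mul, neg_zero, zero_sub, div_self (br_ne_zero _)]

/-- `c_{n+1}(z) = q F(z) c_n(z + 1)`. -/
theorem cf_succ (n : ℤ) : cf q (n + 1) = fQ q * fF q * Mer.T 1 (cf q n) := by
  have h1 := br_ne_zero (q := q) (-1)
  have h2 := br_ne_zero (q := q) (-2)
  rw [T_one_cf, cf, fF_eq, zpow_add_one₀ fQ_ne_zero,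
    show -(n + 1) - 1 = -n - 2 by ring]
  field_simp

/-- `c_{n-1}(z) = (q F(z - 1))⁻¹ c_n(z - 1)`. -/
theorem cf_pred (n : ℤ) : cf q (n - 1) = (fQ q * fFm q)⁻¹ * Mer.T (-1) (cf q n) := by
  have h1 := br_ne_zero (q := q) (-1)
  have h2 := br_ne_zero (q := q) 0
  have hQ := fQ_ne_zero (q := q)
  rw [T_neg_one_cf, cf, fFm_eq_br, zpow_sub_one₀ fQ_ne_zero,
    show -(n - 1) - 1 = -n by ring]
  field_simp

theorem cf_neg_one : cf q (-1) = (fQ q * fFm q)⁻¹ := by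
  have := cf_pred (q := q) 0
  rwa [cf_zero, map_one, mul_one, zero_sub] at this

theorem bar_fQ : Mer.bar (fQ q) = fQ q := by
  rw [fQ, Mer.bar_cst, conj_qc]

theorem bar_fY : Mer.bar (fY q) = fY q := by
  rw [fY, qE_bar, map_zero, map_neg, Complex.conj_ofNat]

theorem bar_br (a : ℤ) : Mer.bar (br q a) = br q a := by
  rw [br, map_sub, map_mul, map_zpow₀, bar_fQ, bar_fY, map_one]

theorem bar_cf (n : ℤ) : Mer.bar (cf q n) = cf q n := by
  rw [cf, map_div₀, map_mul, map_zpow₀, bar_fQ, bar_br, bar_br]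

/-! ## `q`-binomial coefficients -/

theorem qPoch_succ {R : Type*} [CommRing R] (a p : R) (n : ℕ) :
    qPoch a p (n + 1) = qPoch a p n * (1 - a * p ^ n) := Finset.prod_range_succ _ _

theorem qc_pow_ne_one (n : ℕ) : 1 - qc q ^ 2 * (qc q ^ 2) ^ n ≠ 0 := by
  rw [← pow_succ', ← pow_mul, qc, sub_ne_zero]
  have h : (q : ℝ) ^ (2 * (n + 1)) < 1 := pow_lt_one₀ q.2.1.le q.2.2 (by omega)
  exact_mod_cast h.ne'

theorem qPoch_ne_zero (n : ℕ) : qPoch (qc q ^ 2) (qc q ^ 2) n ≠ 0 :=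
  Finset.prod_ne_zero_iff.2 fun i _ => qc_pow_ne_one i

theorem qBinom_zero_right (n : ℕ) : qBinom q n 0 = 1 := by
  have h := qPoch_ne_zero (q := q) n
  rw [qBinom, Nat.sub_zero, qPoch, qPoch, Finset.prod_range_zero, one_mul]
  exact div_self h

theorem qBinom_self (n : ℕ) : qBinom q n n = 1 := by
  have h := qPoch_ne_zero (q := q) n
  rw [qBinom, Nat.sub_self, qPoch, qPoch, Finset.prod_range_zero, mul_one]
  exact div_self h

theorem qBinom_ne_zero (n k : ℕ) : qBinom q n k ≠ 0 :=
  div_ne_zero (qPoch_ne_zero _) (mul_ne_zero (qPoch_ne_zero _) (qPoch_ne_zero _))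

theorem qBinom_conj (n k : ℕ) : (starRingEnd ℂ) (qBinom q n k) = qBinom q n k := by
  have h (m : ℕ) : (starRingEnd ℂ) (qPoch (qc q ^ 2) (qc q ^ 2) m) =
      qPoch (qc q ^ 2) (qc q ^ 2) m := by
    simp only [qPoch, map_prod, map_sub, map_one, map_mul, map_pow, conj_qc]
  rw [qBinom, map_div₀, map_mul, h, h, h]

theorem bin_zero_right (n : ℕ) : bin q n 0 = 1 := by
  rw [bin, if_pos (Nat.zero_le n), qBinom_zero_right, map_one]

theorem bin_self (n : ℕ) : bin q n n = 1 := by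
  rw [bin, if_pos le_rfl, qBinom_self, map_one]

theorem bin_of_lt {n k : ℕ} (h : n < k) : bin q n k = 0 := if_neg (by omega)

theorem bin_of_le {n k : ℕ} (h : k ≤ n) : bin q n k = cst (qBinom q n k) := if_pos h

theorem T_bin (a : ℂ) (n k : ℕ) : Mer.T a (bin q n k) = bin q n k := by
  rw [bin]; split_ifs
  · exact Mer.T_cst _ _
  · exact map_zero _

theorem bar_bin (n k : ℕ) : Mer.bar (bin q n k) = bin q n k := by
  rw [bin]; split_ifs
  · rw [Mer.bar_cst, qBinom_conj]
  · exact map_zero _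

/-- The two `q`-Pascal identities in one. -/
theorem bin_pascal (n k : ℕ) : bin q (n + 1) (k + 1) * br q (-1) =
    bin q n k * fQ q ^ (2 * (n - k : ℤ)) * br q (k - n - 1) + bin q n (k + 1) * br q k := by
  -- Both sides have degree one in q^{-2z}. The constant terms and the coefficients of q^{-2z} give
  -- the two Pascal rules. For n ≤ k the convention that `bin` vanishes above the diagonal enters.
  rcases lt_trichotomy n k with h | rfl | h
  · rw [bin_of_lt (by omega), bin_of_lt h, bin_of_lt (by omega)]; ring
  · rw [bin_self, bin_self, bin_of_lt (by omega), sub_self, mul_zero, zpow_zero]; ring_nf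
  · obtain ⟨m, rfl⟩ := Nat.exists_eq_add_of_lt h
    have e1 : fQ q ^ (2 * ((k + m + 1 : ℕ) - k : ℤ)) = fQ q ^ 2 * (fQ q ^ 2) ^ m := by
      rw [← pow_succ', ← pow_mul, ← zpow_natCast]; congr 1; push_cast; ring
    have e2 : fQ q ^ (2 * (-1) : ℤ) = (fQ q ^ 2)⁻¹ := by
      rw [← zpow_natCast, ← zpow_neg]; rfl
    have e3 : fQ q ^ (2 * (k : ℤ)) = (fQ q ^ 2) ^ k := by
      rw [← pow_mul, ← zpow_natCast]; congr 1
    have e4 : fQ q ^ (2 * (k - (k + m + 1 : ℕ) - 1 : ℤ)) = ((fQ q ^ 2) ^ (m + 2))⁻¹ := by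
      rw [← pow_mul, ← zpow_natCast, ← zpow_neg]; congr 1; push_cast; ring
    have h1 := qPoch_ne_zero (q := q) k
    have h2 := qPoch_ne_zero (q := q) m
    have h3 := qc_pow_ne_one (q := q) k
    have h4 := qc_pow_ne_one (q := q) m
    have hQ := fQ_ne_zero (q := q)
    rw [bin_of_le (by omega), bin_of_le (by omega), bin_of_le (by omega), qBinom, qBinom, qBinom,
      show k + m + 1 + 1 - (k + 1) = m + 1 by omega, show k + m + 1 - k = m + 1 by omega,
      show k + m + 1 - (k + 1) = m by omega, qPoch_succ _ _ (k + m + 1), qPoch_succ _ _ k,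
      qPoch_succ _ _ m, br, br, br, e1, e2, e3, e4]
    generalize qPoch (qc q ^ 2) (qc q ^ 2) (k + m + 1) = P
    have c1 := (map_ne_zero cst).2 h1
    have c2 := (map_ne_zero cst).2 h2
    have c3 := (map_ne_zero cst).2 h3
    have c4 := (map_ne_zero cst).2 h4
    simp only [map_div₀, map_mul, map_sub, map_one, map_pow] at c1 c2 c3 c4 ⊢
    change 1 - fQ q ^ 2 * (fQ q ^ 2) ^ k ≠ 0 at c3
    change 1 - fQ q ^ 2 * (fQ q ^ 2) ^ m ≠ 0 at c4
    rw [show cst (qc q) = fQ q from rfl]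
    field_simp
    ring

/-! ## `q`-shifted factorials -/

/-- With consecutive brackets as factors, shifts and conjugation can be applied factor by factor. -/
theorem pochFun_eq (m : ℤ) (n : ℕ) :
    pochFun q m n = ∏ r ∈ Finset.range n, br q (m + r) := by
  rw [pochFun, qPoch]
  refine Finset.prod_congr rfl fun r _ => ?_
  have h1 := qE_add q 0 ((2 * m : ℤ) : ℂ) (-2) 0
  rw [zero_add, add_zero, cst_qc_exp] at h1
  push_cast at h1
  rw [h1, br, map_pow, ← fY, mul_add, zpow_add₀ fQ_ne_zero, show cst (qc q) = fQ q from rfl,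
    ← pow_mul, show (2 * (r : ℤ)) = ((2 * r : ℕ) : ℤ) by push_cast; rfl, zpow_natCast]
  ring

theorem pochFun_ne_zero (m : ℤ) (n : ℕ) : pochFun q m n ≠ 0 := by
  rw [pochFun_eq, Finset.prod_ne_zero_iff]
  exact fun i _ => br_ne_zero _

theorem pochFun_zero (m : ℤ) : pochFun q m 0 = 1 := by
  rw [pochFun_eq, Finset.prod_range_zero]

theorem pochFun_succ (m : ℤ) (n : ℕ) : pochFun q m (n + 1) = pochFun q m n * br q (m + n) := by
  rw [pochFun_eq, pochFun_eq, Finset.prod_range_succ]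

theorem pochFun_succ' (m : ℤ) (n : ℕ) : pochFun q m (n + 1) = br q m * pochFun q (m + 1) n := by
  rw [pochFun_eq, pochFun_eq, Finset.prod_range_succ', mul_comm]
  congr 1
  · simp
  · refine Finset.prod_congr rfl fun r _ => ?_
    congr 1; push_cast; ring

theorem T_one_pochFun (m : ℤ) (n : ℕ) : Mer.T 1 (pochFun q m n) = pochFun q (m - 1) n := by
  rw [pochFun_eq, pochFun_eq, map_prod]
  refine Finset.prod_congr rfl fun r _ => ?_
  rw [T_one_br]; congr 1; ring

theorem T_neg_one_pochFun (m : ℤ) (n : ℕ) : Mer.T (-1) (pochFun q m n) = pochFun q (m + 1) n := by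
  rw [pochFun_eq, pochFun_eq, map_prod]
  refine Finset.prod_congr rfl fun r _ => ?_
  rw [T_neg_one_br]; congr 1; ring

theorem bar_pochFun (m : ℤ) (n : ℕ) : Mer.bar (pochFun q m n) = pochFun q m n := by
  rw [pochFun_eq, map_prod]
  exact Finset.prod_congr rfl fun r _ => bar_br _

/-! ## The normalizing functions -/

/-- The functions `Γ_k`, extended by zero. -/
def Gam (q : QParam) (N k : ℕ) : Mer := bin q N k * (pochFun q (k - N - 1) k / pochFun q 0 k)

theorem Gam_eq {N k : ℕ} (h : k ≤ N) : Gam q N k = normFun q N k := by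
  rw [Gam, normFun, bin_of_le h]

theorem Gam_of_lt {N k : ℕ} (h : N < k) : Gam q N k = 0 := by
  rw [Gam, bin_of_lt h, zero_mul]

theorem Gam_zero_right (N : ℕ) : Gam q N 0 = 1 := by
  rw [Gam, bin_zero_right, pochFun_zero, pochFun_zero, div_one, one_mul]

theorem Gam_ne_zero {N k : ℕ} (h : k ≤ N) : Gam q N k ≠ 0 := by
  rw [Gam, bin_of_le h]
  exact mul_ne_zero ((map_ne_zero cst).2 (qBinom_ne_zero _ _))
    (div_ne_zero (pochFun_ne_zero _ _) (pochFun_ne_zero _ _))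

theorem bar_Gam (N k : ℕ) : Mer.bar (Gam q N k) = Gam q N k := by
  rw [Gam, map_mul, map_div₀, bar_bin, bar_pochFun, bar_pochFun]

/-- `Γ_{k+1}^{N+1}(z) = Γ_{k+1}^N(z + 1) + c_{N-k}(z)² F(z - 1) Γ_k^N(z - 1)`. -/
theorem Gam_succ (N k : ℕ) : Gam q (N + 1) (k + 1) =
    Mer.T 1 (Gam q N (k + 1)) + cf q (N - k) ^ 2 * fFm q * Mer.T (-1) (Gam q N k) := by
  have hP := bin_pascal (q := q) N k
  have a1 : (((k + 1 : ℕ) : ℤ) - ((N + 1 : ℕ) : ℤ) - 1) = k - N - 1 := by push_cast; ring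
  have a2 : (((k + 1 : ℕ) : ℤ) - (N : ℤ) - 1) - 1 = k - N - 1 := by push_cast; ring
  have a3 : (k - N - 1 : ℤ) + 1 = k - N := by ring
  have h1 := br_ne_zero (q := q) (-1)
  have h0 := br_ne_zero (q := q) 0
  have hk := br_ne_zero (q := q) k
  have h2 := pochFun_ne_zero (q := q) 0 k
  have h3 := pochFun_ne_zero (q := q) (0 + 1) k
  have h4 := pochFun_ne_zero (q := q) (-1) (k + 1)
  have e1 := pochFun_succ' (q := q) 0 k
  have e2 := pochFun_succ (q := q) 0 k
  have e3 := pochFun_succ' (q := q) (-1) k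
  rw [show (-1 + 1 : ℤ) = 0 by rfl] at e3
  rw [zero_add] at e1 e2 h3
  have e4 : fQ q ^ (2 * (N - k : ℤ)) = (fQ q ^ (N - k : ℤ)) ^ 2 := by
    rw [mul_comm, zpow_mul, zpow_ofNat]
  rw [e4] at hP
  rw [Gam, Gam, Gam, map_mul, map_mul, map_div₀, map_div₀, T_bin, T_bin, T_one_pochFun,
    T_one_pochFun, T_neg_one_pochFun, T_neg_one_pochFun, a1, a2, a3, cf, fFm_eq_br,
    pochFun_succ' (k - N - 1 : ℤ), a3, zero_sub, e3, zero_add,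
    show -(N - k : ℤ) - 1 = k - N - 1 by ring]
  rw [e1] at e2
  rw [e1]
  -- Peeling (q^{-2z}; q²)_{k+1} at either end compares the factorial starting at label 1 with the
  -- one starting at 0.
  have e5 : pochFun q 1 k = pochFun q 0 k * br q k / br q 0 := by
    field_simp; linear_combination e2
  rw [e5]
  field_simp
  -- With the common factorials removed, the recursion for Γ is the Pascal rule.
  linear_combination br q (k - N - 1) * pochFun q (k - N) k * hP

/-! ## Recursions for the matrix elements -/

theorem kst_eq_inL : kst (qc q) = inL (fQ q) := (inL_cst _).symm

theorem kst_eq_inR : kst (qc q) = inR (fQ q) := (inR_cst _).symm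

/-- The relation for γδ solved for δγ, since c_{-1}(z) = 1/(q F(z-1)). -/
theorem FR.de_ga : FR.de q * FR.ga q = inR (cf q (-1)) • (FR.ga q * FR.de q) := by
  rw [FR.ga_de, smul_smul, kst_eq_inR, ← map_mul, ← map_mul, cf_neg_one,
    inv_mul_cancel₀ (mul_ne_zero fQ_ne_zero (fFm_ne_zero q)), map_one, one_smul]

theorem FR.be_al : FR.be q * FR.al q = inR (cf q (-1)) • (FR.al q * FR.be q) := by
  rw [FR.al_be, smul_smul, kst_eq_inR, ← map_mul, ← map_mul, cf_neg_one,
    inv_mul_cancel₀ (mul_ne_zero fQ_ne_zero (fFm_ne_zero q)), map_one, one_smul]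

/-- Each γ that δ crosses contributes c_{-1}(μ), and γ shifts what was collected before; `cf_pred`
sums this up as c_{-n}. The next two lemmas follow the same pattern, the last one with λ and
`cf_succ`. -/
theorem FR.de_ga_pow (n : ℕ) :
    FR.de q * FR.ga q ^ n = inR (cf q (-n)) • (FR.ga q ^ n * FR.de q) := by
  induction n with
  | zero => simp [cf_zero]
  | succ n ih =>
    rw [pow_succ', ← mul_assoc, FR.de_ga, FR.smul2_mul, mul_assoc, ih, FR.ga_smul, T2_inR,
      smul_smul, ← map_mul, ← mul_assoc, cf_neg_one, ← cf_pred, Nat.cast_succ, neg_add']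

theorem FR.be_al_pow (n : ℕ) :
    FR.be q * FR.al q ^ n = inR (cf q (-n)) • (FR.al q ^ n * FR.be q) := by
  induction n with
  | zero => simp [cf_zero]
  | succ n ih =>
    rw [pow_succ', ← mul_assoc, FR.be_al, FR.smul2_mul, mul_assoc, ih, FR.al_smul, T2_inR,
      smul_smul, ← map_mul, ← mul_assoc, cf_neg_one, ← cf_pred, Nat.cast_succ, neg_add']

theorem FR.al_ga_pow (n : ℕ) :
    FR.al q * FR.ga q ^ n = inL (cf q n) • (FR.ga q ^ n * FR.al q) := by
  induction n with
  | zero => simp [cf_zero]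
  | succ n ih =>
    rw [pow_succ', ← mul_assoc, FR.al_ga, FR.smul2_mul, mul_assoc, ih, FR.ga_smul, T2_inL,
      smul_smul, kst_eq_inL, ← map_mul, ← map_mul, ← mul_assoc, ← cf_succ, Nat.cast_succ]

/-- The coefficient of `γ^i δ^{M-i} α^l β^{k-l}` in the matrix element. -/
def tcoef (q : QParam) (M k i l : ℕ) : Mer :=
  bin q M i * bin q k l * fQ q ^ ((i * (i + (k - l) - M) - l * (k - l) : ℤ)) *
    (pochFun q (i - M - (k - l) - 1) i / pochFun q (i - M - 1) i)

/-- The monomial `γ^i δ^{M-i} α^l β^{k-l}`. -/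
def mon (q : QParam) (M k i l : ℕ) : FR q :=
  FR.ga q ^ i * FR.de q ^ (M - i) * FR.al q ^ l * FR.be q ^ (k - l)

/-- The matrix element `t_{kj}` of `V_{M+k}`, for all `j`. -/
def tt (q : QParam) (M k j : ℕ) : FR q :=
  ∑ x ∈ Finset.HasAntidiagonal.antidiagonal j, inR (tcoef q M k x.1 x.2) • mon q M k x.1 x.2

theorem tcoef_zero (M k l : ℕ) :
    tcoef q M k 0 l = bin q k l * fQ q ^ (-(l * (k - l)) : ℤ) := by
  rw [tcoef, bin_zero_right, pochFun_zero, pochFun_zero, Nat.cast_zero, zero_mul, zero_sub]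
  ring

theorem T_tcoef_zero (a : ℂ) (M k l : ℕ) : Mer.T a (tcoef q M k 0 l) = tcoef q M k 0 l := by
  rw [tcoef_zero, map_mul, map_zpow₀, T_bin, T_fQ]

theorem tcoef_of_lt_left {M k i l : ℕ} (h : M < i) : tcoef q M k i l = 0 := by
  rw [tcoef, bin_of_lt h]; ring

theorem tcoef_of_lt_right {M k i l : ℕ} (h : k < l) : tcoef q M k i l = 0 := by
  rw [tcoef, bin_of_lt h]; ring

/-- The Pascal rule for coefficients. A monomial with γ^{i+1} arises by putting γ before one with
γ^i, or δ before one with γ^{i+1}. The shifts come from carrying the coefficient across γ or δ, and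
c_{-(i+1)} from δ crossing γ^{i+1}. -/
theorem tcoef_succ (M k i l : ℕ) : tcoef q (M + 1) k (i + 1) l =
    cf q (M + k - (i + l)) * Mer.T (-1) (tcoef q M k i l) +
      Mer.T 1 (tcoef q M k (i + 1) l) * cf q (-(i + 1)) := by
  have hP := bin_pascal (q := q) M i
  have hQ := fQ_ne_zero (q := q)
  have h1 := br_ne_zero (q := q) (-1)
  have h2 := br_ne_zero (q := q) (i - M - 1)
  have h3 := pochFun_ne_zero (q := q) (i - M) i
  -- Apart from `bin q k l`, the number k enters only through the integer k - l, which may be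
  -- negative.
  obtain ⟨p, hp⟩ : ∃ p : ℤ, p = k - l := ⟨_, rfl⟩
  have hk : (M + k - (i + l) : ℤ) = M + p - i := by rw [hp]; ring
  have a0 : ((i + 1 : ℕ) - (M + 1 : ℕ) - p - 1 : ℤ) = i - M - p - 1 := by push_cast; ring
  have a1 : ((i + 1 : ℕ) - (M + 1 : ℕ) - 1 : ℤ) = i - M - 1 := by push_cast; ring
  have a2 : ((i + 1 : ℕ) - M - p - 1 - 1 : ℤ) = i - M - p - 1 := by push_cast; ring
  have a3 : ((i + 1 : ℕ) - M - 1 - 1 : ℤ) = i - M - 1 := by push_cast; ring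
  have a4 : (i - M - p - 1 + 1 : ℤ) = i - M - p := by ring
  have a5 : (i - M - 1 + 1 : ℤ) = i - M := by ring
  have a6 : (-(M + p - i) - 1 : ℤ) = i - M - p - 1 := by ring
  have a7 : (-(-(i + 1)) - 1 : ℤ) = i := by ring
  rw [hk]
  simp only [tcoef, ← hp, map_mul, map_div₀, map_zpow₀, T_bin, T_fQ, T_one_pochFun,
    T_neg_one_pochFun]
  rw [a0, a1, a2, a3, a4, a5, cf, cf, a6, a7, pochFun_succ', pochFun_succ', a4, a5]

  have e1 : fQ q ^ (((i + 1 : ℕ) : ℤ) * ((i + 1 : ℕ) + p - M) - l * p) =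
      fQ q ^ (((i + 1 : ℕ) : ℤ) * ((i + 1 : ℕ) + p - (M + 1 : ℕ)) - l * p) * fQ q ^ (i + 1 : ℤ) := by
    rw [← zpow_add₀ hQ]; congr 1; push_cast; ring
  have e2 : fQ q ^ (M + p - i : ℤ) * fQ q ^ (i * (i + p - M) - l * p) =
      fQ q ^ (((i + 1 : ℕ) : ℤ) * ((i + 1 : ℕ) + p - (M + 1 : ℕ)) - l * p) *
        fQ q ^ (2 * (M - i : ℤ)) := by
    rw [← zpow_add₀ hQ, ← zpow_add₀ hQ]; congr 1; push_cast; ring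
  rw [e1, zpow_neg]
  have h4 := zpow_ne_zero (i + 1 : ℤ) hQ
  generalize fQ q ^ (((i + 1 : ℕ) : ℤ) * ((i + 1 : ℕ) + p - (M + 1 : ℕ)) - l * p) = E at *
  field_simp
  -- The q-Pascal rule gives the identity; `e2` reconciles the powers of q in the summand coming
  -- from γ.
  linear_combination bin q k l * E * br q (i - M - p - 1) * pochFun q (i - M - p) i * hP -
    bin q k l * br q (i - M - p - 1) * pochFun q (i - M - p) i * br q (i - M - 1) * bin q M i * e2

theorem ga_mon (M k i l : ℕ) : FR.ga q * mon q M k i l = mon q (M + 1) k (i + 1) l := by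
  rw [mon, mon, pow_succ', Nat.add_sub_add_right]; simp only [mul_assoc]

theorem de_mon {M i : ℕ} (h : i ≤ M) (k l : ℕ) :
    FR.de q * mon q M k i l = inR (cf q (-i)) • mon q (M + 1) k i l := by
  have h1 := congrArg (fun t => t * (FR.de q ^ (M - i) * (FR.al q ^ l * FR.be q ^ (k - l))))
    (FR.de_ga_pow (q := q) i)
  rw [mon, mon, show M + 1 - i = M - i + 1 by omega, pow_succ' (FR.de q)]
  simpa only [FR.smul2_mul, mul_assoc] using h1

theorem term_succ (M k i l : ℕ) :
    inR (tcoef q (M + 1) k (i + 1) l) • mon q (M + 1) k (i + 1) l =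
      inR (cf q (M + k - (i + l))) • (FR.ga q * (inR (tcoef q M k i l) • mon q M k i l)) +
        FR.de q * (inR (tcoef q M k (i + 1) l) • mon q M k (i + 1) l) := by
  rw [tcoef_succ, map_add, add_smul, FR.ga_smul, ga_mon, T2_inR, smul_smul, ← map_mul]
  congr 1
  rcases le_or_gt (i + 1) M with h | h
  · rw [FR.de_smul, de_mon h, T2_inR, smul_smul, ← map_mul, Nat.cast_succ]
  -- For i + 1 > M the exponent M - (i+1) is truncated and δ cannot be absorbed, but the coefficient
  -- is zero.
  · rw [tcoef_of_lt_left h, map_zero, zero_mul, map_zero, zero_smul, zero_smul, mul_zero]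

theorem term_zero (M k l : ℕ) :
    inR (tcoef q (M + 1) k 0 l) • mon q (M + 1) k 0 l =
      FR.de q * (inR (tcoef q M k 0 l) • mon q M k 0 l) := by
  rw [FR.de_smul, de_mon (Nat.zero_le M), T2_inR, T_tcoef_zero, Nat.cast_zero, neg_zero, cf_zero,
    map_one, one_smul, tcoef_zero, tcoef_zero]

/-- The shift of a sequence by one place. -/
def pv (f : ℕ → FR q) : ℕ → FR q
  | 0 => 0
  | j + 1 => f j

theorem pv_zero (f : ℕ → FR q) : pv f 0 = 0 := rfl

theorem pv_succ (f : ℕ → FR q) (j : ℕ) : pv f (j + 1) = f j := rfl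

/-- The row recursion `t_{kj} = c(μ) γ t_{k,j-1} + δ t_{kj}`. -/
theorem tt_succ_left (M k j : ℕ) : tt q (M + 1) k j =
    inR (cf q (M + k + 1 - j)) • (FR.ga q * pv (tt q M k) j) + FR.de q * tt q M k j := by
  cases j with
  | zero => simpa [pv_zero, tt] using term_zero M k 0
  | succ j =>
    -- The term with i = 0 receives no γ and is split off; the term (i+1, l) of the antidiagonal of
    -- j+1 is matched with the term (i, l) of that of j.
    rw [pv_succ, tt, tt, tt, Finset.Nat.sum_antidiagonal_succ, Finset.Nat.sum_antidiagonal_succ,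
      mul_add, term_zero, Finset.mul_sum, Finset.mul_sum, Finset.smul_sum, add_left_comm,
      ← Finset.sum_add_distrib]
    congr 1
    refine Finset.sum_congr rfl fun x hx => ?_
    rw [term_succ]
    congr 4
    rw [← Finset.HasAntidiagonal.mem_antidiagonal.1 hx]
    push_cast; ring

theorem tt_zero_left (k j : ℕ) : tt q 0 k j =
    inR (bin q k j * fQ q ^ (-(j * (k - j)) : ℤ)) • (FR.al q ^ j * FR.be q ^ (k - j)) := by
  rw [tt, Finset.sum_eq_single (0, j)]
  · rw [tcoef_zero, mon, Nat.zero_sub, pow_zero, pow_zero, one_mul, one_mul]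
  · intro x hx hne
    rw [tcoef_of_lt_left, map_zero, zero_smul]
    rcases Nat.eq_zero_or_pos x.1 with h | h
    · rw [Finset.HasAntidiagonal.mem_antidiagonal, h, zero_add] at hx
      exact absurd (Prod.ext h hx) hne
    · exact h
  · intro h
    exact absurd (Finset.HasAntidiagonal.mem_antidiagonal.2 (zero_add j)) h

/-- Without γ and δ the coefficients are constants, and the recursion is the Pascal rule for the
words α^j β^{k-j}, the factor c_{-(j+1)} coming from β crossing α^{j+1}. -/
theorem tt_zero_succ_coef (k j : ℕ) :
    bin q (k + 1) (j + 1) * fQ q ^ (-((j + 1) * (k - j)) : ℤ) =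
      cf q (k - j) * (bin q k j * fQ q ^ (-(j * (k - j)) : ℤ)) +
      bin q k (j + 1) * fQ q ^ (-((j + 1) * (k - (j + 1))) : ℤ) * cf q (-(j + 1)) := by
  have hP := bin_pascal (q := q) k j
  have hQ := fQ_ne_zero (q := q)
  have h1 := br_ne_zero (q := q) (-1)
  have e1 : fQ q ^ (-((j + 1) * (k - (j + 1))) : ℤ) =
      fQ q ^ (-((j + 1) * (k - j)) : ℤ) * fQ q ^ (j + 1 : ℤ) := by
    rw [← zpow_add₀ hQ]; congr 1; ring
  have e2 : fQ q ^ (k - j : ℤ) * fQ q ^ (-(j * (k - j)) : ℤ) =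
      fQ q ^ (-((j + 1) * (k - j)) : ℤ) * fQ q ^ (2 * (k - j : ℤ)) := by
    rw [← zpow_add₀ hQ, ← zpow_add₀ hQ]; congr 1; ring
  have h4 := zpow_ne_zero (j + 1 : ℤ) hQ
  rw [e1, cf, cf, zpow_neg _ (j + 1 : ℤ), show (-(k - j) - 1 : ℤ) = j - k - 1 by ring,
    show (-(-(j + 1)) - 1 : ℤ) = j by ring]
  generalize fQ q ^ (-((j + 1) * (k - j)) : ℤ) = E at *
  field_simp
  linear_combination E * hP - br q (j - k - 1) * bin q k j * e2

theorem tt_zero_succ (k j : ℕ) : tt q 0 (k + 1) j =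
    inR (cf q (k + 1 - j)) • (FR.al q * pv (tt q 0 k) j) + FR.be q * tt q 0 k j := by
  have hB (k j : ℕ) (a : ℂ) : Mer.T a (bin q k j * fQ q ^ (-(j * (k - j)) : ℤ)) =
      bin q k j * fQ q ^ (-(j * (k - j)) : ℤ) := by
    rw [map_mul, map_zpow₀, T_bin, T_fQ]
  have hbe (k j : ℕ) : FR.be q * tt q 0 k j =
      inR (bin q k j * fQ q ^ (-(j * (k - j)) : ℤ) * cf q (-j)) •
        (FR.al q ^ j * FR.be q ^ (k + 1 - j)) := by
    -- For j > k the exponent k - j is truncated, so the absorption of β is only claimed where the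
    -- binomial is nonzero.
    rcases le_or_gt j k with h | h
    · rw [tt_zero_left, FR.be_smul, T2_inR, hB, ← mul_assoc, FR.be_al_pow, FR.smul2_mul,
        smul_smul, ← map_mul, mul_assoc (FR.al q ^ j), ← pow_succ', Nat.sub_add_comm h]
    · rw [tt_zero_left, bin_of_lt h]; simp
  cases j with
  | zero =>
    rw [hbe, tt_zero_left, pv_zero, mul_zero, smul_zero, zero_add, Nat.cast_zero, neg_zero,
      cf_zero, bin_zero_right, bin_zero_right, zero_mul, zero_mul, mul_one]
  | succ j =>
    rw [hbe, pv_succ, tt_zero_left, tt_zero_left, FR.al_smul, T2_inR, hB, ← mul_assoc, ← pow_succ',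
      smul_smul, ← map_mul, Nat.add_sub_add_right, ← add_smul, ← map_add]
    congr 2
    have := tt_zero_succ_coef (q := q) k j
    push_cast at this ⊢
    rw [add_sub_add_right_eq_sub]
    exact this

/-- Makes a factor q F(μ) visible, in the form in which it occurs in `key2`. -/
theorem cf_shift (n : ℤ) : inR (cf q (n + 1)) = kst (qc q) * inR (fF q) * inR (Mer.T 1 (cf q n)) := by
  rw [cf_succ, kst_eq_inR, map_mul, map_mul]

/-- The row recursion `c(λ) t_{k+1,j} = c(μ) α t_{k,j-1} + β t_{kj}`. -/
theorem tt_succ_right (M k j : ℕ) : inL (cf q M) • tt q M (k + 1) j =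
    inR (cf q (M + k + 1 - j)) • (FR.al q * pv (tt q M k) j) + FR.be q * tt q M k j := by
  induction M generalizing k j with
  | zero =>
    rw [tt_zero_succ, Nat.cast_zero, cf_zero, map_one, one_smul, zero_add]
  | succ M ih =>
    -- Both recursions are needed at j - 1 as well, where j = 0 reads 0 = 0.
    have ih' : inL (cf q M) • pv (tt q M (k + 1)) j =
        inR (cf q (M + k + 2 - j)) • (FR.al q * pv (pv (tt q M k)) j) +
          FR.be q * pv (tt q M k) j := by
      cases j with
      | zero => simp [pv_zero]
      | succ j =>
        rw [pv_succ, pv_succ, pv_succ, ih]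
        congr 4; push_cast; ring
    have hr : pv (tt q (M + 1) k) j =
        inR (cf q (M + k + 2 - j)) • (FR.ga q * pv (pv (tt q M k)) j) +
          FR.de q * pv (tt q M k) j := by
      cases j with
      | zero => simp [pv_zero]
      | succ j =>
        rw [pv_succ, pv_succ, pv_succ, tt_succ_left]
        congr 4; push_cast; ring
    have hx (x : FR q) : inL (Mer.T 1 (cf q M)) • (FR.ga q * x) = FR.ga q * (inL (cf q M) • x) := by
      rw [FR.ga_smul, T2_inL]
    have hy (x : FR q) : inL (Mer.T 1 (cf q M)) • (FR.de q * x) = FR.de q * (inL (cf q M) • x) := by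
      rw [FR.de_smul, T2_inL]
    -- After expansion, the terms in t_{k,j-2} and t_{k,j} match by αγ = q F(λ) γα and βδ = q F(λ)
    -- δβ. The four terms in t_{k,j-1} contain αδ, βγ, γβ, δα, and their balance is `key2`.
    have hk := key2 q (pv (tt q M k) j)
    have hc := cf_shift (q := q) (M + k + 1 - j)
    rw [show (M + k + 1 - j + 1 : ℤ) = M + k + 2 - j by ring] at hc
    rw [tt_succ_left, hr, tt_succ_left, Nat.cast_succ, cf_succ, map_mul, map_mul, ← kst_eq_inL,
      mul_smul, smul_add, smul_comm _ (inR _), hx, hy, ih, ih',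
      show (M + ((k + 1 : ℕ) : ℤ) + 1 - j) = M + k + 2 - j by push_cast; ring,
      show ((M + 1 : ℤ) + k + 1 - j) = M + k + 2 - j by ring]
    simp only [mul_add, FR.ga_smul, FR.al_smul, FR.be_smul, FR.de_smul, FR.al_ga_mul, FR.be_de_mul,
      T2_inR]
    generalize Mer.T (-1) (cf q (M + k + 2 - j)) = c1 at *
    rw [hc]
    linear_combination (norm := module) (-inR (Mer.T 1 (cf q (M + k + 1 - j)))) • hk

/-! ## The bigrading -/

theorem IsMon.pow {a b : ℂ} {x : FR q} (h : IsMon q a b x) (n : ℕ) :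
    IsMon q (n * a) (n * b) (x ^ n) := by
  induction n with
  | zero =>
    rw [pow_zero, Nat.cast_zero, zero_mul, zero_mul]
    have := IsMon.left (q := q) 1
    rwa [map_one] at this
  | succ n ih =>
    have := IsMon.mul ih h
    rw [pow_succ]
    convert this using 1 <;> push_cast <;> ring

theorem mon_isMon {M k i l : ℕ} (hi : i ≤ M) (hl : l ≤ k) :
    IsMon q (k - M) (2 * (i + l) - M - k) (mon q M k i l) := by
  have h := (((IsMon.ga (q := q)).pow i).mul ((IsMon.de (q := q)).pow (M - i))).mul
    ((IsMon.al (q := q)).pow l) |>.mul ((IsMon.be (q := q)).pow (k - l))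
  rw [Nat.cast_sub hi, Nat.cast_sub hl] at h
  have e1 : (k : ℂ) - M = i * (-1) + (M - i) * (-1) + l * 1 + (k - l) * 1 := by ring
  have e2 : 2 * ((i : ℂ) + l) - M - k = i * 1 + (M - i) * (-1) + l * 1 + (k - l) * (-1) := by ring
  rw [e1, e2]
  exact h

/-- The bidegree records exactly how far functions are shifted when they cross the element, and
shifts add under products. -/
theorem IsMon.mul_muL {a b : ℂ} {x : FR q} (h : IsMon q a b x) (f : Mer) :
    x * FR.muL q f = FR.muL q (Mer.T (-a) f) * x := by
  induction h generalizing f with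
  | left g => rw [neg_zero, Mer.T_zero, ← map_mul, mul_comm, map_mul]
  | right g => rw [neg_zero, Mer.T_zero, muL_comm]
  | al => exact FR.al_muL q f
  | be => exact FR.be_muL q f
  | ga => rw [neg_neg]; exact FR.ga_muL q f
  | de => rw [neg_neg]; exact FR.de_muL q f
  | mul hx hy ihx ihy =>
    rw [mul_assoc, ihy, ← mul_assoc, ihx, mul_assoc, Mer.T_T, neg_add]

theorem IsMon.mul_muR {a b : ℂ} {x : FR q} (h : IsMon q a b x) (f : Mer) :
    x * FR.muR q f = FR.muR q (Mer.T (-b) f) * x := by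
  induction h generalizing f with
  | left g => rw [neg_zero, Mer.T_zero, muL_comm]
  | right g => rw [neg_zero, Mer.T_zero, ← map_mul, mul_comm, map_mul]
  | al => exact FR.al_muR q f
  | be => rw [neg_neg]; exact FR.be_muR q f
  | ga => exact FR.ga_muR q f
  | de => rw [neg_neg]; exact FR.de_muR q f
  | mul hx hy ihx ihy =>
    rw [mul_assoc, ihy, ← mul_assoc, ihx, mul_assoc, Mer.T_T, neg_add]

theorem FR.gr_mul_muL {a b : ℂ} {x : FR q} (h : x ∈ FR.gr q a b) (f : Mer) :
    x * FR.muL q f = FR.muL q (Mer.T (-a) f) * x := by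
  induction h using Submodule.span_induction with
  | mem x hx => exact IsMon.mul_muL hx f
  | zero => rw [zero_mul, mul_zero]
  | add x y _ _ hx hy => rw [add_mul, mul_add, hx, hy]
  | smul c x _ hx => rw [smul_mul_assoc, mul_smul_comm, hx]

theorem FR.gr_mul_muR {a b : ℂ} {x : FR q} (h : x ∈ FR.gr q a b) (f : Mer) :
    x * FR.muR q f = FR.muR q (Mer.T (-b) f) * x := by
  induction h using Submodule.span_induction with
  | mem x hx => exact IsMon.mul_muR hx f
  | zero => rw [zero_mul, mul_zero]
  | add x y _ _ hx hy => rw [add_mul, mul_add, hx, hy]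
  | smul c x _ hx => rw [smul_mul_assoc, mul_smul_comm, hx]

theorem FR.muR_mul_gr {a b : ℂ} {x : FR q} (h : x ∈ FR.gr q a b) (f : Mer) :
    FR.muR q f * x = x * FR.muR q (Mer.T b f) := by
  rw [FR.gr_mul_muR h, Mer.T_T, neg_add_cancel, Mer.T_zero]

theorem FR.muL_mul_gr {a b : ℂ} {x : FR q} (h : x ∈ FR.gr q a b) (f : Mer) :
    FR.muL q f * x = x * FR.muL q (Mer.T a f) := by
  rw [FR.gr_mul_muL h, Mer.T_T, neg_add_cancel, Mer.T_zero]

/-! ### The matrix elements indexed by N -/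

/-- The matrix element `t_{kj}` of `V_N`, for all `j`. -/
def tE (q : QParam) (N k j : ℕ) : FR q := tt q (N - k) k j

/-- If i + l > N = (N-k) + k, then i > N-k or l > k, so one binomial vanishes. This lets sums over j
be extended or shifted freely. -/
theorem tE_eq_zero {N k j : ℕ} (hk : k ≤ N) (hj : N < j) : tE q N k j = 0 := by
  rw [tE, tt]
  refine Finset.sum_eq_zero fun x hx => ?_
  rw [Finset.HasAntidiagonal.mem_antidiagonal] at hx
  rcases le_or_gt x.1 (N - k) with h | h
  · rw [tcoef_of_lt_right (by omega), map_zero, zero_smul]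
  · rw [tcoef_of_lt_left h, map_zero, zero_smul]

/-- All monomials with i + l = j share one bidegree. It determines how functions move across the
matrix elements in the sums below. -/
theorem tE_mem_gr {N k : ℕ} (hk : k ≤ N) (j : ℕ) :
    tE q N k j ∈ FR.gr q (2 * k - N) (2 * j - N) := by
  rw [tE, tt]
  refine Submodule.sum_mem _ fun x hx => ?_
  rw [Finset.HasAntidiagonal.mem_antidiagonal] at hx
  rcases le_or_gt x.1 (N - k) with h | h
  · rcases le_or_gt x.2 k with h' | h'
    · refine Submodule.subset_span ?_
      have h1 := (IsMon.right (q := q) (tcoef q (N - k) k x.1 x.2)).mul (mon_isMon h h')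
      rw [Nat.cast_sub hk] at h1
      have hx' : (x.1 : ℂ) + x.2 = j := by exact_mod_cast hx
      rw [hx'] at h1
      change IsMon q _ _ _
      have e1 : (2 * k - N : ℂ) = 0 + (k - (N - k)) := by ring
      have e2 : (2 * j - N : ℂ) = 0 + (2 * j - (N - k) - k) := by ring
      rw [e1, e2]
      exact h1
    · rw [tcoef_of_lt_right h', map_zero, zero_smul]; exact zero_mem _
  · rw [tcoef_of_lt_left h, map_zero, zero_smul]; exact zero_mem _

/-- Substitute i = j - l. The stated range of l is where both binomials are nonzero, and the
truncated j + k - N supplies the maximum with 0; all other terms of the antidiagonal vanish. -/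
theorem tE_eq_tN {N k : ℕ} (hk : k ≤ N) (j : ℕ) : tN q N k j = tE q N k j := by
  rw [tN, tE, tt]
  refine Finset.sum_of_injOn (fun l => (j - l, l)) (fun l _ l' _ h => congrArg Prod.snd h) ?_ ?_ ?_
  · intro l hl
    have := Finset.mem_Icc.1 hl
    simp only [Finset.mem_coe, Finset.HasAntidiagonal.mem_antidiagonal]
    omega
  · rintro ⟨i, l⟩ hx hne
    rw [Finset.HasAntidiagonal.mem_antidiagonal] at hx
    simp only at hx
    rcases le_or_gt i (N - k) with h | h
    · rcases le_or_gt l k with h' | h'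
      · refine absurd ⟨l, ?_, ?_⟩ hne
        · rw [Finset.mem_coe, Finset.mem_Icc]; omega
        · simp only [Prod.mk.injEq, and_true]; omega
      · rw [tcoef_of_lt_right h', map_zero, zero_smul]
    · rw [tcoef_of_lt_left h, map_zero, zero_smul]
  · intro l hl
    have hl' := Finset.mem_Icc.1 hl
    have h1 : l ≤ k := by omega
    have h2 : j - l ≤ N - k := by omega
    have h3 : l ≤ j := by omega
    change FR.muR q _ * _ = FR.muR q _ * _
    rw [tcoef, mon, bin_of_le h1, bin_of_le h2, ← cst_zpow, ← map_mul, ← map_mul,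
      show N + l - (k + j) = N - k - (j - l) by omega, Nat.cast_sub h3, Nat.cast_sub hk]
    congr 4
    · congr 2; ring
    · congr 1; ring
    · change _ = pochFun q _ (j - l)
      congr 1; ring

theorem tE_succ_left {N k : ℕ} (hk : k ≤ N) (j : ℕ) : tE q (N + 1) k j =
    inR (cf q (N + 1 - j)) • (FR.ga q * pv (tE q N k) j) + FR.de q * tE q N k j := by
  have h := tt_succ_left (q := q) (N - k) k j
  rw [Nat.cast_sub hk, sub_add_cancel] at h
  rw [tE, Nat.sub_add_comm hk, h]; rfl

theorem tE_succ_right {N k : ℕ} (hk : k ≤ N) (j : ℕ) :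
    inL (cf q (N - k)) • tE q (N + 1) (k + 1) j =
    inR (cf q (N + 1 - j)) • (FR.al q * pv (tE q N k) j) + FR.be q * tE q N k j := by
  have h := tt_succ_right (q := q) (N - k) k j
  rw [Nat.cast_sub hk, sub_add_cancel] at h
  rw [tE, Nat.add_sub_add_right, h]; rfl

/-- The bottom row is out of reach of the first recursion; in the second its coefficient on the left
is c_0 = 1. -/
theorem tE_succ_last (N j : ℕ) : tE q (N + 1) (N + 1) j =
    inR (cf q (N + 1 - j)) • (FR.al q * pv (tE q N N) j) + FR.be q * tE q N N j := by
  rw [← tE_succ_right le_rfl, sub_self, cf_zero, map_one, one_smul]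

theorem tE_zero_zero : tE q 0 0 0 = 1 := by
  rw [tE, tt_zero_left, bin_zero_right, pow_zero, pow_zero, mul_one, Nat.cast_zero, zero_mul,
    neg_zero, zpow_zero, mul_one, map_one, one_smul]

/-! ## The antipode of the matrix elements -/

theorem antipode_add (x y : FR q) :
    FR.antipode q (x + y) = FR.antipode q x + FR.antipode q y := by
  rw [FR.antipode, map_add]; rfl

theorem antipode_zero : FR.antipode q 0 = 0 := by
  rw [FR.antipode, map_zero]; rfl

theorem antipode_one : FR.antipode q 1 = 1 := by
  rw [FR.antipode, map_one]; rfl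

/-- The antipode exchanges λ and μ, so the left degree of x decides how S(x) passes f(μ). -/
theorem antipode_mul_muR {a b : ℂ} {x : FR q} (h : x ∈ FR.gr q a b) (f : Mer) :
    FR.antipode q x * FR.muR q f = FR.muR q (Mer.T a f) * FR.antipode q x := by
  rw [← FR.antipode_muL, ← FR.antipode_mul, FR.muL_mul_gr h, FR.antipode_mul, FR.antipode_muL]

theorem antipode_al' : FR.antipode q (FR.al q) =
    (inL (fF q) * inR (fF q)⁻¹) • FR.de q := by
  rw [FR.antipode_al, FR.smul2_def, map_mul]; rfl

theorem antipode_be' : FR.antipode q (FR.be q) =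
    -((kst (qc q)⁻¹ * inR (fF q)⁻¹) • FR.be q) := by
  rw [FR.antipode_be, FR.csmul_eq, mul_smul]; rfl

theorem antipode_ga' : FR.antipode q (FR.ga q) =
    -((kst (qc q) * inL (fF q)) • FR.ga q) := by
  rw [FR.antipode_ga, FR.csmul_eq, mul_smul]; rfl

/-- This and the next three lemmas say that the matrix of generators times its antipode is the
identity: the orthogonality relation for N = 1. -/
theorem ga_antipode_al :
    FR.ga q * FR.antipode q (FR.al q) + FR.de q * FR.antipode q (FR.ga q) = 0 := by
  have hRm := inR_mul_inv (fFm_ne_zero q)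
  rw [antipode_al', antipode_ga', FR.ga_smul, mul_neg, FR.de_smul, FR.ga_de, map_mul, map_mul]
  simp only [T2_inL, T2_inR, T2_kst, map_inv₀, T_neg_fF, smul_smul]
  match_scalars
  grind

theorem ga_antipode_be :
    FR.ga q * FR.antipode q (FR.be q) + FR.de q * FR.antipode q (FR.de q) = 1 := by
  rw [antipode_be', FR.antipode_de, mul_neg, FR.ga_smul, FR.de_al, map_mul]
  simp only [T2_inR, T2_kst, map_inv₀, T_neg_fF]
  abel

theorem al_antipode_al :
    FR.al q * FR.antipode q (FR.al q) + FR.be q * FR.antipode q (FR.ga q) = 1 := by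
  have hk := kst_q_mul q
  have hL := inL_mul_inv (fF_ne_zero q)
  have hR := inR_mul_inv (fF_ne_zero q)
  have hLm := inL_mul_inv (fFm_ne_zero q)
  have hRm := inR_mul_inv (fFm_ne_zero q)
  have hsL := inL_sum q
  have hsR := inR_sum q
  rw [antipode_al', antipode_ga', FR.al_smul, mul_neg, FR.be_smul, FR.al_de, FR.be_ga, map_mul,
    map_mul]
  simp only [T2_inL, T2_inR, T2_kst, map_inv₀, T_neg_fF, smul_add, smul_smul]
  match_scalars
  · grind
  · grind

theorem al_antipode_be :
    FR.al q * FR.antipode q (FR.be q) + FR.be q * FR.antipode q (FR.de q) = 0 := by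
  have hk := kst_q_mul q
  have hRm := inR_mul_inv (fFm_ne_zero q)
  rw [antipode_be', FR.antipode_de, mul_neg, FR.al_smul, FR.al_be, map_mul]
  simp only [T2_inR, T2_kst, map_inv₀, T_neg_fF, smul_smul]
  match_scalars
  grind

/-- The recursions under an antihomomorphism: the generators move to the right end and c(μ) becomes
c(λ). -/
theorem antipode_tE_succ_left {N k : ℕ} (hk : k ≤ N) (j : ℕ) :
    FR.antipode q (tE q (N + 1) k j) =
      FR.antipode q (pv (tE q N k) j) * (FR.antipode q (FR.ga q) * FR.muL q (cf q (N + 1 - j))) +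
        FR.antipode q (tE q N k j) * FR.antipode q (FR.de q) := by
  rw [tE_succ_left hk, antipode_add]
  change FR.antipode q (FR.muR q _ * _) + _ = _
  rw [FR.antipode_mul, FR.antipode_mul, FR.antipode_mul, FR.antipode_muR, mul_assoc]

theorem antipode_tE_succ_right {N k : ℕ} (hk : k ≤ N) (j : ℕ) :
    FR.antipode q (tE q (N + 1) (k + 1) j) * FR.muR q (cf q (N - k)) =
      FR.antipode q (pv (tE q N k) j) * (FR.antipode q (FR.al q) * FR.muL q (cf q (N + 1 - j))) +
        FR.antipode q (tE q N k j) * FR.antipode q (FR.be q) := by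
  rw [← FR.antipode_muL, ← FR.antipode_mul]
  have h := congrArg (FR.antipode q) (tE_succ_right (q := q) hk j)
  rw [antipode_add] at h
  refine h.trans ?_
  change FR.antipode q (FR.muR q _ * _) + _ = _
  rw [FR.antipode_mul, FR.antipode_mul, FR.antipode_mul, FR.antipode_muR, mul_assoc]

/-- The induction step of the orthogonality relation, treated once for (x, y) = (γ, δ) and (α, β).
The x-terms are reindexed to j + 1 and meet the second recursion for S(t_{j+1,l}), the y-terms meet
the first one for S(t_{jl}). Of x only the right degree 1, shared by γ and α, is used. -/
theorem sum_row_antipode {N k : ℕ} (hk : k ≤ N) (l : ℕ) (x y : FR q)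
    (hx : ∀ f, x * FR.muR q f = FR.muR q (Mer.T (-1) f) * x) :
    ∑ j ∈ Finset.range (N + 2),
        (inR (cf q (N + 1 - j)) • (x * pv (tE q N k) j) + y * tE q N k j) *
          FR.antipode q (tE q (N + 1) j l) =
      x * ((∑ j ∈ Finset.range (N + 1), tE q N k j * FR.antipode q (pv (tE q N j) l)) *
          (FR.antipode q (FR.al q) * FR.muL q (cf q (N + 1 - l))) +
        (∑ j ∈ Finset.range (N + 1), tE q N k j * FR.antipode q (tE q N j l)) *
          FR.antipode q (FR.be q)) +
      y * ((∑ j ∈ Finset.range (N + 1), tE q N k j * FR.antipode q (pv (tE q N j) l)) *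
          (FR.antipode q (FR.ga q) * FR.muL q (cf q (N + 1 - l))) +
        (∑ j ∈ Finset.range (N + 1), tE q N k j * FR.antipode q (tE q N j l)) *
          FR.antipode q (FR.de q)) := by
  simp only [add_mul]
  rw [Finset.sum_mul, Finset.sum_mul, Finset.sum_mul, Finset.sum_mul,
    ← Finset.sum_add_distrib, ← Finset.sum_add_distrib, Finset.mul_sum, Finset.mul_sum,
    Finset.sum_add_distrib]
  congr 1
  · rw [Finset.sum_range_succ', pv_zero, mul_zero, smul_zero, zero_mul, add_zero]
    refine Finset.sum_congr rfl fun j hj => ?_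
    have hj' : j ≤ N := by rw [Finset.mem_range] at hj; omega
    rw [pv_succ, Nat.cast_succ, add_sub_add_right_eq_sub]
    -- The second recursion needs c_{N-j}(μ) to the right of S(t_{j+1,l}). It is carried there
    -- through x, t_{kj} and S(t_{j+1,l}), and the three shifts -1, -(2j-N) and 2(j+1)-(N+1) add up
    -- to 0.
    have h1 := antipode_mul_muR (tE_mem_gr (q := q) (N := N + 1) (k := j + 1) (by omega) l)
      (cf q (N - j))
    have h2 := FR.gr_mul_muR (tE_mem_gr (q := q) hk j)
      (Mer.T (2 * ((j + 1 : ℕ) : ℂ) - ((N + 1 : ℕ) : ℂ)) (cf q (N - j)))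
    rw [Mer.T_T] at h2
    have h3 := hx (Mer.T (-(2 * (j : ℂ) - N) + (2 * ((j + 1 : ℕ) : ℂ) - ((N + 1 : ℕ) : ℂ)))
      (cf q (N - j)))
    rw [Mer.T_T, show (-1 + (-(2 * (j : ℂ) - N) + (2 * ((j + 1 : ℕ) : ℂ) - ((N + 1 : ℕ) : ℂ)))) = 0
      by push_cast; ring, Mer.T_zero] at h3
    change FR.muR q (cf q (N - j)) * (x * tE q N k j) * _ = _
    rw [← mul_assoc (FR.muR q _), ← h3, mul_assoc x, ← h2, mul_assoc x, mul_assoc (tE q N k j),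
      ← h1, antipode_tE_succ_right hj']
    simp only [mul_add, mul_assoc]
  · rw [Finset.sum_range_succ, tE_eq_zero hk (Nat.lt_succ_self N), mul_zero, zero_mul, add_zero]
    refine Finset.sum_congr rfl fun j hj => ?_
    have hj' : j ≤ N := by rw [Finset.mem_range] at hj; omega
    rw [antipode_tE_succ_left hj']
    simp only [mul_add, mul_assoc]

/-- `∑_j t_{kj} S(t_{jl}) = δ_{kl}`. -/
theorem sum_tE_antipode (N k l : ℕ) (hk : k ≤ N) :
    ∑ j ∈ Finset.range (N + 1), tE q N k j * FR.antipode q (tE q N j l) =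
      if k = l then 1 else 0 := by
  induction N generalizing k l with
  | zero =>
    obtain rfl : k = 0 := by omega
    rw [zero_add, Finset.sum_range_one, tE_zero_zero, one_mul]
    rcases Nat.eq_zero_or_pos l with rfl | hl
    · rw [tE_zero_zero, if_pos rfl, antipode_one]
    · rw [tE_eq_zero le_rfl hl, if_neg (by omega), antipode_zero]
  | succ N ih =>
    -- The sum with l replaced by l - 1, again an instance of the induction hypothesis; for l = 0 it
    -- is empty of content because `pv` starts with 0.
    have hA (k : ℕ) (hk : k ≤ N) :
        ∑ j ∈ Finset.range (N + 1), tE q N k j * FR.antipode q (pv (tE q N j) l) =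
          if k + 1 = l then 1 else 0 := by
      cases l with
      | zero => simp [pv_zero, antipode_zero]
      | succ l =>
        simp only [pv_succ, Nat.add_right_cancel_iff]
        exact ih k l hk
    rcases Nat.lt_or_ge k (N + 1) with hk' | hk'
    · have hk'' : k ≤ N := by omega
      rw [Finset.sum_congr rfl fun j _ => by rw [tE_succ_left hk'' j],
        sum_row_antipode hk'' l _ _ (FR.ga_muR q), hA k hk'', ih k l hk'']
      -- At most one of l = k + 1 and l = k holds, so at most one of the two level-N sums is 1 and
      -- the expression reduces to one generator identity, or to 0.
      split_ifs with h1 h2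
      · omega
      · rw [zero_mul, add_zero, zero_mul, add_zero, one_mul, one_mul, ← mul_assoc, ← mul_assoc,
          ← add_mul, ga_antipode_al, zero_mul]
      · rw [zero_mul, zero_add, zero_mul, zero_add, one_mul, one_mul, ga_antipode_be]
      · simp
    · obtain rfl : k = N + 1 := by omega
      rw [Finset.sum_congr rfl fun j _ => by rw [tE_succ_last N j],
        sum_row_antipode le_rfl l _ _ (FR.al_muR q), hA N le_rfl, ih N l le_rfl]
      split_ifs with h1 h2
      · omega
      · rw [zero_mul, add_zero, zero_mul, add_zero, one_mul, one_mul, ← mul_assoc, ← mul_assoc,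
          ← add_mul, al_antipode_al, ← h1]
        -- Here l = N + 1, and the leftover factor c_{N+1-l} is c_0 = 1.
        simp [cf_zero]
      · rw [zero_mul, zero_add, zero_mul, zero_add, one_mul, one_mul, al_antipode_be]
      · simp

/-! ## The star of the matrix elements -/

theorem star_add (x y : FR q) : FR.star q (x + y) = FR.star q x + FR.star q y := by
  rw [FR.star, map_add]; rfl

theorem star_zero : FR.star q 0 = 0 := by
  rw [FR.star, map_zero]; rfl

theorem star_one : FR.star q 1 = 1 := by
  rw [FR.star, map_one]; rfl

theorem star_neg (x : FR q) : FR.star q (-x) = -FR.star q x := by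
  rw [FR.star, map_neg]; rfl

theorem star_coef (x : Mer2) : FR.star q (FR.star q (FR.coef q x)) = FR.coef q x := by
  induction x using Mer2.ind with
  | hadd x y hx hy => rw [map_add, star_add, star_add, hx, hy]
  | hmul f g =>
    have hb (f : Mer) : Mer.bar (Mer.bar f) = f := by
      induction f using Mer.ind with
      | h f hf =>
        rw [Mer.bar_mk, Mer.bar_mk, Mer.mk_eq_mk]
        exact fun x => Filter.Eventually.of_forall fun z => by simp
    rw [map_mul, FR.star_mul, FR.star_mul]
    change FR.star q (FR.star q (FR.muL q f)) * FR.star q (FR.star q (FR.muR q g)) = _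
    rw [FR.star_muL, FR.star_muL, FR.star_muR, FR.star_muR, hb, hb]; rfl

/-- The square of the star is linear and multiplicative, so the generators suffice. Involutivity is
what returns t_{jk} from t_{jk}^* at the end. -/
theorem star_star (x : FR q) : FR.star q (FR.star q x) = x := by
  obtain ⟨x, rfl⟩ := FR.proj_surjective q x
  induction x using FreeAlgebra.induction with
  | grade0 r =>
    rw [AlgHom.commutes, Algebra.algebraMap_eq_smul_one, FR.star_smul, FR.star_smul, star_one,
      star_one, Complex.conj_conj]
  | grade1 x =>
    have hq := qc_ne_zero q
    cases x with
    | coef x => exact star_coef x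
    | al => exact (congrArg (FR.star q) (FR.star_al q)).trans (FR.star_de q)
    | be =>
      change FR.star q (FR.star q (FR.be q)) = FR.be q
      rw [FR.star_be, star_neg, FR.star_smul, FR.star_ga, conj_qc, smul_neg, neg_neg, smul_smul,
        mul_inv_cancel₀ hq, one_smul]
    | ga =>
      change FR.star q (FR.star q (FR.ga q)) = FR.ga q
      rw [FR.star_ga, star_neg, FR.star_smul, FR.star_be, map_inv₀, conj_qc, smul_neg, neg_neg,
        smul_smul, inv_mul_cancel₀ hq, one_smul]
    | de => exact (congrArg (FR.star q) (FR.star_de q)).trans (FR.star_al q)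
  | mul x y hx hy => rw [map_mul, FR.star_mul, FR.star_mul, hx, hy]
  | add x y hx hy => rw [map_add, star_add, star_add, hx, hy]

theorem star_be' : FR.star q (FR.be q) = -(kst (qc q) • FR.ga q) := by
  rw [FR.star_be, FR.csmul_eq]

theorem star_ga' : FR.star q (FR.ga q) = -(kst (qc q)⁻¹ • FR.be q) := by
  rw [FR.star_ga, FR.csmul_eq]

/-- The four quadratic identities behind the recursion for the orthogonality sums. -/
theorem star_quadratic (su sv u v : FR q) (G c c' : Mer) :
    (su * (FR.star q (FR.ga q) * FR.muR q c) + sv * FR.star q (FR.de q)) *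
        (FR.muL q (Mer.T 1 G) * (inR c' • (FR.ga q * u) + FR.de q * v)) +
      (su * (FR.star q (FR.al q) * FR.muR q c) + sv * FR.star q (FR.be q)) *
        (FR.muL q (fFm q * Mer.T (-1) G) * (inR c' • (FR.al q * u) + FR.be q * v)) =
    sv * (FR.muL q G * v) +
      su * (FR.muL q G * (FR.muR q (fF q * (Mer.T 1 c * Mer.T 1 c')) * u)) := by
  have hk := kst_q_mul q
  have hL := inL_mul_inv (fF_ne_zero q)
  have hR := inR_mul_inv (fF_ne_zero q)
  have hLm := inL_mul_inv (fFm_ne_zero q)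
  have hRm := inR_mul_inv (fFm_ne_zero q)
  have hsL := inL_sum q
  have hsR := inR_sum q
  have hmL (f : Mer) (x : FR q) : FR.muL q f * x = inL f • x := rfl
  have hmR (f : Mer) (x : FR q) : FR.muR q f * x = inR f • x := rfl
  -- Moved to the left, both weights become G(λ), with F(λ-1) turning into F(λ) across γ. What
  -- remains is the determinant relation αδ - q F(λ) γβ = 1.
  have m1 : FR.star q (FR.de q) * (FR.muL q (Mer.T 1 G) * (FR.de q * v)) +
      FR.star q (FR.be q) * (FR.muL q (fFm q * Mer.T (-1) G) * (FR.be q * v)) =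
      FR.muL q G * v := by
    simp only [FR.star_de, star_be', hmL, neg_mul, FR.smul2_mul, FR.al_smul, FR.ga_smul, T2_inL,
      map_mul, T_neg_T, T_one_T, T_one_fFm, FR.al_de_mul, smul_smul, smul_add]
    match_scalars <;> grind
  -- Here the remaining relation is F(λ) δα - q⁻¹ βγ = F(μ), the source of the factor F(μ). The
  -- mixed terms `m3` and `m4` cancel by βδ = q F(λ) δβ and αγ = q F(λ) γα.
  have m2 : FR.star q (FR.ga q) * (FR.muR q c * (FR.muL q (Mer.T 1 G) * (inR c' • (FR.ga q * u)))) +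
      FR.star q (FR.al q) *
        (FR.muR q c * (FR.muL q (fFm q * Mer.T (-1) G) * (inR c' • (FR.al q * u)))) =
      FR.muL q G * (FR.muR q (fF q * (Mer.T 1 c * Mer.T 1 c')) * u) := by
    simp only [FR.star_al, star_ga', hmL, hmR, neg_mul, FR.smul2_mul, FR.be_smul, FR.de_smul,
      T2_inL, T2_inR, map_mul, T_neg_T, T_one_T, T_one_fFm, FR.be_ga_mul, FR.de_al_mul, smul_smul,
      smul_add]
    match_scalars <;> grind
  have m3 : FR.star q (FR.ga q) * (FR.muR q c * (FR.muL q (Mer.T 1 G) * (FR.de q * v))) +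
      FR.star q (FR.al q) *
        (FR.muR q c * (FR.muL q (fFm q * Mer.T (-1) G) * (FR.be q * v))) = 0 := by
    simp only [FR.star_al, star_ga', hmL, hmR, neg_mul, FR.smul2_mul, FR.be_smul, FR.de_smul,
      T2_inL, T2_inR, map_mul, T_neg_T, T_one_T, T_one_fFm, FR.be_de_mul, smul_smul]
    match_scalars
    grind
  have m4 : FR.star q (FR.de q) * (FR.muL q (Mer.T 1 G) * (inR c' • (FR.ga q * u))) +
      FR.star q (FR.be q) * (FR.muL q (fFm q * Mer.T (-1) G) * (inR c' • (FR.al q * u))) = 0 := by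
    simp only [FR.star_de, star_be', hmL, neg_mul, FR.smul2_mul, FR.al_smul, FR.ga_smul, T2_inL,
      T2_inR, map_mul, T_neg_T, T_one_T, T_one_fFm, FR.al_ga_mul, smul_smul]
    match_scalars
    grind
  rw [← m1, ← m2]
  have e3 := congrArg (fun t => su * t) m3
  have e4 := congrArg (fun t => sv * t) m4
  simp only [mul_zero] at e3 e4
  rw [← add_zero (sv * _ + _), ← e3, ← add_zero (_ + su * (_ + _)), ← e4]
  simp only [mul_add, add_mul, mul_assoc]
  abel

/-- The recursions under the star: generators move to the right end, while λ and μ stay in place and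
c_n, being real, is unchanged. -/
theorem star_tE_succ_left {N k : ℕ} (hk : k ≤ N) (j : ℕ) :
    FR.star q (tE q (N + 1) k j) =
      FR.star q (pv (tE q N k) j) * (FR.star q (FR.ga q) * FR.muR q (cf q (N + 1 - j))) +
        FR.star q (tE q N k j) * FR.star q (FR.de q) := by
  rw [tE_succ_left hk, star_add]
  change FR.star q (FR.muR q _ * _) + _ = _
  rw [FR.star_mul, FR.star_mul, FR.star_mul, FR.star_muR, bar_cf, mul_assoc]

theorem star_tE_succ_right {N k : ℕ} (hk : k ≤ N) (j : ℕ) :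
    FR.star q (tE q (N + 1) (k + 1) j) * FR.muL q (cf q (N - k)) =
      FR.star q (pv (tE q N k) j) * (FR.star q (FR.al q) * FR.muR q (cf q (N + 1 - j))) +
        FR.star q (tE q N k j) * FR.star q (FR.be q) := by
  have h := congrArg (FR.star q) (tE_succ_right (q := q) hk j)
  rw [star_add] at h
  change FR.star q (FR.muL q _ * _) = FR.star q (FR.muR q _ * _) + _ at h
  rwa [FR.star_mul, FR.star_mul, FR.star_mul, FR.star_mul, FR.star_muL, FR.star_muR, bar_cf, bar_cf,
    mul_assoc] at h

/-- The recursion for Γ splits a weighted sum into a part over rows j ≤ N, suited to the first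
recursion for t, and a part over rows j + 1, suited to the second. -/
theorem sum_Gam_succ (N : ℕ) (s t : ℕ → FR q) :
    ∑ j ∈ Finset.range (N + 2), s j * (FR.muL q (Gam q (N + 1) j) * t j) =
      (∑ j ∈ Finset.range (N + 1), s j * (FR.muL q (Mer.T 1 (Gam q N j)) * t j)) +
      ∑ j ∈ Finset.range (N + 1), s (j + 1) *
        (FR.muL q (cf q (N - j) ^ 2 * (fFm q * Mer.T (-1) (Gam q N j))) * t (j + 1)) := by
  -- The extra term j = N + 1 is zero because Γ^N_{N+1} = 0; at j = 0 both weights are 1.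
  have h2 : ∑ j ∈ Finset.range (N + 1), s j * (FR.muL q (Mer.T 1 (Gam q N j)) * t j) =
      ∑ j ∈ Finset.range (N + 2), s j * (FR.muL q (Mer.T 1 (Gam q N j)) * t j) := by
    rw [Finset.sum_range_succ _ (N + 1), Gam_of_lt (Nat.lt_succ_self N), map_zero, map_zero,
      zero_mul, mul_zero, add_zero]
  rw [h2, Finset.sum_range_succ', Finset.sum_range_succ' _ (N + 1), add_right_comm,
    ← Finset.sum_add_distrib, Gam_zero_right, Gam_zero_right, map_one (Mer.T 1)]
  congr 1
  refine Finset.sum_congr rfl fun j _ => ?_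
  rw [Gam_succ, map_add, add_mul, mul_add, mul_assoc (cf q _ ^ 2)]

/-- Distributes the factor c² of the recursion for Γ: one c goes to t^* and one to t, since the
second recursion holds for c(λ) t_{k+1,j}. -/
theorem mul_muL_sq (s t : FR q) (c g : Mer) :
    s * FR.muL q c * (FR.muL q g * (inL c • t)) = s * (FR.muL q (c ^ 2 * g) * t) := by
  change s * FR.muL q c * (FR.muL q g * (FR.muL q c * t)) = _
  rw [← mul_assoc (FR.muL q g), mul_assoc s, ← mul_assoc (FR.muL q c), ← map_mul, ← map_mul,
    show c * (g * c) = c ^ 2 * g by ring]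

/-- Row by row this is `star_quadratic`: mixed products cancel, leaving the sum for (k, l) and one
for (k-1, l-1) with a function of μ inserted. -/
theorem sum_star_succ (N k l : ℕ) :
    ∑ j ∈ Finset.range (N + 2),
      FR.star q (tE q (N + 1) j k) * (FR.muL q (Gam q (N + 1) j) * tE q (N + 1) j l) =
    (∑ j ∈ Finset.range (N + 1),
      FR.star q (tE q N j k) * (FR.muL q (Gam q N j) * tE q N j l)) +
    ∑ j ∈ Finset.range (N + 1), FR.star q (pv (tE q N j) k) * (FR.muL q (Gam q N j) *
      (FR.muR q (fF q * (Mer.T 1 (cf q (N + 1 - k)) * Mer.T 1 (cf q (N + 1 - l)))) *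
        pv (tE q N j) l)) := by
  rw [sum_Gam_succ N (fun j => FR.star q (tE q (N + 1) j k)) (fun j => tE q (N + 1) j l),
    ← Finset.sum_add_distrib, ← Finset.sum_add_distrib]
  refine Finset.sum_congr rfl fun j hj => ?_
  have hj' : j ≤ N := by rw [Finset.mem_range] at hj; omega
  rw [← star_quadratic, ← star_tE_succ_left hj', ← star_tE_succ_right hj', ← tE_succ_left hj',
    ← tE_succ_right hj', mul_muL_sq]

/-- `∑_j t_{jk}^* Γ_j(λ) t_{jl} = δ_{kl} Γ_k(μ + 2 k - N)`. -/
theorem sum_star_tE (N k l : ℕ) : ∑ j ∈ Finset.range (N + 1),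
    FR.star q (tE q N j k) * (FR.muL q (Gam q N j) * tE q N j l) =
      if k = l then FR.muR q (Mer.T (2 * k - N) (Gam q N k)) else 0 := by
  induction N generalizing k l with
  | zero =>
    rw [zero_add, Finset.sum_range_one]
    rcases Nat.eq_zero_or_pos k with rfl | hk
    · rcases Nat.eq_zero_or_pos l with rfl | hl
      · simp [tE_zero_zero, star_one, Gam_zero_right]
      · rw [tE_eq_zero le_rfl hl, if_neg (by omega), mul_zero, mul_zero]
    · rw [tE_eq_zero le_rfl hk, star_zero, zero_mul, Gam_of_lt hk, map_zero, map_zero, ite_self]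
  | succ N ih =>
    rw [sum_star_succ, ih]
    cases k with
    | zero =>
      simp [pv_zero, star_zero, Gam_zero_right]
    | succ k =>
      cases l with
      | zero => simp [pv_zero]
      | succ l =>
        -- A function of μ passes t_{jl} with a shift that depends on l but not on j, so it leaves
        -- the sum.
        have h1 (f : Mer) : ∑ j ∈ Finset.range (N + 1),
            FR.star q (tE q N j k) * (FR.muL q (Gam q N j) * (FR.muR q f * tE q N j l)) =
            (if k = l then FR.muR q (Mer.T (2 * k - N) (Gam q N k)) else 0) *
              FR.muR q (Mer.T (2 * l - N) f) := by
          rw [← ih, Finset.sum_mul]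
          refine Finset.sum_congr rfl fun j hj => ?_
          have hj' : j ≤ N := by rw [Finset.mem_range] at hj; omega
          rw [FR.muR_mul_gr (tE_mem_gr hj' l)]
          simp only [mul_assoc]
        simp only [pv_succ]
        rw [h1]
        by_cases h : k = l
        · subst h
          -- On the diagonal the two pieces are the two terms of the recursion for Γ, read at the
          -- argument μ + 2(k+1) - (N+1).
          rw [if_pos rfl, if_pos rfl, if_pos rfl, Gam_succ, ← map_mul, ← map_add, ← map_mul]
          congr 1
          have e1 : (2 * ((k + 1 : ℕ) : ℂ) - ((N + 1 : ℕ) : ℂ)) + 1 = 2 * ((k + 1 : ℕ) : ℂ) - N := by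
            push_cast; ring
          have e2 : (2 * ((k + 1 : ℕ) : ℂ) - ((N + 1 : ℕ) : ℂ)) = 2 * (k : ℂ) - N + 1 := by
            push_cast; ring
          have e3 : (N + 1 - (k + 1 : ℕ) : ℤ) = N - k := by push_cast; ring
          rw [map_add, Mer.T_T, e1, e3]
          congr 1
          rw [e2, ← Mer.T_T]
          congr 1
          rw [map_mul, map_mul, map_pow, T_one_fFm, T_one_T]
          ring
        · rw [if_neg (by omega), if_neg h, zero_mul, add_zero, if_neg (by omega)]

/-! ### The two inverses of the matrix of matrix elements -/

theorem sum_tE_star_left (N k l : ℕ) (hk : k ≤ N) : ∑ j ∈ Finset.range (N + 1),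
    FR.star q (tE q N j k) * (FR.muL q (Gam q N j) * FR.muR q (Gam q N k)⁻¹) * tE q N j l =
      if k = l then 1 else 0 := by
  have h1 : ∑ j ∈ Finset.range (N + 1),
      FR.star q (tE q N j k) * (FR.muL q (Gam q N j) * FR.muR q (Gam q N k)⁻¹) * tE q N j l =
      (∑ j ∈ Finset.range (N + 1),
        FR.star q (tE q N j k) * (FR.muL q (Gam q N j) * tE q N j l)) *
          FR.muR q (Mer.T (2 * l - N) (Gam q N k)⁻¹) := by
    rw [Finset.sum_mul]
    refine Finset.sum_congr rfl fun j hj => ?_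
    have hj' : j ≤ N := by rw [Finset.mem_range] at hj; omega
    -- The factor Γ_k(μ)⁻¹ stands before t_{jl}. Moved behind it, it is shifted by 2l - N; for l = k
    -- that is exactly the shift in `sum_star_tE`.
    rw [mul_assoc, mul_assoc, FR.muR_mul_gr (tE_mem_gr hj' l)]
    simp only [mul_assoc]
  rw [h1, sum_star_tE]
  split_ifs with h
  · subst h
    rw [← map_mul, ← map_mul, mul_inv_cancel₀ (Gam_ne_zero hk), map_one, map_one]
  · rw [zero_mul]

/-- `sum_tE_star_left` makes the right-hand side a left inverse of t, `sum_tE_antipode` makes S(t) a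
right inverse; by associativity of matrix multiplication over the noncommutative ring they coincide.
-/
theorem antipode_tE {N k j : ℕ} (hk : k ≤ N) (hj : j ≤ N) : FR.antipode q (tE q N k j) =
    FR.star q (tE q N j k) * (FR.muL q (Gam q N j) * FR.muR q (Gam q N k)⁻¹) := by
  let S : Matrix (Fin (N + 1)) (Fin (N + 1)) (FR q) := fun a b => FR.antipode q (tE q N a b)
  let R : Matrix (Fin (N + 1)) (Fin (N + 1)) (FR q) := fun a b =>
    FR.star q (tE q N b a) * (FR.muL q (Gam q N b) * FR.muR q (Gam q N a)⁻¹)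
  let t : Matrix (Fin (N + 1)) (Fin (N + 1)) (FR q) := fun a b => tE q N a b
  have h1 : R * t = 1 := by
    ext a b
    rw [Matrix.mul_apply, Matrix.one_apply]
    have := sum_tE_star_left (q := q) N a b (by omega)
    rw [Finset.sum_range] at this
    simpa only [Fin.val_inj] using this
  have h2 : t * S = 1 := by
    ext a b
    rw [Matrix.mul_apply, Matrix.one_apply]
    have := sum_tE_antipode (q := q) N a b (by omega)
    rw [Finset.sum_range] at this
    simpa only [Fin.val_inj] using this
  have h3 : R = S := left_inv_eq_right_inv h1 h2
  exact (congrFun (congrFun h3 (⟨k, by omega⟩ : Fin (N + 1))) (⟨j, by omega⟩ : Fin (N + 1))).symm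

theorem sum_tE_star_right (N k l : ℕ) (hk : k ≤ N) (hl : l ≤ N) : ∑ j ∈ Finset.range (N + 1),
    tE q N k j * FR.star q (tE q N l j) * (FR.muL q (Gam q N l) * FR.muR q (Gam q N j)⁻¹) =
      if k = l then 1 else 0 := by
  rw [← sum_tE_antipode N k l hk]
  refine Finset.sum_congr rfl fun j hj => ?_
  rw [antipode_tE (by rw [Finset.mem_range] at hj; omega) hl, mul_assoc]

/-- The star of `antipode_tE`. Reversal of the order puts Γ_k(μ)⁻¹ in front, where Γ_k(μ) cancels
it. -/
theorem unitarity_tE {N k j : ℕ} (hk : k ≤ N) (hj : j ≤ N) :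
    FR.muR q (Gam q N k) * FR.star q (FR.antipode q (tE q N k j)) =
      FR.muL q (Gam q N j) * tE q N j k := by
  rw [antipode_tE hk hj, FR.star_mul, FR.star_mul, star_star, FR.star_muL, FR.star_muR, map_inv₀,
    bar_Gam, bar_Gam, ← mul_assoc, ← mul_assoc, ← map_mul, mul_inv_cancel₀ (Gam_ne_zero hk),
    map_one, one_mul]

/-! ## The coproduct of the basis vectors -/

theorem coprod_one : FR.coprod q 1 = tm 1 1 := by
  rw [FR.coprod, map_one]; rfl

/-- The coproduct is the value at 1 ⊗ 1 of an operator representation, so left factors come out as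
operators. -/
theorem coprod_al_mul (x : FR q) : FR.coprod q (FR.al q * x) = dAl q (FR.coprod q x) := by
  rw [FR.coprod, map_mul, RepData.lift_al]; rfl

theorem coprod_be_mul (x : FR q) : FR.coprod q (FR.be q * x) = dBe q (FR.coprod q x) := by
  rw [FR.coprod, map_mul, RepData.lift_be]; rfl

theorem coprod_ga_mul (x : FR q) : FR.coprod q (FR.ga q * x) = dGa q (FR.coprod q x) := by
  rw [FR.coprod, map_mul, RepData.lift_ga]; rfl

theorem coprod_de_mul (x : FR q) : FR.coprod q (FR.de q * x) = dDe q (FR.coprod q x) := by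
  rw [FR.coprod, map_mul, RepData.lift_de]; rfl

theorem vN_zero_zero : vN q 0 0 = 1 := by
  rw [vN, pow_zero, pow_zero, mul_one]

theorem ga_vN {N k : ℕ} (hk : k ≤ N) : FR.ga q * vN q N k = vN q (N + 1) k := by
  rw [vN, vN, Nat.sub_add_comm hk, pow_succ', mul_assoc]

/-- α must cross γ^{N-k}; this is where the functions c_n in the recursions originate. -/
theorem al_vN {N k : ℕ} (hk : k ≤ N) :
    FR.al q * vN q N k = inL (cf q (N - k)) • vN q (N + 1) (k + 1) := by
  rw [vN, vN, ← mul_assoc, FR.al_ga_pow, FR.smul2_mul, Nat.add_sub_add_right, pow_succ', mul_assoc,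
    Nat.cast_sub hk]

theorem al_vN_self (N : ℕ) : FR.al q * vN q N N = vN q (N + 1) (N + 1) := by
  rw [al_vN le_rfl, sub_self, cf_zero, map_one, one_smul]

/-- c_{N-j}(μ) on the first leg equals c_{N-j}(λ) on the second, where it completes v_{j+1} to α
v_j. The row recursion is thus multiplication by x ⊗ α + y ⊗ γ. -/
theorem sum_row_tm {N k : ℕ} (hk : k ≤ N) (x y : FR q) :
    ∑ j ∈ Finset.range (N + 2),
      tm (inR (cf q (N + 1 - j)) • (x * pv (tE q N k) j) + y * tE q N k j) (vN q (N + 1) j) =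
    ∑ j ∈ Finset.range (N + 1), (tm (x * tE q N k j) (FR.al q * vN q N j) +
      tm (y * tE q N k j) (FR.ga q * vN q N j) : Tens q (FR q)) := by
  simp only [add_tm]
  rw [Finset.sum_add_distrib, Finset.sum_add_distrib]
  congr 1
  · rw [Finset.sum_range_succ', pv_zero, mul_zero, smul_zero, zero_tm, add_zero]
    refine Finset.sum_congr rfl fun j hj => ?_
    have hj' : j ≤ N := by rw [Finset.mem_range] at hj; omega
    rw [pv_succ, Nat.cast_succ, add_sub_add_right_eq_sub, rho_tm, al_vN hj']
  · rw [Finset.sum_range_succ, tE_eq_zero hk (Nat.lt_succ_self N), mul_zero, zero_tm, add_zero]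
    refine Finset.sum_congr rfl fun j hj => ?_
    have hj' : j ≤ N := by rw [Finset.mem_range] at hj; omega
    rw [ga_vN hj']

/-- `Δ(γ^{N-k} α^k) = ∑_j t_{kj} ⊗ γ^{N-j} α^j`. -/
theorem coprod_vN {N k : ℕ} (hk : k ≤ N) :
    FR.coprod q (vN q N k) = ∑ j ∈ Finset.range (N + 1), tm (tE q N k j) (vN q N j) := by
  induction N generalizing k with
  | zero =>
    obtain rfl : k = 0 := by omega
    rw [zero_add, Finset.sum_range_one, tE_zero_zero, vN_zero_zero, coprod_one]
  | succ N ih =>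
    -- Every vector of level N + 1 is γ times one of level N, except α^{N+1}, which is α times α^N.
    rcases Nat.lt_or_ge k (N + 1) with hk' | hk'
    · have hk'' : k ≤ N := by omega
      rw [← ga_vN hk'', coprod_ga_mul, ih hk'', map_sum]
      exact (sum_row_tm hk'' _ _).symm.trans
        (Finset.sum_congr rfl fun j _ => by rw [tE_succ_left hk'' j])
    · obtain rfl : k = N + 1 := by omega
      rw [← al_vN_self, coprod_al_mul, ih le_rfl, map_sum]
      exact (sum_row_tm le_rfl _ _).symm.trans
        (Finset.sum_congr rfl fun j _ => by rw [tE_succ_last N j])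

/-! ## Coassociativity and the counit -/

section Coassociativity

variable {V W : Type} [AddCommGroup V] [Module Mer V] [AddCommGroup W] [Module Mer W]

/-- The map `a ⊗ v ↦ x a ⊗ D v`, for `x` and `D` of the same weight. -/
def opTens (σ : Mer → Mer) (x : FR q) (D : V →+ W)
    (hx : ∀ f, x * FR.muR q f = FR.muR q (σ f) * x) (hD : ∀ f v, D (f • v) = σ f • D v) :
    Tens q V →+ Tens q W :=
  Tens.lift
    { toFun := fun a => (tmHom q W (x * a)).comp D
      map_zero' := by ext v; change tm (x * 0) _ = 0; rw [mul_zero, zero_tm]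
      map_add' := fun a b => by
        ext v
        change tm (x * (a + b)) (D v) = tm (x * a) (D v) + tm (x * b) (D v)
        rw [mul_add, add_tm] }
    (fun f a v => by
      change tm (x * (FR.muR q f * a)) (D v) = tm (x * a) (D (f • v))
      rw [← mul_assoc, hx, mul_assoc, muR_tm, hD])

theorem mulTm_smul (σ τ : Mer → Mer) (x y : FR q)
    (hx : ∀ f, x * FR.muR q f = FR.muR q (σ f) * x)
    (hy : ∀ f, y * FR.muL q f = FR.muL q (σ f) * y)
    (hτ : ∀ f, x * FR.muL q f = FR.muL q (τ f) * x) (f : Mer) (w : Tens q (FR q)) :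
    mulTm σ x y hx hy (f • w) = τ f • mulTm σ x y hx hy w := by
  induction w using Tens.ind with
  | h0 => rw [smul_zero, map_zero, smul_zero]
  | ht a b => rw [smul_tm, mulTm_tm, mulTm_tm, smul_tm, ← mul_assoc, hτ, mul_assoc]
  | ha u v hu hv => rw [smul_add, map_add, map_add, smul_add, hu, hv]

/-- The first legs α and β of Δ(α) have the same left degree, hence shift f(λ) equally. This
semilinearity makes the operator usable on the second factor of a tensor product. -/
theorem dAl_smul (f : Mer) (w : Tens q (FR q)) : dAl q (f • w) = Mer.T (-1) f • dAl q w := by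
  rw [dAl, LinearMap.add_apply, LinearMap.add_apply, smul_add,
    mulTm_smul _ (Mer.T (-1)) _ _ _ _ (FR.al_muL q), mulTm_smul _ (Mer.T (-1)) _ _ _ _ (FR.be_muL q)]

theorem dGa_smul (f : Mer) (w : Tens q (FR q)) : dGa q (f • w) = Mer.T 1 f • dGa q w := by
  rw [dGa, LinearMap.add_apply, LinearMap.add_apply, smul_add,
    mulTm_smul _ (Mer.T 1) _ _ _ _ (FR.ga_muL q), mulTm_smul _ (Mer.T 1) _ _ _ _ (FR.de_muL q)]

/-- Left multiplication by `(Δ ⊗ id) Δ(α)`. -/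
def ddAl (q : QParam) : Tens q (Tens q (FR q)) →+ Tens q (Tens q (FR q)) :=
  opTens (Mer.T (-1)) (FR.al q) (dAl q).toAddMonoidHom (FR.al_muR q) dAl_smul +
    opTens (Mer.T 1) (FR.be q) (dGa q).toAddMonoidHom (FR.be_muR q) dGa_smul

/-- Left multiplication by `(Δ ⊗ id) Δ(γ)`. -/
def ddGa (q : QParam) : Tens q (Tens q (FR q)) →+ Tens q (Tens q (FR q)) :=
  opTens (Mer.T (-1)) (FR.ga q) (dAl q).toAddMonoidHom (FR.ga_muR q) dAl_smul +
    opTens (Mer.T 1) (FR.de q) (dGa q).toAddMonoidHom (FR.de_muR q) dGa_smul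

theorem ddAl_tm (a : FR q) (w : Tens q (FR q)) :
    ddAl q (tm a w) = tm (FR.al q * a) (dAl q w) + tm (FR.be q * a) (dGa q w) := rfl

theorem ddGa_tm (a : FR q) (w : Tens q (FR q)) :
    ddGa q (tm a w) = tm (FR.ga q * a) (dAl q w) + tm (FR.de q * a) (dGa q w) := rfl

theorem coprodTens_tm (a : FR q) (v : V) :
    coprodTens q V (tm a v) = Tens.map (tmRight v) (FR.coprod q a) := rfl

/-- (Δ ⊗ id)Δ(α) = Δ(α) ⊗ α + Δ(β) ⊗ γ, whose four terms regroup as α ⊗ Δ(α) + β ⊗ Δ(γ). -/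
theorem coprodTens_dAl (w : Tens q (FR q)) :
    coprodTens q (FR q) (dAl q w) = ddAl q (coprodTens q (FR q) w) := by
  induction w using Tens.ind with
  | h0 => simp only [map_zero]
  | ha u v hu hv => simp only [map_add, hu, hv]
  | ht a b =>
    rw [dAl_tm, map_add, coprodTens_tm, coprodTens_tm, coprodTens_tm, coprod_al_mul, coprod_be_mul]
    induction FR.coprod q a using Tens.ind with
    | h0 => simp only [map_zero, add_zero]
    | ha u v hu hv =>
      simp only [map_add, ← hu, ← hv]
      abel
    | ht c d =>
      rw [dAl_tm, dBe_tm, map_add, map_add]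
      change tm _ (tm _ _) + tm _ (tm _ _) + (tm _ (tm _ _) + tm _ (tm _ _)) =
        ddAl q (tm c (tm d b))
      rw [ddAl_tm, dAl_tm, dGa_tm, tm_add, tm_add]
      abel

theorem coprodTens_dGa (w : Tens q (FR q)) :
    coprodTens q (FR q) (dGa q w) = ddGa q (coprodTens q (FR q) w) := by
  induction w using Tens.ind with
  | h0 => simp only [map_zero]
  | ha u v hu hv => simp only [map_add, hu, hv]
  | ht a b =>
    rw [dGa_tm, map_add, coprodTens_tm, coprodTens_tm, coprodTens_tm, coprod_ga_mul, coprod_de_mul]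
    induction FR.coprod q a using Tens.ind with
    | h0 => simp only [map_zero, add_zero]
    | ha u v hu hv =>
      simp only [map_add, ← hu, ← hv]
      abel
    | ht c d =>
      rw [dGa_tm, dDe_tm, map_add, map_add]
      change tm _ (tm _ _) + tm _ (tm _ _) + (tm _ (tm _ _) + tm _ (tm _ _)) =
        ddGa q (tm c (tm d b))
      rw [ddGa_tm, dAl_tm, dGa_tm, tm_add, tm_add]
      abel

/-- The coproduct as a linear map over the functions `f(λ)`. -/
def coprodLin (q : QParam) : FR q →ₗ[Mer] Tens q (FR q) where
  toFun := FR.coprod q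
  map_add' := FR.coprod_add
  map_smul' f x := FR.coprod_muL_mul f x

theorem coprodLin_apply (x : FR q) : coprodLin q x = FR.coprod q x := rfl

/-- (id ⊗ Δ)Δ(α) is α ⊗ Δ(α) + β ⊗ Δ(γ) at once. Both sides of coassociativity are therefore
intertwined by the same operator. -/
theorem map_coprodLin_dAl (w : Tens q (FR q)) :
    Tens.map (coprodLin q) (dAl q w) = ddAl q (Tens.map (coprodLin q) w) := by
  induction w using Tens.ind with
  | h0 => simp only [map_zero]
  | ha u v hu hv => simp only [map_add, hu, hv]
  | ht a b =>
    rw [dAl_tm, map_add, map_tm, map_tm, map_tm, ddAl_tm, coprodLin_apply, coprodLin_apply,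
      coprodLin_apply, coprod_al_mul, coprod_ga_mul]

theorem map_coprodLin_dGa (w : Tens q (FR q)) :
    Tens.map (coprodLin q) (dGa q w) = ddGa q (Tens.map (coprodLin q) w) := by
  induction w using Tens.ind with
  | h0 => simp only [map_zero]
  | ha u v hu hv => simp only [map_add, hu, hv]
  | ht a b =>
    rw [dGa_tm, map_add, map_tm, map_tm, map_tm, ddGa_tm, coprodLin_apply, coprodLin_apply,
      coprodLin_apply, coprod_al_mul, coprod_ga_mul]

theorem coprodTens_smul (f : Mer) (w : Tens q V) :
    coprodTens q V (f • w) = f • coprodTens q V w := by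
  induction w using Tens.ind with
  | h0 => rw [smul_zero, map_zero, smul_zero]
  | ht a b => rw [smul_tm, coprodTens_tm, coprodTens_tm, FR.coprod_muL_mul, map_smul]
  | ha u v hu hv => rw [smul_add, map_add, map_add, smul_add, hu, hv]

theorem counitTens_tm (a : FR q) (v : V) :
    counitTens q V (tm a v) = FR.counit q a 1 • v := rfl

theorem counitTens_smul (f : Mer) (w : Tens q V) :
    counitTens q V (f • w) = f • counitTens q V w := by
  induction w using Tens.ind with
  | h0 => rw [smul_zero, map_zero, smul_zero]
  | ht a b =>
    rw [smul_tm, counitTens_tm, counitTens_tm, smul_smul, map_mul, FR.counit, RepData.lift_muL,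
      Module.End.mul_apply]
    exact congrArg (· • b) (counitCoef_inL f _)
  | ha u v hu hv => rw [smul_add, map_add, map_add, smul_add, hu, hv]

/-- ε(β) = 0 removes one summand, and ε(α) = T_{-1} is the shift with which α passes functions of λ.
-/
theorem counitTens_dAl (w : Tens q (FR q)) :
    counitTens q (FR q) (dAl q w) = FR.al q * counitTens q (FR q) w := by
  induction w using Tens.ind with
  | h0 => rw [map_zero, map_zero, mul_zero]
  | ha u v hu hv => rw [map_add, map_add, map_add, mul_add, hu, hv]
  | ht a b =>
    have h1 : FR.counit q (FR.al q * a) 1 = Mer.T (-1) (FR.counit q a 1) := by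
      rw [map_mul, FR.counit, RepData.lift_al]; rfl
    have h2 : FR.counit q (FR.be q * a) 1 = 0 := by
      rw [map_mul, FR.counit, RepData.lift_be]; rfl
    rw [dAl_tm, map_add, counitTens_tm, counitTens_tm, counitTens_tm, h1, h2, zero_smul, add_zero,
      FR.smul_def, FR.smul_def, ← mul_assoc, ← mul_assoc, FR.al_muL]

theorem counitTens_dGa (w : Tens q (FR q)) :
    counitTens q (FR q) (dGa q w) = FR.ga q * counitTens q (FR q) w := by
  induction w using Tens.ind with
  | h0 => rw [map_zero, map_zero, mul_zero]
  | ha u v hu hv => rw [map_add, map_add, map_add, mul_add, hu, hv]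
  | ht a b =>
    have h1 : FR.counit q (FR.de q * a) 1 = Mer.T 1 (FR.counit q a 1) := by
      rw [map_mul, FR.counit, RepData.lift_de]; rfl
    have h2 : FR.counit q (FR.ga q * a) 1 = 0 := by
      rw [map_mul, FR.counit, RepData.lift_ga]; rfl
    rw [dGa_tm, map_add, counitTens_tm, counitTens_tm, counitTens_tm, h1, h2, zero_smul, zero_add,
      FR.smul_def, FR.smul_def, ← mul_assoc, ← mul_assoc, FR.ga_muL]

/-- The spanning vectors are words in γ and α, so left multiplication by these two is all that needs
checking. -/
theorem vN_induction {P : FR q → Prop} (h1 : P 1) (hal : ∀ x, P x → P (FR.al q * x))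
    (hga : ∀ x, P x → P (FR.ga q * x)) (N k : ℕ) : P (vN q N k) := by
  have ha (n : ℕ) : P (FR.al q ^ n) := by
    induction n with
    | zero => rwa [pow_zero]
    | succ n ih => rw [pow_succ']; exact hal _ ih
  rw [vN]
  generalize N - k = m
  induction m with
  | zero => rw [pow_zero, one_mul]; exact ha k
  | succ m ih => rw [pow_succ', mul_assoc]; exact hga _ ih

theorem coassoc_of_mem_VN {N : ℕ} {x : FR q} (hx : x ∈ VN q N) :
    coprodTens q (FR q) (FR.coprod q x) = Tens.map (coprodLin q) (FR.coprod q x) := by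
  induction hx using Submodule.span_induction with
  | mem x hx =>
    obtain ⟨k, -, rfl⟩ := hx
    refine vN_induction (P := fun x => coprodTens q (FR q) (FR.coprod q x) =
      Tens.map (coprodLin q) (FR.coprod q x)) ?_ (fun x ih => ?_) (fun x ih => ?_) N k
    · rw [coprod_one, coprodTens_tm, map_tm, coprodLin_apply, coprod_one]; rfl
    · rw [coprod_al_mul, coprodTens_dAl, ih, map_coprodLin_dAl]
    · rw [coprod_ga_mul, coprodTens_dGa, ih, map_coprodLin_dGa]
  | zero => rw [FR.coprod_zero, map_zero, map_zero]
  | add x y _ _ hx hy => rw [FR.coprod_add, map_add, map_add, hx, hy]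
  | smul f x _ hx => rw [FR.smul_def, FR.coprod_muL_mul, coprodTens_smul, map_smul, hx]

theorem counit_of_mem_VN {N : ℕ} {x : FR q} (hx : x ∈ VN q N) :
    counitTens q (FR q) (FR.coprod q x) = x := by
  induction hx using Submodule.span_induction with
  | mem x hx =>
    obtain ⟨k, -, rfl⟩ := hx
    refine vN_induction (P := fun x => counitTens q (FR q) (FR.coprod q x) = x)
      ?_ (fun x ih => ?_) (fun x ih => ?_) N k
    · rw [coprod_one, counitTens_tm]
      exact (congrArg (fun e : Module.End ℂ Mer => e 1 • (1 : FR q)) (map_one (FR.counit q))).trans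
        (one_smul Mer _)
    · rw [coprod_al_mul, counitTens_dAl, ih]
    · rw [coprod_ga_mul, counitTens_dGa, ih]
  | zero => rw [FR.coprod_zero, map_zero]
  | add x y _ _ hx hy => rw [FR.coprod_add, map_add, hx, hy]
  | smul f x _ hx => rw [FR.smul_def, FR.coprod_muL_mul, counitTens_smul, hx]; rfl

/-! ### Naturality, for passing from A to its subspace V_N -/

theorem map_map (φ : V →ₗ[Mer] W) {U : Type} [AddCommGroup U] [Module Mer U] (ψ : W →ₗ[Mer] U)
    (x : Tens q V) : Tens.map ψ (Tens.map φ x) = Tens.map (ψ ∘ₗ φ) x := by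
  induction x using Tens.ind with
  | h0 => simp only [map_zero]
  | ht a v => rfl
  | ha x y hx hy => rw [map_add, map_add, hx, hy, map_add]

theorem map_id (x : Tens q V) : Tens.map LinearMap.id x = x := by
  induction x using Tens.ind with
  | h0 => rw [map_zero]
  | ht a v => rfl
  | ha x y hx hy => rw [map_add, hx, hy]

theorem map_leftInverse {φ : V →ₗ[Mer] W} {ψ : W →ₗ[Mer] V} (h : ψ ∘ₗ φ = LinearMap.id)
    (x : Tens q V) : Tens.map ψ (Tens.map φ x) = x := by
  rw [map_map, h, map_id]

theorem map_map_coprodTens (φ : V →ₗ[Mer] W) (x : Tens q V) :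
    Tens.map (Tens.map φ) (coprodTens q V x) = coprodTens q W (Tens.map φ x) := by
  induction x using Tens.ind with
  | h0 => simp only [map_zero]
  | ht a v => rw [coprodTens_tm, map_tm, coprodTens_tm, map_map]; rfl
  | ha x y hx hy => simp only [map_add, hx, hy]

theorem map_counitTens (φ : V →ₗ[Mer] W) (x : Tens q V) :
    φ (counitTens q V x) = counitTens q W (Tens.map φ x) := by
  induction x using Tens.ind with
  | h0 => simp only [map_zero]
  | ht a v => rw [counitTens_tm, map_tm, counitTens_tm, map_smul]
  | ha x y hx hy => simp only [map_add, hx, hy]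

end Coassociativity

/-! ## A representation by difference operators -/

theorem T_one_fY : Mer.T 1 (fY q) = (fQ q ^ 2)⁻¹ * fY q := by
  have h := T_fY (q := q) 1
  rw [Int.cast_one] at h
  rw [h, ← zpow_natCast, ← zpow_neg]; rfl

theorem T_neg_one_fY : Mer.T (-1) (fY q) = fQ q ^ 2 * fY q := by
  have h := T_fY (q := q) (-1)
  rw [Int.cast_neg, Int.cast_one] at h
  rw [h, ← zpow_natCast]; rfl

/-- `f(λ)` as an operator on `ℤ → Mer`. -/
def repL : Mer →ₐ[ℂ] Module.End ℂ (ℤ → Mer) where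
  toFun f :=
    { toFun := fun g k => f * g k
      map_add' := fun g h => by ext k; exact mul_add _ _ _
      map_smul' := fun c g => by ext k; exact mul_smul_comm c f (g k) }
  map_one' := by ext g k; exact one_mul _
  map_mul' f f' := by ext g k; exact mul_assoc _ _ _
  map_zero' := by ext g k; exact zero_mul _
  map_add' f f' := by ext g k; exact add_mul _ _ _
  commutes' c := by ext g k; exact (Algebra.smul_def _ _).symm

/-- `f(μ)` as an operator on `ℤ → Mer`. -/
def repR : Mer →ₐ[ℂ] Module.End ℂ (ℤ → Mer) where
  toFun f :=
    { toFun := fun g k => Mer.T (2 * k) f * g k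
      map_add' := fun g h => by ext k; exact mul_add _ _ _
      map_smul' := fun c g => by ext k; exact mul_smul_comm c (Mer.T (2 * k) f) (g k) }
  map_one' := by ext g k; exact (congrArg (· * g k) (map_one _)).trans (one_mul _)
  map_mul' f f' := by ext g k; exact (congrArg (· * g k) (map_mul _ _ _)).trans (mul_assoc _ _ _)
  map_zero' := by ext g k; exact (congrArg (· * g k) (map_zero _)).trans (zero_mul _)
  map_add' f f' := by ext g k; exact (congrArg (· * g k) (map_add _ _ _)).trans (add_mul _ _ _)
  commutes' c := by
    ext g k
    exact (congrArg (· * g k) (AlgHom.commutes _ _)).trans (Algebra.smul_def _ _).symm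

theorem repL_apply (f : Mer) (g : ℤ → Mer) (k : ℤ) : repL f g k = f * g k := rfl

theorem repR_apply (f : Mer) (g : ℤ → Mer) (k : ℤ) : repR f g k = Mer.T (2 * k) f * g k := rfl

theorem rep_commute (f f' : Mer) : Commute (repL f) (repR f') := by
  ext g k
  change f * (Mer.T (2 * k) f' * g k) = Mer.T (2 * k) f' * (f * g k)
  ring

/-- The functions of two variables as operators on `ℤ → Mer`. -/
def repCoef : Mer2 →ₐ[ℂ] Module.End ℂ (ℤ → Mer) :=
  (Algebra.TensorProduct.lift repL repR rep_commute :
    TensorProduct ℂ Mer Mer →ₐ[ℂ] Module.End ℂ (ℤ → Mer))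

theorem repCoef_inL (f : Mer) (g : ℤ → Mer) (k : ℤ) : repCoef (inL f) g k = f * g k := by
  have h : repCoef (inL f) = repL f :=
    (Algebra.TensorProduct.lift_tmul repL repR rep_commute f 1).trans (by rw [map_one, mul_one])
  rw [h, repL_apply]

theorem repCoef_inR (f : Mer) (g : ℤ → Mer) (k : ℤ) :
    repCoef (inR f) g k = Mer.T (2 * k) f * g k := by
  have h : repCoef (inR f) = repR f :=
    (Algebra.TensorProduct.lift_tmul repL repR rep_commute 1 f).trans (by rw [map_one, one_mul])
  rw [h, repR_apply]

theorem repCoef_kst (c : ℂ) (g : ℤ → Mer) (k : ℤ) : repCoef (kst c) g k = cst c * g k := by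
  rw [← inL_cst, repCoef_inL]

/-- The operator `(g_k) ↦ (a_k T_c g_{k + n})`. -/
def repOp (a : ℤ → Mer) (c : ℂ) (n : ℤ) : Module.End ℂ (ℤ → Mer) where
  toFun g k := a k * Mer.T c (g (k + n))
  map_add' g h := by
    ext k
    change a k * Mer.T c (g (k + n) + h (k + n)) = _
    rw [map_add, mul_add]; rfl
  map_smul' r g := by
    ext k
    change a k * Mer.T c (r • g (k + n)) = _
    rw [map_smul, mul_smul_comm]; rfl

theorem repOp_apply (a : ℤ → Mer) (c : ℂ) (n : ℤ) (g : ℤ → Mer) (k : ℤ) :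
    repOp a c n g k = a k * Mer.T c (g (k + n)) := rfl

/-- The coefficient of `α`. -/
def repA (q : QParam) (k : ℤ) : Mer := fQ q ^ k / br q (-1)

/-- The coefficient of `β`. -/
def repB (q : QParam) (k : ℤ) : Mer :=
  (fQ q ^ k * fQ q ^ k * fQ q + (fQ q ^ k * fQ q ^ k * fQ q)⁻¹) * fY q *
    (fQ q ^ k * fQ q ^ k * fQ q ^ 2)⁻¹ / (br q (-1) * br q (-2 * k - 1))

/-- The coefficient of `δ`. -/
def repD (q : QParam) (k : ℤ) : Mer :=
  (fQ q ^ k)⁻¹ * (1 + ((fQ q ^ k) ^ 4 * fQ q ^ 6)⁻¹ * fY q ^ 2) / br q (-2 * k - 1)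

theorem T_two_br (k a : ℤ) : Mer.T (2 * k) (br q a) = br q (-2 * k + a) := by
  have := T_br (q := q) (2 * k) a
  push_cast at this
  rw [this]; congr 1; ring

theorem br_neg_one : br q (-1) = (fQ q ^ 2 - fY q) / fQ q ^ 2 := by
  have hQ := fQ_ne_zero (q := q)
  have h : br q (-1) = 1 - (fQ q ^ 2)⁻¹ * fY q := by rw [br, ← zpow_natCast, ← zpow_neg]; rfl
  rw [h]; field_simp

theorem br_neg_two : br q (-2) = (fQ q ^ 4 - fY q) / fQ q ^ 4 := by
  have hQ := fQ_ne_zero (q := q)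
  have h : br q (-2) = 1 - (fQ q ^ 4)⁻¹ * fY q := by rw [br, ← zpow_natCast, ← zpow_neg]; rfl
  rw [h]; field_simp

theorem br_neg_two_mul_sub (k : ℤ) (n : ℕ) : br q (-2 * k - n) =
    ((fQ q ^ k) ^ 4 * fQ q ^ (2 * n) - fY q) / ((fQ q ^ k) ^ 4 * fQ q ^ (2 * n)) := by
  have hQ := fQ_ne_zero (q := q)
  have hw := zpow_ne_zero k hQ
  have h : br q (-2 * k - n) = 1 - ((fQ q ^ k) ^ 4 * fQ q ^ (2 * n))⁻¹ * fY q := by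
    rw [br, ← zpow_natCast, ← zpow_mul, ← zpow_natCast, ← zpow_add₀ fQ_ne_zero, ← zpow_neg]
    congr 3; push_cast; ring
  rw [h]; field_simp

theorem br_neg_two_mul (k : ℤ) : br q (-2 * k) = ((fQ q ^ k) ^ 4 - fY q) / (fQ q ^ k) ^ 4 := by
  have h := br_neg_two_mul_sub (q := q) k 0
  rwa [Nat.cast_zero, sub_zero, mul_zero, pow_zero, mul_one] at h

theorem br_neg_two_mul_sub_one (k : ℤ) : br q (-2 * k - 1) =
    ((fQ q ^ k) ^ 4 * fQ q ^ 2 - fY q) / ((fQ q ^ k) ^ 4 * fQ q ^ 2) := by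
  have h := br_neg_two_mul_sub (q := q) k 1
  rwa [Nat.cast_one, mul_one] at h

theorem br_neg_two_mul_sub_two (k : ℤ) : br q (-2 * k - 2) =
    ((fQ q ^ k) ^ 4 * fQ q ^ 4 - fY q) / ((fQ q ^ k) ^ 4 * fQ q ^ 4) :=
  br_neg_two_mul_sub (q := q) k 2

/-- The values on the generators of a representation on `ℤ → Mer`. -/
def repData (q : QParam) : RepData q (Module.End ℂ (ℤ → Mer)) where
  s := repCoef
  -- The exponents of T and the index steps are forced by the bidegrees. With the coefficient of γ
  -- normalized to 1, the relations for αγ and γδ are first-order recursions in k, satisfied by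
  -- `repA` and `repD`; the determinant then determines `repB`.
  al := repOp (repA q) (-1) 0
  be := repOp (repB q) (-1) 1
  ga := repOp 1 1 (-1)
  de := repOp (repD q) 1 0
  al_left f := by
    ext g k
    simp only [Module.End.mul_apply, repOp_apply, repCoef_inL, map_mul, T_neg_T]
    ring
  al_right f := by
    ext g k
    simp only [Module.End.mul_apply, repOp_apply, repCoef_inR, map_mul, Mer.T_T]
    rw [show (-1 + (2 * ((k + 0 : ℤ) : ℂ) + 1)) = 2 * k by push_cast; ring]
    ring
  be_left f := by
    ext g k
    simp only [Module.End.mul_apply, repOp_apply, repCoef_inL, map_mul, T_neg_T]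
    ring
  be_right f := by
    ext g k
    simp only [Module.End.mul_apply, repOp_apply, repCoef_inR, map_mul, Mer.T_T]
    rw [show (-1 + (2 * ((k + 1 : ℤ) : ℂ) + -1)) = 2 * k by push_cast; ring]
    ring
  ga_left f := by
    ext g k
    simp only [Module.End.mul_apply, repOp_apply, repCoef_inL, map_mul, T_one_T]
    ring
  ga_right f := by
    ext g k
    simp only [Module.End.mul_apply, repOp_apply, repCoef_inR, map_mul, Mer.T_T]
    rw [show (1 + (2 * ((k + -1 : ℤ) : ℂ) + 1)) = 2 * k by push_cast; ring]
    ring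
  de_left f := by
    ext g k
    simp only [Module.End.mul_apply, repOp_apply, repCoef_inL, map_mul, T_one_T]
    ring
  de_right f := by
    ext g k
    simp only [Module.End.mul_apply, repOp_apply, repCoef_inR, map_mul, Mer.T_T]
    rw [show (1 + (2 * ((k + 0 : ℤ) : ℂ) + -1)) = 2 * k by push_cast; ring]
    ring
  al_be := by
    ext g k
    have hQ := fQ_ne_zero (q := q)
    have hw := zpow_ne_zero k hQ
    have h1 := br_ne_zero (q := q) (-1)
    have h2 := br_ne_zero (q := q) 0
    have h3 := br_ne_zero (q := q) (-2 * k)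
    have h4 := br_ne_zero (q := q) (-2 * k - 1)
    simp only [Module.End.mul_apply, repOp_apply, repCoef_inR, repCoef_kst, map_mul, add_zero, repA,
      repB, fFm_eq_br, map_div₀, map_add, map_zpow₀, map_pow, map_inv₀, T_fQ, T_neg_one_br,
      T_two_br, T_neg_one_fY, zpow_add_one₀ hQ, ← sub_eq_add_neg, sub_add_cancel, neg_add_cancel,
      show cst (qc q) = fQ q from rfl]
    field_simp
  al_ga := by
    ext g k
    have hQ := fQ_ne_zero (q := q)
    have hw := zpow_ne_zero k hQ
    have h1 := br_ne_zero (q := q) (-1)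
    have h2 := br_ne_zero (q := q) (-2)
    simp only [Module.End.mul_apply, repOp_apply, repCoef_inL, repCoef_kst, map_mul, add_zero, repA,
      fF_eq, map_div₀, map_zpow₀, map_inv₀, T_fQ, T_one_br, Pi.one_apply, one_mul, T_one_T, T_neg_T,
      ← sub_eq_add_neg, zpow_sub_one₀ hQ, show (-1 - 1 : ℤ) = -2 by rfl,
      show cst (qc q) = fQ q from rfl]
    field_simp
  be_de := by
    ext g k
    have hQ := fQ_ne_zero (q := q)
    have hw := zpow_ne_zero k hQ
    have h1 := br_ne_zero (q := q) (-1)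
    have h2 := br_ne_zero (q := q) (-2)
    have h3 := br_ne_zero (q := q) (-2 * k - 1)
    have h4 := br_ne_zero (q := q) (-2 * k - 2)
    have e1 : (-2 * (k + 1) - 1 + 1 : ℤ) = -2 * k - 2 := by ring
    have e2 : (-2 * k - 1 - 1 : ℤ) = -2 * k - 2 := by ring
    simp only [Module.End.mul_apply, repOp_apply, repCoef_inL, repCoef_kst, map_mul, add_zero, repB,
      repD, fF_eq, map_div₀, map_add, map_zpow₀, map_pow, map_inv₀, map_one, T_fQ, T_one_br,
      T_neg_one_br, T_one_fY, T_neg_one_fY, T_one_T, T_neg_T, zpow_add_one₀ hQ, e1, e2,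
      show (-1 - 1 : ℤ) = -2 by rfl, show cst (qc q) = fQ q from rfl]
    field_simp
  ga_de := by
    ext g k
    have hQ := fQ_ne_zero (q := q)
    have hw := zpow_ne_zero k hQ
    have h3 := br_ne_zero (q := q) (-2 * k - 1)
    have h4 := br_ne_zero (q := q) (-2 * k)
    have e1 : (-2 * (k - 1) - 1 - 1 : ℤ) = -2 * k := by ring
    simp only [Module.End.mul_apply, repOp_apply, repCoef_inR, repCoef_kst, map_mul, add_zero,
      repD, fFm_eq_br, map_div₀, map_add, map_zpow₀, map_pow, map_inv₀, map_one, T_fQ, T_one_br,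
      T_two_br, T_one_fY, Pi.one_apply, one_mul, ← sub_eq_add_neg, zpow_sub_one₀ hQ, e1,
      show cst (qc q) = fQ q from rfl]
    field_simp
  det1 := by
    ext g k
    have hQ := fQ_ne_zero (q := q)
    have hw := zpow_ne_zero k hQ
    have h1 := (div_ne_zero_iff.1 (br_neg_one (q := q) ▸ br_ne_zero (q := q) (-1))).1
    have h2 := (div_ne_zero_iff.1 (br_neg_two (q := q) ▸ br_ne_zero (q := q) (-2))).1
    have h4 := (div_ne_zero_iff.1 (br_neg_two_mul (q := q) k ▸ br_ne_zero (q := q) (-2 * k))).1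
    have e2 : (-2 * (k - 1) - 1 - 1 : ℤ) = -2 * k := by ring
    have e3 : (-2 * k - 1 + 1 : ℤ) = -2 * k := by ring
    simp only [Module.End.mul_apply, Module.End.one_apply, LinearMap.sub_apply, Pi.sub_apply,
      repOp_apply, repCoef_inL, repCoef_kst, map_mul, add_zero, repA, repB,
      repD, fF_eq, map_div₀, map_add, map_zpow₀, map_pow, map_inv₀, map_one, T_fQ, T_one_br,
      T_neg_one_br, T_one_fY, T_neg_one_fY, T_one_T, T_neg_T, Pi.one_apply, one_mul,
      ← sub_eq_add_neg, zpow_sub_one₀ hQ, e2, e3, sub_add_cancel, show (-1 - 1 : ℤ) = -2 by rfl,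
      show cst (qc q) = fQ q from rfl]
    rw [br_neg_one, br_neg_two, br_neg_two_mul]
    generalize fQ q ^ k = w at *
    generalize fQ q = Q at *
    generalize fY q = Y at *
    field_simp
    ring
  det2 := by
    ext g k
    have hQ := fQ_ne_zero (q := q)
    have hw := zpow_ne_zero k hQ
    have h2 := (div_ne_zero_iff.1 (br_neg_two (q := q) ▸ br_ne_zero (q := q) (-2))).1
    have h3 := (div_ne_zero_iff.1
      (br_neg_two_mul_sub_one (q := q) k ▸ br_ne_zero (q := q) (-2 * k - 1))).1
    have h4 := (div_ne_zero_iff.1 (br_neg_two_mul (q := q) k ▸ br_ne_zero (q := q) (-2 * k))).1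
    have e2 : (-2 * (k - 1) - 1 - 1 : ℤ) = -2 * k := by ring
    simp only [Module.End.mul_apply, Module.End.one_apply, LinearMap.sub_apply, Pi.sub_apply,
      repOp_apply, repCoef_inR, repCoef_kst, map_mul, add_zero, repA, repB,
      repD, fFm_eq_br, map_div₀, map_add, map_zpow₀, map_pow, map_inv₀, T_fQ, T_one_br,
      T_two_br, T_one_fY, T_one_T, Pi.one_apply, one_mul,
      ← sub_eq_add_neg, zpow_sub_one₀ hQ, e2, sub_add_cancel, show (-1 - 1 : ℤ) = -2 by rfl,
      show cst (qc q)⁻¹ = (fQ q)⁻¹ from map_inv₀ _ _]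
    rw [br_neg_two, br_neg_two_mul, br_neg_two_mul_sub_one]
    generalize fQ q ^ k = w at *
    generalize fQ q = Q at *
    generalize fY q = Y at *
    field_simp
    ring
  det3 := by
    ext g k
    have hQ := fQ_ne_zero (q := q)
    have hw := zpow_ne_zero k hQ
    have h1 := (div_ne_zero_iff.1 (br_neg_one (q := q) ▸ br_ne_zero (q := q) (-1))).1
    have h2 := (div_ne_zero_iff.1 (br_neg_two (q := q) ▸ br_ne_zero (q := q) (-2))).1
    have h3 := (div_ne_zero_iff.1
      (br_neg_two_mul_sub_one (q := q) k ▸ br_ne_zero (q := q) (-2 * k - 1))).1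
    simp only [Module.End.mul_apply, LinearMap.sub_apply, Pi.sub_apply,
      repOp_apply, repCoef_inL, repCoef_inR, repCoef_kst, map_mul, add_zero, repA, repB,
      repD, fF_eq, map_div₀, map_zpow₀, T_fQ, T_one_br,
      T_two_br, T_one_T, T_neg_T, Pi.one_apply, one_mul,
      ← sub_eq_add_neg, add_sub_cancel_right, show (-1 - 1 : ℤ) = -2 by rfl,
      show cst (qc q)⁻¹ = (fQ q)⁻¹ from map_inv₀ _ _]
    rw [br_neg_one, br_neg_two, br_neg_two_mul_sub_one, br_neg_two_mul_sub_two]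
    generalize fQ q ^ k = w at *
    generalize fQ q = Q at *
    generalize fY q = Y at *
    field_simp
    ring

/-! ### Supports and linear independence -/

/-- The functions on `ℤ` with support `{n}`. -/
def IsSingle (n : ℤ) (g : ℤ → Mer) : Prop := g n ≠ 0 ∧ ∀ m ≠ n, g m = 0

theorem repA_ne_zero (k : ℤ) : repA q k ≠ 0 :=
  div_ne_zero (zpow_ne_zero k fQ_ne_zero) (br_ne_zero _)

theorem isSingle_al {n : ℤ} {g : ℤ → Mer} (h : IsSingle n g) : IsSingle n ((repData q).al g) := by
  change IsSingle n (repOp (repA q) (-1) 0 g)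
  refine ⟨?_, fun m hm => ?_⟩
  · rw [repOp_apply, add_zero]
    exact mul_ne_zero (repA_ne_zero n) ((map_ne_zero _).2 h.1)
  · rw [repOp_apply, add_zero, h.2 m hm, map_zero, mul_zero]

theorem isSingle_ga {n : ℤ} {g : ℤ → Mer} (h : IsSingle n g) :
    IsSingle (n + 1) ((repData q).ga g) := by
  change IsSingle (n + 1) (repOp 1 1 (-1) g)
  refine ⟨?_, fun m hm => ?_⟩
  · rw [repOp_apply, add_neg_cancel_right, Pi.one_apply, one_mul]
    exact (map_ne_zero _).2 h.1
  · rw [repOp_apply, h.2 (m + -1) (fun e => hm (by rw [← e, neg_add_cancel_right])), map_zero,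
      mul_zero]

/-- The representation applied to the function that is `1` at `0`, and `0` elsewhere. -/
def repVec (x : FR q) : ℤ → Mer := (repData q).lift x (Pi.single 0 1)

theorem repVec_smul (f : Mer) (x : FR q) (n : ℤ) : repVec (f • x) n = f * repVec x n := by
  rw [repVec, FR.smul_def, map_mul, RepData.lift_muL, Module.End.mul_apply]
  exact repCoef_inL f _ n

/-- α acts diagonally with nonvanishing coefficients and γ moves the index by one, so the support of
the image counts the factors γ. -/
theorem isSingle_repVec_ga_pow_mul (m k : ℕ) :
    IsSingle (m : ℤ) (repVec (FR.ga q ^ m * FR.al q ^ k)) := by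
  induction m with
  | zero =>
    rw [pow_zero, one_mul]
    induction k with
    | zero =>
      rw [pow_zero, repVec, map_one]
      exact ⟨by simp, fun m hm => Pi.single_eq_of_ne (by simpa using hm) _⟩
    | succ k ih =>
      rw [pow_succ', repVec, map_mul, RepData.lift_al]
      exact isSingle_al (q := q) ih
  | succ m ih =>
    rw [pow_succ', mul_assoc, repVec, map_mul, RepData.lift_ga, Nat.cast_succ]
    exact isSingle_ga (q := q) ih

/-- The images of the v_i have the disjoint supports {N-i}, and f(λ) acts by multiplication at every
index. Evaluating a relation at N - k isolates the k-th coefficient. -/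
theorem linearIndependent_vN (N : ℕ) :
    LinearIndependent Mer fun k : Fin (N + 1) => vN q N k := by
  rw [Fintype.linearIndependent_iff]
  intro c hc k
  have h : ∑ i : Fin (N + 1), c i * repVec (vN q N i) ((N - (k : ℕ) : ℕ) : ℤ) = 0 := by
    have h1 := congrArg (fun x : FR q => repVec x ((N - (k : ℕ) : ℕ) : ℤ)) hc
    simp only [repVec, map_sum, LinearMap.sum_apply, Finset.sum_apply, map_zero,
      LinearMap.zero_apply, Pi.zero_apply] at h1
    rw [← h1]
    exact Finset.sum_congr rfl fun i _ => (repVec_smul _ _ _).symm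
  rw [Finset.sum_eq_single k] at h
  · exact (mul_eq_zero.1 h).resolve_right (isSingle_repVec_ga_pow_mul _ _).1
  · intro i _ hi
    rw [vN, (isSingle_repVec_ga_pow_mul _ _).2 _ fun e => hi (Fin.ext ?_), mul_zero]
    have := i.isLt; have := k.isLt; omega
  · exact fun hk => absurd (Finset.mem_univ k) hk

/-! ## The grading of `V_N` -/

/-- The function `z ↦ z`. -/
def fZ : Mer := Mer.mk (fun z => z) (fun _ => analyticAt_id.meromorphicAt)

theorem T_fZ (a : ℂ) : Mer.T a fZ = fZ + cst a := rfl

/-- Right multiplication by the function `λ`, which acts on `A_a` as the scalar `λ - a`. -/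
def mulRightZ (q : QParam) : Module.End Mer (FR q) where
  toFun x := x * FR.muL q fZ
  map_add' x y := add_mul _ _ _
  map_smul' f x := by rw [FR.smul_def, mul_assoc]; rfl

theorem mulRightZ_of_mem_grL {a : ℂ} {x : FR q} (hx : x ∈ FR.grL q a) :
    mulRightZ q x = (fZ - cst a) • x := by
  induction hx using Submodule.span_induction with
  | mem x hx =>
    obtain ⟨b, hb⟩ := hx
    change x * FR.muL q fZ = _
    rw [FR.gr_mul_muL hb, T_fZ, map_neg, ← sub_eq_add_neg, FR.smul_def]
  | zero => rw [map_zero, smul_zero]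
  | add x y _ _ hx hy => rw [map_add, hx, hy, smul_add]
  | smul f x _ hx => rw [map_smul, hx, smul_comm]

/-- A_a lies in the eigenspace of `mulRightZ` for the eigenvalue λ - a, and these eigenvalues in M
are distinct. -/
theorem iSupIndep_grL (q : QParam) : iSupIndep (FR.grL q) := by
  refine (((mulRightZ q).eigenspaces_iSupIndep.comp (f := fun a : ℂ => fZ - cst a) ?_)).mono ?_
  · intro a b h
    exact (algebraMap ℂ Mer).injective (sub_right_injective h)
  · intro a x hx
    exact Module.End.mem_eigenspace_iff.2 (mulRightZ_of_mem_grL hx)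

theorem iSupIndep_VNgr (q : QParam) (N : ℕ) : iSupIndep (VNgr q N) := by
  intro a
  rw [Submodule.disjoint_def]
  intro x hx hx'
  refine Subtype.ext ((Submodule.disjoint_def.1 (iSupIndep_grL q a)) _ hx ?_)
  have h : (⨆ b, ⨆ _ : b ≠ a, VNgr q N b) ≤
      (⨆ b, ⨆ _ : b ≠ a, FR.grL q b).comap (VN q N).subtype :=
    iSup₂_le fun b hb => Submodule.comap_mono (le_iSup₂_of_le b hb le_rfl)
  exact h hx'

/-! ## The basis of `V_N` -/

/-- The basis `γ^{N-k} α^k` of `V_N`. -/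
def basisVN (q : QParam) (N : ℕ) : Module.Basis (Fin (N + 1)) Mer (VN q N) :=
  (Module.Basis.span (linearIndependent_vN (q := q) N)).map (LinearEquiv.ofEq _ _ (by
    rw [VN]
    congr 1
    ext x
    constructor
    · rintro ⟨k, rfl⟩
      exact ⟨k, Nat.lt_succ_iff.1 k.isLt, rfl⟩
    · rintro ⟨k, hk, rfl⟩
      exact ⟨⟨k, Nat.lt_succ_iff.2 hk⟩, rfl⟩))

theorem coe_basisVN (N : ℕ) (k : Fin (N + 1)) : (basisVN q N k : FR q) = vN q N k := by
  rw [basisVN, Module.Basis.map_apply, LinearEquiv.coe_ofEq_apply, Module.Basis.span_apply]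

theorem vN_mem_gr {N k : ℕ} (hk : k ≤ N) : vN q N k ∈ FR.gr q (2 * k - N) N := by
  have h := (IsMon.ga (q := q)).pow (N - k) |>.mul ((IsMon.al (q := q)).pow k)
  refine Submodule.subset_span ?_
  change IsMon q _ _ (FR.ga q ^ (N - k) * FR.al q ^ k)
  convert h using 1
  · rw [Nat.cast_sub hk]; ring
  · rw [Nat.cast_sub hk]; ring

theorem basisVN_mem (N : ℕ) (k : Fin (N + 1)) :
    basisVN q N k ∈ VNgr q N (2 * (k : ℕ) - N) := by
  change (basisVN q N k : FR q) ∈ FR.grL q _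
  rw [coe_basisVN]
  exact Submodule.subset_span ⟨_, vN_mem_gr (Nat.lt_succ_iff.1 k.isLt)⟩

theorem isInternal_VNgr (q : QParam) (N : ℕ) : DirectSum.IsInternal (VNgr q N) := by
  refine DirectSum.isInternal_submodule_of_iSupIndep_of_iSup_eq_top (iSupIndep_VNgr q N) ?_
  rw [eq_top_iff, ← (basisVN q N).span_eq, Submodule.span_le]
  rintro _ ⟨k, rfl⟩
  exact le_iSup (VNgr q N) _ (basisVN_mem N k)

/-- Right multiplication by λ has the eigenvalue λ - a on v and λ - (2i-N) on the i-th basis vector.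
Comparing coordinates, each is annihilated by the constant a - (2i-N). -/
theorem basisVN_repr_eq_zero {N : ℕ} {a : ℂ} {v : VN q N} (hv : v ∈ VNgr q N a)
    (k : Fin (N + 1)) (ha : a ≠ 2 * (k : ℕ) - N) : (basisVN q N).repr v k = 0 := by
  have hsum : ∑ i, (basisVN q N).repr v i • vN q N i = (v : FR q) := by
    have := congrArg (VN q N).subtype ((basisVN q N).sum_repr v)
    rw [map_sum] at this
    rw [← Submodule.subtype_apply, ← this]
    refine Finset.sum_congr rfl fun i _ => ?_
    rw [map_smul, Submodule.subtype_apply, coe_basisVN]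
  have h1 := mulRightZ_of_mem_grL (show (v : FR q) ∈ FR.grL q a from hv)
  rw [← hsum, map_sum, Finset.smul_sum, ← sub_eq_zero, ← Finset.sum_sub_distrib] at h1
  have h2 : ∑ i, ((basisVN q N).repr v i * cst (a - (2 * (i : ℕ) - N))) • vN q N i = 0 := by
    rw [← h1]
    refine Finset.sum_congr rfl fun i _ => ?_
    have hi := mulRightZ_of_mem_grL (show (basisVN q N i : FR q) ∈ FR.grL q _ from basisVN_mem N i)
    rw [coe_basisVN] at hi
    rw [map_smul, hi, smul_smul, smul_smul, ← sub_smul, map_sub]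
    congr 1
    ring
  have h3 := Fintype.linearIndependent_iff.1 (linearIndependent_vN N) _ h2 k
  refine (mul_eq_zero.1 h3).resolve_right ?_
  rw [cst, map_eq_zero]
  exact sub_ne_zero.2 ha

/-! ## The corepresentation on `V_N` -/

/-- A linear projection of `A` onto `V_N`. -/
def projVN (q : QParam) (N : ℕ) : FR q →ₗ[Mer] VN q N :=
  ((VN q N).subtype.exists_leftInverse_of_injective (VN q N).ker_subtype).choose

theorem projVN_comp_subtype (N : ℕ) : projVN q N ∘ₗ (VN q N).subtype = LinearMap.id :=
  ((VN q N).subtype.exists_leftInverse_of_injective (VN q N).ker_subtype).choose_spec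

/-- Over the field M the subspace V_N is a direct summand, so the inclusion stays injective after
tensoring twice and coassociativity can be tested inside A. -/
theorem map_map_subtype_injective (N : ℕ) :
    Function.Injective (Tens.map (q := q) (Tens.map (q := q) (VN q N).subtype)) :=
  Function.LeftInverse.injective (map_leftInverse (ψ := Tens.map (projVN q N))
    (LinearMap.ext fun x => map_leftInverse (projVN_comp_subtype N) x))

/-- The restriction of the coproduct to `V_N`. -/
def corepVN (q : QParam) (N : ℕ) : VN q N →ₗ[Mer] Tens q (VN q N) :=
  Tens.map (projVN q N) ∘ₗ coprodLin q ∘ₗ (VN q N).subtype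

theorem coprod_basisVN (N : ℕ) (k : Fin (N + 1)) : FR.coprod q (basisVN q N k) =
    Tens.map (VN q N).subtype (∑ j : Fin (N + 1), tm (tE q N k j) (basisVN q N j)) := by
  rw [coe_basisVN, coprod_vN (Nat.lt_succ_iff.1 k.isLt), map_sum, Finset.sum_range]
  refine Finset.sum_congr rfl fun j _ => ?_
  rw [map_tm, Submodule.subtype_apply, coe_basisVN]

theorem corepVN_basisVN (N : ℕ) (k : Fin (N + 1)) :
    corepVN q N (basisVN q N k) = ∑ j : Fin (N + 1), tm (tE q N k j) (basisVN q N j) := by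
  change Tens.map (projVN q N) (FR.coprod q (basisVN q N k)) = _
  rw [coprod_basisVN, map_leftInverse (projVN_comp_subtype N)]

/-- The projection in `corepVN` loses nothing: on basis vectors the coproduct already has its second
leg in V_N. -/
theorem map_subtype_corepVN (N : ℕ) (v : VN q N) :
    Tens.map (VN q N).subtype (corepVN q N v) = FR.coprod q v := by
  have h : Tens.map (VN q N).subtype ∘ₗ corepVN q N = coprodLin q ∘ₗ (VN q N).subtype := by
    refine (basisVN q N).ext fun k => ?_
    rw [LinearMap.comp_apply, corepVN_basisVN, ← coprod_basisVN]; rfl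
  exact LinearMap.congr_fun h v

/-- A homogeneous vector of degree a has nonzero coordinates only at indices with 2k - N = a, where
the bidegrees of t_{kj} and v_j fit together. -/
theorem corepVN_mem {N : ℕ} {a : ℂ} {v : VN q N} (hv : v ∈ VNgr q N a) :
    corepVN q N v ∈ tensGr q (VNgr q N) a := by
  rw [← (basisVN q N).sum_repr v, map_sum]
  refine Submodule.sum_mem _ fun k _ => ?_
  rw [map_smul]
  by_cases ha : a = 2 * (k : ℕ) - N
  · refine Submodule.smul_mem _ _ ?_
    rw [corepVN_basisVN, ha]
    exact Submodule.sum_mem _ fun j _ => Submodule.subset_span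
      ⟨_, _, tE_mem_gr (Nat.lt_succ_iff.1 k.isLt) j, _, basisVN_mem N j, rfl⟩
  · rw [basisVN_repr_eq_zero hv k ha, zero_smul]
    exact Submodule.zero_mem _

theorem isCorep_corepVN (q : QParam) (N : ℕ) : IsCorep (VNgr q N) (corepVN q N) where
  internal := isInternal_VNgr q N
  graded _ _ hv := corepVN_mem hv
  coassoc v := by
    refine map_map_subtype_injective N ?_
    have h : Tens.map (VN q N).subtype ∘ₗ corepVN q N = coprodLin q ∘ₗ (VN q N).subtype :=
      LinearMap.ext (map_subtype_corepVN N)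
    rw [map_map_coprodTens, map_map, h, ← map_map, map_subtype_corepVN]
    exact coassoc_of_mem_VN v.2
  counit v := by
    refine (VN q N).subtype_injective ?_
    rw [map_counitTens, map_subtype_corepVN]
    exact counit_of_mem_VN v.2

theorem isNormalizing_corepVN (q : QParam) (N : ℕ) :
    IsNormalizing (corepVN q N) (basisVN q N)
      (fun k => Finsupp.equivFunOnFinite.symm fun j => tN q N k j)
      (fun k => normFun q N k) where
  matrix_elements k := by
    rw [corepVN_basisVN,
      Finsupp.sum_fintype _ (fun j a => tm a (basisVN q N j)) fun j => zero_tm _]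
    refine Finset.sum_congr rfl fun j _ => ?_
    rw [Finsupp.equivFunOnFinite_symm_apply_apply, tE_eq_tN (Nat.lt_succ_iff.1 k.isLt)]
  ne_zero k := by
    rw [← Gam_eq (Nat.lt_succ_iff.1 k.isLt)]
    exact Gam_ne_zero (Nat.lt_succ_iff.1 k.isLt)
  bar_eq k := by
    rw [← Gam_eq (Nat.lt_succ_iff.1 k.isLt)]
    exact bar_Gam _ _
  unitarity k j := by
    have hk := Nat.lt_succ_iff.1 k.isLt
    have hj := Nat.lt_succ_iff.1 j.isLt
    rw [Finsupp.equivFunOnFinite_symm_apply_apply, Finsupp.equivFunOnFinite_symm_apply_apply,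
      tE_eq_tN hk, tE_eq_tN hj, ← Gam_eq hk, ← Gam_eq hj]
    exact unitarity_tE hk hj

end DynSU2

end

/-! ### Assembly of the three statements -/

open DynSU2
theorem mainTheorem4 (q : QParam) (N : ℕ) :
    (∀ k ≤ N, ∀ j ≤ N,
      FR.muR q (normFun q N k) * FR.star q (FR.antipode q (tN q N k j)) =
        FR.muL q (normFun q N j) * tN q N j k) ∧
    (∃ π : VN q N →ₗ[Mer] Tens q (VN q N),
      (∀ v, Tens.map (VN q N).subtype (π v) = FR.coprod q v) ∧
      IsUnitarizable (VNgr q N) π ∧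
      ∃ b : Module.Basis (Fin (N + 1)) Mer (VN q N),
        (∀ k, (b k : FR q) = vN q N k ∧ b k ∈ VNgr q N (2 * (k : ℕ) - N)) ∧
        IsNormalizing π b (fun k => Finsupp.equivFunOnFinite.symm fun j => tN q N k j)
          (fun k => normFun q N k)) ∧
    (∀ k ≤ N, ∀ l ≤ N,
      ∑ j ∈ Finset.range (N + 1), FR.star q (tN q N j k) *
        (FR.muL q (normFun q N j) * FR.muR q (normFun q N k)⁻¹) * tN q N j l =
          if k = l then 1 else 0) ∧
    (∀ k ≤ N, ∀ l ≤ N,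
      ∑ j ∈ Finset.range (N + 1), tN q N k j * FR.star q (tN q N l j) *
        (FR.muL q (normFun q N l) * FR.muR q (normFun q N j)⁻¹) =
          if k = l then 1 else 0) := by
  refine ⟨fun k hk j hj => ?_, ⟨corepVN q N, map_subtype_corepVN N,
    ⟨isCorep_corepVN q N, Fin (N + 1), basisVN q N, _, _, _, basisVN_mem N,
      isNormalizing_corepVN q N⟩,
    basisVN q N, fun k => ⟨coe_basisVN N k, basisVN_mem N k⟩, isNormalizing_corepVN q N⟩,
    fun k hk l hl => ?_, fun k hk l hl => ?_⟩
  · rw [tE_eq_tN hk, tE_eq_tN hj, ← Gam_eq hk, ← Gam_eq hj]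
    exact unitarity_tE hk hj
  · rw [← sum_tE_star_left N k l hk]
    refine Finset.sum_congr rfl fun j hj => ?_
    have hj' : j ≤ N := Nat.lt_succ_iff.1 (Finset.mem_range.1 hj)
    rw [tE_eq_tN hj', tE_eq_tN hj', Gam_eq hj', Gam_eq hk]
  · rw [← sum_tE_star_right N k l hk hl]
    refine Finset.sum_congr rfl fun j hj => ?_
    have hj' : j ≤ N := Nat.lt_succ_iff.1 (Finset.mem_range.1 hj)
    rw [tE_eq_tN hk, tE_eq_tN hl, Gam_eq hj', Gam_eq hl]
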